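/- **Setting.** Let $p$ be an odd prime, $L$ a finite extension of $\mathbb{Q}_p$ with absolute ramification degree $e'$ and residue field $k$ of order $p^f$, and $k_E$ a finite field with embeddings $\sigma_i:k\hookrightarrow k_E$ ($i\in\mathbb{Z}/f\mathbb{Z}$) such that $\sigma_{i+1}^p=\sigma_i$. Let $I_L$ be the inertia subgroup of $G_L$. Fix $\pi\in\overline{\mathbb{Q}}_p$ such that $\pi^{p^f-1}$ is a uniformiser of $L$, and let $\omega_i:I_L\to k_E^\times$ be the fundamental character $g\mapsto\sigma_i\big(\overline{g(\pi)/\pi}\big)$. Let $\tilde\omega_i$ be the Teichmüller lift of $\omega_i$. Via the Artin map (uniformisers corresponding to geometric Frobenius elements), characters of $I_L$ that factor through $k^\times$ are identified with characters of $k^\times$; thus $\omega_i$ corresponds to $\sigma_i$. Let $\overline\rho:G_L\to \mathrm{GL}_2(k_E)$ be continuous and reducible, $\overline\rho\simeq\begin{pmatrix}\chi_2&*\\0&\chi_1\end{pmatrix}$, with the ordered pair $(\chi_1,\chi_2)$ fixed. Assume that $\overline\rho$ is *generic*: $\chi_1^{-1}\chi_2|_{I_L}=\prod_i\omega_i^{b_i+e'}$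 for integers $b_i$ with $e'\le b_i+e'\le p-1-e'$. Write $\chi_1|_{I_L}=\prod_i\omega_i^{c_i}$ with integers $c_i$. **Weights.** For $m\in\mathbb{Z}^f$ and $n\in\{0,\dots,p-1\}^f$ let $\mu_{m,n}$ be the (isomorphism class of the) representation $\bigotimes_{i}(\det^{m_i}\otimes\mathrm{Sym}^{n_i}k^2)\otimes_{k,\sigma_i}k_E$ of $\mathrm{GL}_2(k)$. Call $(J,d)$, with $J\subseteq\mathbb{Z}/f\mathbb{Z}$ and $d\in\mathbb{Z}^f$, *admissible* if $0\le d_i\le e'-1$ for $i\in J$ and $1\le d_i\le e'$ for $i\notin J$. Let $W'=W_{\mathrm{expl}}(\overline\rho^{\mathrm{ss}})$ be the set of all $\mu_{m,n}$ for which there is an admissible $(J,d)$ with $$\chi_2|_{I_L}=\prod_{i\in J}\omega_i^{m_i+n_i+e'-d_i}\prod_{i\notin J}\omega_i^{m_i+e'-d_i},\qquad \chi_1|_{I_L}=\prod_{i\in J}\omega_i^{m_i+d_i}\prod_{i\notin J}\omega_i^{m_i+n_i+d_i}.$$ For $(J,d)$ admissible let $\mu(J,d)=\mu_{m,n}$,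 where $$(m_i,n_i)=\begin{cases}(c_i+p-1-d_i,\ b_i+2d_i)& i\in J,\ i+1\in J,\\ (c_i+p-1-d_i,\ b_i+2d_i+1)& i\in J,\ i+1\notin J,\\ (c_i+b_i+d_i-1,\ p-b_i-2d_i)& i\notin J,\ i+1\in J,\\ (c_i+b_i+d_i,\ p-1-b_i-2d_i)& i\notin J,\ i+1\notin J,\end{cases}$$ and let $W$ be the set of all these $\mu(J,d)$. In two exceptional cases there is a further weight $\mu'(J,d)=\mu_{m,n}$ with all $n_i=p-1$: if $b=d=(0,\dots,0)$ and $J=\mathbb{Z}/f\mathbb{Z}$, take $m_i=c_i$; if $b=(p-1-2e',\dots,p-1-2e')$, $d=(e',\dots,e')$ and $J=\varnothing$, take $m_i=c_i-e'$. **Types.** Let $A=\{0,\dots,e'\}^f$. For $a\in A$ put $\psi_1=\prod_i\tilde\omega_i^{c_i+b_i+a_i}$ and $\psi_2=\prod_i\tilde\omega_i^{c_i-a_i}$. If $\psi_1\ne\psi_2$, let $\theta_a=\theta_a'=\mathrm{Ind}_B^{\mathrm{GL}_2(k)}(\psi_1\otimes\psi_2)$, where $B$ is the group of upper triangular matrices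 in $\mathrm{GL}_2(k)$ and $\psi_1\otimes\psi_2$ sends $\begin{pmatrix}x&*\\0&y\end{pmatrix}$ to $\psi_1(x)\psi_2(y)$. If $\psi_1=\psi_2$, let $\theta_a=\psi_1\circ\det$ and $\theta_a'=\theta_a\otimes\mathrm{Ind}_B^{\mathrm{GL}_2(k)}\mathbf 1$. Let $W_a$ (resp. $W'_a$) be the set of $\mu\in W'$ that are Jordan–Hölder constituents of the reduction modulo $p$ of $\theta_a$ (resp. $\theta'_a$). **Proposition.** 1. $W$ (resp. $W'$) is the disjoint union of the $W_a$ (resp. $W'_a$) for $a\in A$. 2. $|W_a|=2^{f-\delta_a}$ for $a\in A$, where $\delta_a=|\{\,i : a_i=0\text{ or }a_i=e'\,\}|$. 3. For $a\in A$: if $\mu(J,d)\in W'_a$ ($(J,d)$ admissible), or $\mu'(J,d)\in W'_a$ ($(J,d)$ exceptional), then $\sum_i a_i=\sum_i d_i$. -/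

import Mathlib

open scoped NNReal TensorProduct

noncomputable section

namespace SerreWeights

/-! ### Local fields, inertia, and the tame characters

A finite extension `L` of `ℚ_p` is a subfield of the fixed algebraic closure `PadicAlgCl p` of
`ℚ_p`, which carries the unique norm extending the `p`-adic one. -/

section LocalField

variable {p : ℕ} [Fact p.Prime]

/-- The ring of integers of `L`, i.e. the elements of norm at most one. -/
abbrev ringOfIntegers (L : IntermediateField ℚ_[p] (PadicAlgCl p)) : ValuationSubring L :=
  ((Valued.v : Valuation (PadicAlgCl p) ℝ≥0).comap
    (algebraMap L (PadicAlgCl p))).valuationSubring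

/-- The residue field of `L`. -/
abbrev residueField (L : IntermediateField ℚ_[p] (PadicAlgCl p)) : Type :=
  IsLocalRing.ResidueField (ringOfIntegers L)

/-- The absolute Galois group of `L`, a topological group for the Krull topology. -/
abbrev absGal (L : IntermediateField ℚ_[p] (PadicAlgCl p)) : Type :=
  Gal(PadicAlgCl p/L)

theorem mem_ringOfIntegers (L : IntermediateField ℚ_[p] (PadicAlgCl p)) (x : L) :
    x ∈ ringOfIntegers L ↔ ‖(x : PadicAlgCl p)‖ ≤ 1 := by
  rw [← PadicAlgCl.valuation_coe]
  exact Iff.rfl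

theorem norm_absGal {L : IntermediateField ℚ_[p] (PadicAlgCl p)} (g : absGal L)
    (x : PadicAlgCl p) : ‖g x‖ = ‖x‖ :=
  (spectralNorm_eq_of_equiv (K := ℚ_[p]) (g.restrictScalars ℚ_[p]) x).symm

/-- The inertia subgroup: the automorphisms acting trivially on the residue field of the
algebraic closure. -/
def inertia (L : IntermediateField ℚ_[p] (PadicAlgCl p)) : Subgroup (absGal L) where
  carrier := {g | ∀ x : PadicAlgCl p, ‖x‖ ≤ 1 → ‖g x - x‖ < 1}
  one_mem' := fun x _ => by simp
  mul_mem' := fun {a b} ha hb x hx => by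
    have h1 := ha (b x) (by rwa [norm_absGal])
    have h2 := hb x hx
    have h3 : (a * b) x - x = (a (b x) - b x) + (b x - x) := by
      rw [AlgEquiv.mul_apply]; ring
    rw [h3]
    exact (IsUltrametricDist.norm_add_le_max _ _).trans_lt (max_lt h1 h2)
  inv_mem' := fun {a} ha x hx => by
    have h1 := ha (a⁻¹ x) (by rwa [norm_absGal])
    have h2 : a (a⁻¹ x) = x := AlgEquiv.apply_symm_apply a x
    rw [h2] at h1
    rwa [norm_sub_rev]

/-- `L` has residue field with `p ^ f` elements and absolute ramification degree `e`, and `π` is a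
`(p ^ f - 1)`-st root of a uniformiser of `L` (so that `L(π)` is a totally tamely ramified
extension of `L` of degree `p ^ f - 1`). -/
structure IsLocalSetting (L : IntermediateField ℚ_[p] (PadicAlgCl p)) (f e : ℕ)
    (π : PadicAlgCl p) : Prop where
  card_residueField : Nat.card (residueField L) = p ^ f
  ne_zero : π ≠ 0
  pow_mem : π ^ (p ^ f - 1) ∈ L
  norm_pow_lt_one : ‖π ^ (p ^ f - 1)‖ < 1
  norm_le : ∀ x ∈ L, ‖x‖ < 1 → ‖x‖ ≤ ‖π ^ (p ^ f - 1)‖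
  ramification : ‖π ^ (p ^ f - 1)‖ ^ e = ‖(p : PadicAlgCl p)‖

open Classical in
/-- The function `g ↦ g(π)/π` on `G_L`, reduced to an element of the residue field of `L`. On
inertia this is the fundamental character `I_L → 𝒪_L^× → k^×` given by the Artin map (normalised
so that uniformisers correspond to geometric Frobenius elements). The second branch is never
taken, see `IsLocalSetting.exists_residue`. -/
def tameCharacter (L : IntermediateField ℚ_[p] (PadicAlgCl p)) (π : PadicAlgCl p)
    (g : absGal L) : residueField L :=
  if h : ∃ u : ringOfIntegers L, ‖g π / π - ((u : L) : PadicAlgCl p)‖ < 1 then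
    IsLocalRing.residue (ringOfIntegers L) h.choose
  else 0

theorem IsLocalSetting.exists_residue {L : IntermediateField ℚ_[p] (PadicAlgCl p)} {f e : ℕ}
    {π : PadicAlgCl p} (h : IsLocalSetting L f e π) (g : absGal L) :
    ∃ u : ringOfIntegers L, ‖g π / π - ((u : L) : PadicAlgCl p)‖ < 1 := by
  classical
  have hp : p.Prime := Fact.out
  have hfin : Finite (residueField L) := Nat.finite_of_card_ne_zero (by
    rw [h.card_residueField]
    exact pow_ne_zero _ hp.ne_zero)
  have hft : Fintype (residueField L) := Fintype.ofFinite _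
  set q := p ^ f with hq
  have hcard : Fintype.card (residueField L) = q := by
    rw [← Nat.card_eq_fintype_card, h.card_residueField]
  have hq1 : 1 < q := by
    rw [← hcard]
    exact Fintype.one_lt_card
  let OC : ValuationSubring (PadicAlgCl p) :=
    (Valued.v : Valuation (PadicAlgCl p) ℝ≥0).valuationSubring
  have hunit : ∀ y : OC, ‖(y : PadicAlgCl p)‖ < 1 ↔ IsLocalRing.residue OC y = 0 := fun y => by
    rw [IsLocalRing.residue_eq_zero_iff, ValuationSubring.valuation_lt_one_iff]
    exact Valuation.isEquiv_iff_val_lt_one.1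
      (Valuation.isEquiv_valuation_valuationSubring
        (Valued.v : Valuation (PadicAlgCl p) ℝ≥0))
  let φ : ringOfIntegers L →+* OC :=
    ((algebraMap L (PadicAlgCl p)).comp (ringOfIntegers L).subtype).codRestrict OC fun x => x.2
  have hφ : ∀ x, ((φ x : OC) : PadicAlgCl p) = ((x : L) : PadicAlgCl p) := fun _ => rfl
  have hker : ∀ x ∈ IsLocalRing.maximalIdeal (ringOfIntegers L),
      (IsLocalRing.residue OC).comp φ x = 0 := fun x hx => by
    rw [RingHom.comp_apply, ← hunit, hφ]
    rw [ValuationSubring.valuation_lt_one_iff] at hx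
    exact (Valuation.isEquiv_iff_val_lt_one.1
      (Valuation.isEquiv_valuation_valuationSubring
        ((Valued.v : Valuation (PadicAlgCl p) ℝ≥0).comap (algebraMap L (PadicAlgCl p))))).2 hx
  let ι : residueField L →+* IsLocalRing.ResidueField OC := Ideal.Quotient.lift _ _ hker
  have hι : ∀ x, ι (IsLocalRing.residue _ x) = IsLocalRing.residue OC (φ x) := fun x =>
    Ideal.Quotient.lift_mk _ _ _
  have hgπ : (g π) ^ (q - 1) = π ^ (q - 1) := by
    rw [← map_pow]
    exact g.commutes ⟨_, h.pow_mem⟩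
  have hz : (g π / π) ^ q = g π / π := by
    have h1 : (g π / π) ^ (q - 1) = 1 := by
      rw [div_pow, hgπ, div_self (pow_ne_zero _ h.ne_zero)]
    conv_lhs => rw [← Nat.sub_add_cancel hq1.le, pow_succ, h1, one_mul]
  have hzn : ‖g π / π‖ = 1 := by
    rw [norm_div, norm_absGal, div_self (norm_ne_zero_iff.2 h.ne_zero)]
  let z : OC := ⟨g π / π, by
    rw [Valuation.mem_valuationSubring_iff]
    exact hzn.le⟩
  have hzq : (IsLocalRing.residue OC z) ^ q = IsLocalRing.residue OC z := by
    rw [← map_pow]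
    congr 1
    exact Subtype.ext hz
  have hroots := FiniteField.roots_X_pow_card_sub_X (residueField L)
  rw [hcard] at hroots
  have hmap : ((Polynomial.X ^ q - Polynomial.X : Polynomial (residueField L)).map ι).roots =
      (Polynomial.X ^ q - Polynomial.X : Polynomial (residueField L)).roots.map ι := by
    refine Polynomial.Splits.roots_map (Polynomial.splits_iff_card_roots.2 ?_) ι
    rw [hroots, FiniteField.X_pow_card_sub_X_natDegree_eq _ hq1, ← hcard]
    rfl
  have hmem : IsLocalRing.residue OC z ∈
      (Polynomial.X ^ q - Polynomial.X : Polynomial (residueField L)).roots.map ι := by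
    rw [← hmap, Polynomial.map_sub, Polynomial.map_pow, Polynomial.map_X,
      Polynomial.mem_roots (FiniteField.X_pow_card_sub_X_ne_zero _ hq1)]
    simp [hzq]
  obtain ⟨x, -, hx⟩ := Multiset.mem_map.1 hmem
  obtain ⟨u, rfl⟩ := IsLocalRing.residue_surjective x
  refine ⟨u, (hunit (z - φ u)).2 ?_⟩
  rw [map_sub, ← hι, hx, sub_self]

end LocalField

/-! ### Representations of `GL₂` of a finite field -/

section Representations

variable {R G V : Type*} [CommRing R] [Group G] [AddCommGroup V] [Module R V]

/-- The twist of a representation by a character. -/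
def twist (χ : G →* Rˣ) (ρ : Representation R G V) : Representation R G V where
  toFun g := (χ g : R) • ρ g
  map_one' := by simp
  map_mul' g h := by
    refine LinearMap.ext fun v => ?_
    simp only [map_mul, Units.val_mul, LinearMap.smul_apply, Module.End.mul_apply, map_smul]
    rw [mul_comm, mul_smul]

/-- The one-dimensional representation given by a character. -/
def charRep (χ : G →* Rˣ) : Representation R G R :=
  twist χ (Representation.trivial R G R)

/-- Tensor product over `R` of a family of representations of `G`. -/
def piTensor {ι : Type*} {U : ι → Type*} [∀ i, AddCommGroup (U i)] [∀ i, Module R (U i)]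
    (ρ : ∀ i, Representation R G (U i)) :
    Representation R G (PiTensorProduct R U) :=
  PiTensorProduct.mapMonoidHom.comp (MonoidHom.pi ρ)

/-- Isomorphism of representations. -/
def IsoRep {U W : Type*} [AddCommMonoid U] [Module R U] [AddCommMonoid W] [Module R W]
    (ρ : Representation R G U) (ρ' : Representation R G W) : Prop :=
  Nonempty (ρ.Equiv ρ')

theorem IsoRep.trans {U W X : Type*} [AddCommMonoid U] [Module R U] [AddCommMonoid W] [Module R W]
    [AddCommMonoid X] [Module R X] {ρ : Representation R G U} {ρ' : Representation R G W}
    {ρ'' : Representation R G X} (h : IsoRep ρ ρ') (h' : IsoRep ρ' ρ'') : IsoRep ρ ρ'' := by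
  obtain ⟨φ⟩ := h
  obtain ⟨ψ⟩ := h'
  exact ⟨Representation.Equiv.trans φ ψ⟩

/-- `σ` is a Jordan–Hölder constituent of the finite-dimensional representation `ρ`: it is
irreducible and isomorphic to a subquotient `M / N` of `ρ`. -/
def IsJHConstituent {F U W : Type*} [Field F] [AddCommGroup U] [Module F U]
    [AddCommGroup W] [Module F W]
    (σ : Representation F G U) (ρ : Representation F G W) : Prop :=
  σ.IsIrreducible ∧
    ∃ N M : Submodule (MonoidAlgebra F G) ρ.asModule, N ≤ M ∧
      Nonempty ((M ⧸ N.submoduleOf M) ≃ₗ[MonoidAlgebra F G] σ.asModule)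

/-- The substitution `X j ↦ ∑ i, g i j • X i`, by which `g` acts on the symmetric algebra of the
standard representation `F²` with basis vectors `X 0`, `X 1`. -/
def symSubst {F : Type*} [Field F] (g : GL (Fin 2) F) :
    MvPolynomial (Fin 2) F →ₐ[F] MvPolynomial (Fin 2) F :=
  MvPolynomial.aeval fun j => ∑ i : Fin 2, MvPolynomial.C (g.1 i j) * MvPolynomial.X i

theorem symSubst_one {F : Type*} [Field F] :
    symSubst (1 : GL (Fin 2) F) = AlgHom.id F (MvPolynomial (Fin 2) F) := by
  refine MvPolynomial.algHom_ext fun j => ?_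
  fin_cases j <;> simp [symSubst]

theorem symSubst_mul {F : Type*} [Field F] (g h : GL (Fin 2) F) :
    symSubst (g * h) = (symSubst g).comp (symSubst h) := by
  refine MvPolynomial.algHom_ext fun j => ?_
  simp only [symSubst, MvPolynomial.aeval_X, AlgHom.comp_apply, map_mul,
    Fin.sum_univ_two, Units.val_mul, Matrix.mul_apply, map_add, MvPolynomial.aeval_C,
    MvPolynomial.algebraMap_eq]
  ring

theorem symSubst_mem {F : Type*} [Field F] (g : GL (Fin 2) F) {n : ℕ}
    (P : MvPolynomial (Fin 2) F) (hP : P ∈ MvPolynomial.homogeneousSubmodule (Fin 2) F n) :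
    (symSubst g).toLinearMap P ∈ MvPolynomial.homogeneousSubmodule (Fin 2) F n := by
  have hX : ∀ j : Fin 2, (∑ i : Fin 2, MvPolynomial.C (g.1 i j) *
      (MvPolynomial.X i : MvPolynomial (Fin 2) F)).IsHomogeneous 1 := fun j =>
    MvPolynomial.IsHomogeneous.sum _ _ _ fun i _ => by
      simpa using (MvPolynomial.isHomogeneous_C (Fin 2) (g.1 i j)).mul
        (MvPolynomial.isHomogeneous_X F i)
  have h := MvPolynomial.IsHomogeneous.aeval hP _ hX
  rw [one_mul] at h
  exact h

/-- `Sym^n` of the standard representation of `GL₂(F)` on `F²`, realised on the homogeneous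
polynomials of degree `n` in the basis vectors of `F²`. -/
def symRep (F : Type*) [Field F] (n : ℕ) :
    Representation F (GL (Fin 2) F) (MvPolynomial.homogeneousSubmodule (Fin 2) F n) where
  toFun g := (symSubst g).toLinearMap.restrict (symSubst_mem g)
  map_one' := by
    refine LinearMap.ext fun P => Subtype.ext ?_
    simp [symSubst_one]
  map_mul' g h := by
    refine LinearMap.ext fun P => Subtype.ext ?_
    simp [symSubst_mul]

variable {k : Type*} [Field k]

/-- The subgroup `B` of upper triangular matrices in `GL₂(k)`. -/
def borel (k : Type*) [Field k] : Subgroup (GL (Fin 2) k) where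
  carrier := {g | g.1 1 0 = 0}
  one_mem' := by simp
  mul_mem' := fun {a b} ha hb => by
    simp only [Set.mem_ofPred_eq] at ha hb ⊢
    simp [Matrix.mul_apply, Fin.sum_univ_two, ha, hb]
  inv_mem' := fun {a} ha => by
    simp only [Set.mem_ofPred_eq] at ha ⊢
    rw [Matrix.coe_units_inv, Matrix.inv_def, Matrix.adjugate_fin_two]
    simp [ha]

/-- The homomorphism from `B` to `k^×` sending a matrix to its `i`-th diagonal entry. -/
def borelDiag (i : Fin 2) : borel k →* kˣ where
  toFun g := Units.mk0 (g.1.1 i i) (by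
    have hd : g.1.1.det ≠ 0 := (Matrix.isUnit_iff_isUnit_det _).1 g.1.isUnit |>.ne_zero
    have h0 : g.1.1 1 0 = 0 := g.2
    rw [Matrix.det_fin_two, h0, mul_zero, sub_zero] at hd
    fin_cases i
    · exact left_ne_zero_of_mul hd
    · exact right_ne_zero_of_mul hd)
  map_one' := by
    ext
    simp
  map_mul' g h := by
    have hg : g.1.1 1 0 = 0 := g.2
    have hh : h.1.1 1 0 = 0 := h.2
    ext
    fin_cases i <;> simp [Matrix.mul_apply, Fin.sum_univ_two, hg, hh]

/-- The character `ψ₁ ⊗ ψ₂` of `B`, sending `(x, *; 0, y)` to `ψ₁(x) ψ₂(y)`. -/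
def borelChar (ψ₁ ψ₂ : kˣ →* Rˣ) : borel k →* Rˣ :=
  ψ₁.comp (borelDiag 0) * ψ₂.comp (borelDiag 1)

/-- The principal series `Ind_B^{GL₂(k)}(ψ₁ ⊗ ψ₂)` with coefficients in `R`: right translation on
the functions `φ : GL₂(k) → R` such that `φ(bg) = (ψ₁ ⊗ ψ₂)(b) φ(g)` for all `b ∈ B`. -/
def principalSeries (ψ₁ ψ₂ : kˣ →* Rˣ) :
    Representation R (GL (Fin 2) k)
      (Representation.coindV (borel k).subtype (charRep (borelChar ψ₁ ψ₂))) :=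
  Representation.coind (borel k).subtype (charRep (borelChar ψ₁ ψ₂))

/-- The character `ψ ∘ det` of `GL₂(k)`. -/
def detChar (ψ : kˣ →* Rˣ) : GL (Fin 2) k →* Rˣ :=
  ψ.comp Matrix.GeneralLinearGroup.det

end Representations

/-! ### Reduction modulo `p`

For a perfect field `F` of characteristic `p` the Witt vectors `W(F)` are the ring of integers of
the unramified field `W(F)[1/p]`, with residue field `F`. -/

section Reduction

variable {p : ℕ} [Fact p.Prime] {F : Type*} [Field F]

/-- `F` as the residue field of `W(F)`. -/
instance residueAlgebra : Algebra (WittVector p F) F :=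
  (WittVector.constantCoeff : WittVector p F →+* F).toAlgebra

/-- The reduction `F ⊗_{W(F)} Λ` of a representation on a `W(F)`-lattice `Λ`. -/
def reduction {G V : Type*} [Group G] [AddCommGroup V] [Module (WittVector p F) V]
    (ρ : Representation (WittVector p F) G V) :
    Representation F G (F ⊗[WittVector p F] V) where
  toFun g := (ρ g).baseChange F
  map_one' := by
    rw [map_one]
    exact LinearMap.baseChange_id
  map_mul' g h := by
    rw [map_mul]
    exact LinearMap.baseChange_comp _ _

/-- The character `∏ i, ω̃_i ^ s_i` of `k^×`, where `ω̃_i` is the Teichmüller lift of the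
embedding `σ i : k → F`. -/
def teichmullerChar {k : Type*} [Field k] {f : ℕ} [NeZero f] (p : ℕ) [Fact p.Prime]
    (σ : ZMod f → k →+* F) (s : ZMod f → ℤ) : kˣ →* (WittVector p F)ˣ :=
  ∏ i, (Units.map ((WittVector.teichmuller p).comp (σ i : k →* F))) ^ s i

end Reduction

/-! ### Serre weights -/

section Weights

variable {k F : Type*} [Field k] [Field F] {f : ℕ} [NeZero f]

/-- The representation
`μ_{m,n} = ⨂ i, (det ^ m_i ⊗ Sym ^ n_i k²) ⊗_{k, σ_i} F` of `GL₂(k)` over `F`. -/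
def mu (σ : ZMod f → k →+* F) (m : ZMod f → ℤ) (n : ZMod f → ℕ) :
    Representation F (GL (Fin 2) k)
      (PiTensorProduct F fun i => MvPolynomial.homogeneousSubmodule (Fin 2) F (n i)) :=
  piTensor fun i => MonoidHom.comp
    (twist (Matrix.GeneralLinearGroup.det ^ m i) (symRep F (n i)))
    (Matrix.GeneralLinearGroup.map (σ i))

/-- The equivalence relation `μ_{m,n} ≅ μ_{m',n'}` on pairs `(m, n)`. -/
def weightSetoid (σ : ZMod f → k →+* F) : Setoid ((ZMod f → ℤ) × (ZMod f → ℕ)) where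
  r x y := IsoRep (mu σ x.1 x.2) (mu σ y.1 y.2)
  iseqv :=
    { refl := fun _ => ⟨Representation.Equiv.refl _⟩
      symm := fun h => h.elim fun φ => ⟨φ.symm⟩
      trans := fun h h' => IsoRep.trans h h' }

/-- The isomorphism classes of the representations `μ_{m,n}`. The Serre weights are the classes
of those with `0 ≤ n_i ≤ p - 1` for all `i`. -/
def Weight (σ : ZMod f → k →+* F) : Type :=
  Quotient (weightSetoid σ)

/-- The isomorphism class of `μ_{m,n}`. -/
def Weight.mk (σ : ZMod f → k →+* F) (m : ZMod f → ℤ) (n : ZMod f → ℕ) : Weight σ :=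
  Quotient.mk (weightSetoid σ) (m, n)

/-- The pairs `(J, d)` with `0 ≤ d_i ≤ e - 1` if `i ∈ J` and `1 ≤ d_i ≤ e` if `i ∉ J`. -/
def Admissible (e : ℕ) (J : Finset (ZMod f)) (d : ZMod f → ℤ) : Prop :=
  ∀ i, (i ∈ J → 0 ≤ d i ∧ d i ≤ e - 1) ∧ (i ∉ J → 1 ≤ d i ∧ d i ≤ e)

/-- The exponents `m` of the weight `μ(J, d)`. -/
def muM (p : ℕ) (b c : ZMod f → ℤ) (J : Finset (ZMod f)) (d : ZMod f → ℤ) : ZMod f → ℤ :=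
  fun i =>
    if i ∈ J then c i + p - 1 - d i
    else if i + 1 ∈ J then c i + b i + d i - 1
    else c i + b i + d i

/-- The exponents `n` of the weight `μ(J, d)`. -/
def muN (p : ℕ) (b : ZMod f → ℤ) (J : Finset (ZMod f)) (d : ZMod f → ℤ) : ZMod f → ℤ :=
  fun i =>
    if i ∈ J then
      if i + 1 ∈ J then b i + 2 * d i else b i + 2 * d i + 1
    else
      if i + 1 ∈ J then p - b i - 2 * d i else p - 1 - b i - 2 * d i

/-- The integers `n_i` lie in `[0, p - 2]` for the pairs `(J, d)` that occur, so passing to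
natural numbers loses nothing. -/
theorem muN_mem {p e f : ℕ} {b : ZMod f → ℤ} (hb : ∀ i, (e : ℤ) ≤ b i + e ∧ b i + e ≤ p - 1 - e)
    {J : Finset (ZMod f)} {d : ZMod f → ℤ} (h : Admissible e J d) (i : ZMod f) :
    0 ≤ muN p b J d i ∧ muN p b J d i ≤ p - 2 := by
  have h1 := hb i
  have h2 := h i
  unfold muN
  split_ifs with hi hi' hi'
  · have := h2.1 hi
    omega
  · have := h2.1 hi
    omega
  · have := h2.2 hi
    omega
  · have := h2.2 hi
    omega

/-- The weight `μ(J, d)`. -/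
def muJd (σ : ZMod f → k →+* F) (p : ℕ) (b c : ZMod f → ℤ) (J : Finset (ZMod f))
    (d : ZMod f → ℤ) : Weight σ :=
  Weight.mk σ (muM p b c J d) fun i => (muN p b J d i).toNat

/-- The two exceptional cases, in which there is a second weight `μ'(J, d)`: either `b = d = 0`
and `J` is everything, or `b_i = p - 1 - 2e` and `d_i = e` for all `i` and `J` is empty. -/
def Exceptional (p e : ℕ) (b : ZMod f → ℤ) (J : Finset (ZMod f)) (d : ZMod f → ℤ) : Prop :=
  (J = Finset.univ ∧ ∀ i, b i = 0 ∧ d i = 0) ∨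
    (J = ∅ ∧ ∀ i, b i = p - 1 - 2 * e ∧ d i = e)

/-- The additional weight `μ'(J, d)` in the exceptional cases: `n_i = p - 1` for all `i`, and
`m_i = c_i` if `J` is everything, `m_i = c_i - e` if `J` is empty. -/
def muPrimeJd (σ : ZMod f → k →+* F) (p e : ℕ) (c : ZMod f → ℤ) (J : Finset (ZMod f)) :
    Weight σ :=
  Weight.mk σ (fun i => if i ∈ J then c i else c i - e) fun _ => p - 1

/-- The set `W` of the weights `μ(J, d)`. -/
def setW (σ : ZMod f → k →+* F) (p e : ℕ) (b c : ZMod f → ℤ) : Set (Weight σ) :=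
  {w | ∃ J d, Admissible e J d ∧ w = muJd σ p b c J d}

/-- The set `A` of the tuples `a` with `0 ≤ a_i ≤ e` for all `i`. -/
def setA (f e : ℕ) : Set (ZMod f → ℤ) :=
  {a | ∀ i, 0 ≤ a i ∧ a i ≤ e}

/-- `δ_a`, the number of `i` with `a_i = 0` or `a_i = e`. -/
def delta (e : ℕ) (a : ZMod f → ℤ) : ℕ :=
  (Finset.univ.filter fun i => a i = 0 ∨ a i = e).card

/-- The first character `∏ i, ω̃_i ^ (c_i + b_i + a_i)` of the type `τ_a`; characters of inertia
that factor through `k^×` are identified with characters of `k^×`. -/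
def typeChar₁ (p : ℕ) [Fact p.Prime] (σ : ZMod f → k →+* F) (b c a : ZMod f → ℤ) :
    kˣ →* (WittVector p F)ˣ :=
  teichmullerChar p σ fun i => c i + b i + a i

/-- The second character `∏ i, ω̃_i ^ (c_i - a_i)` of the type `τ_a`. -/
def typeChar₂ (p : ℕ) [Fact p.Prime] (σ : ZMod f → k →+* F) (c a : ZMod f → ℤ) :
    kˣ →* (WittVector p F)ˣ :=
  teichmullerChar p σ fun i => c i - a i

/-- `μ` is a Jordan–Hölder constituent of the reduction of `θ_a`, where `θ_a` is the principal
series of the two characters of `τ_a` if they differ, and is `ψ ∘ det` if they are both `ψ`. -/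
def IsConstituentTheta {U : Type*} [AddCommGroup U] [Module F U] (p : ℕ) [Fact p.Prime]
    (σ : ZMod f → k →+* F) (b c a : ZMod f → ℤ) (μ : Representation F (GL (Fin 2) k) U) : Prop :=
  (typeChar₁ p σ b c a ≠ typeChar₂ p σ c a ∧ IsJHConstituent μ
    (reduction (principalSeries (typeChar₁ p σ b c a) (typeChar₂ p σ c a)))) ∨
  (typeChar₁ p σ b c a = typeChar₂ p σ c a ∧ IsJHConstituent μ
    (reduction (charRep (detChar (k := k) (typeChar₁ p σ b c a)))))

/-- `μ` is a Jordan–Hölder constituent of the reduction of `θ'_a`, where `θ'_a = θ_a` if `τ_a` is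
not scalar, and `θ'_a = θ_a ⊗ Ind_B 1` if it is. -/
def IsConstituentTheta' {U : Type*} [AddCommGroup U] [Module F U] (p : ℕ) [Fact p.Prime]
    (σ : ZMod f → k →+* F) (b c a : ZMod f → ℤ) (μ : Representation F (GL (Fin 2) k) U) : Prop :=
  (typeChar₁ p σ b c a ≠ typeChar₂ p σ c a ∧ IsJHConstituent μ
    (reduction (principalSeries (typeChar₁ p σ b c a) (typeChar₂ p σ c a)))) ∨
  (typeChar₁ p σ b c a = typeChar₂ p σ c a ∧ IsJHConstituent μ
    (reduction (twist (detChar (typeChar₁ p σ b c a))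
      (principalSeries (k := k) (R := WittVector p F) 1 1))))

end Weights

/-! ### The weights predicted for a reducible local representation -/

section Predicted

variable {p : ℕ} [Fact p.Prime] {L : IntermediateField ℚ_[p] (PadicAlgCl p)} {F : Type*} [Field F]
  {f : ℕ} [NeZero f]

/-- `χ|_{I_L} = ∏ i, ω_i ^ s_i`, where `ω_i` is the fundamental character attached to the
embedding `σ i` of the residue field of `L` into `F`. -/
def EqOnInertia (σ : ZMod f → residueField L →+* F) (π : PadicAlgCl p) (χ : absGal L →* Fˣ)
    (s : ZMod f → ℤ) : Prop :=
  ∀ g ∈ inertia L, (χ g : F) = ∏ i, (σ i (tameCharacter L π g)) ^ s i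

/-- The set `W' = W_expl(ρ^ss)` of explicitly predicted Serre weights of a representation `ρ` with
semisimplification `χ₂ ⊕ χ₁`: the classes of the `μ_{m,n}` with `n_i ≤ p - 1` such that, for some
`J` and `d` as in `Admissible`, the character `χ₂` is on inertia the product of the
`ω_i ^ (m_i + n_i + e - d_i)` for `i ∈ J` and the `ω_i ^ (m_i + e - d_i)` for `i ∉ J`, and `χ₁` is
the product of the `ω_i ^ (m_i + d_i)` for `i ∈ J` and the `ω_i ^ (m_i + n_i + d_i)` for
`i ∉ J`. -/
def setW' (σ : ZMod f → residueField L →+* F) (e : ℕ) (π : PadicAlgCl p)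
    (χ₁ χ₂ : absGal L →* Fˣ) : Set (Weight σ) :=
  {w | ∃ (m : ZMod f → ℤ) (n : ZMod f → ℕ), (∀ i, n i ≤ p - 1) ∧ w = Weight.mk σ m n ∧
    ∃ (J : Finset (ZMod f)) (d : ZMod f → ℤ), Admissible e J d ∧
      EqOnInertia σ π χ₂ (fun i => if i ∈ J then m i + n i + e - d i else m i + e - d i) ∧
      EqOnInertia σ π χ₁ (fun i => if i ∈ J then m i + d i else m i + n i + d i)}

/-- `W_a`: the weights in `W'` that are constituents of the reduction of `θ_a`. -/
def setWa (σ : ZMod f → residueField L →+* F) (e : ℕ) (π : PadicAlgCl p)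
    (χ₁ χ₂ : absGal L →* Fˣ) (b c a : ZMod f → ℤ) : Set (Weight σ) :=
  {w | w ∈ setW' σ e π χ₁ χ₂ ∧ ∃ m n, w = Weight.mk σ m n ∧
    IsConstituentTheta
      (U := PiTensorProduct F fun i => MvPolynomial.homogeneousSubmodule (Fin 2) F (n i))
      p σ b c a (mu σ m n)}

/-- `W'_a`: the weights in `W'` that are constituents of the reduction of `θ'_a`. -/
def setWa' (σ : ZMod f → residueField L →+* F) (e : ℕ) (π : PadicAlgCl p)
    (χ₁ χ₂ : absGal L →* Fˣ) (b c a : ZMod f → ℤ) : Set (Weight σ) :=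
  {w | w ∈ setW' σ e π χ₁ χ₂ ∧ ∃ m n, w = Weight.mk σ m n ∧
    IsConstituentTheta'
      (U := PiTensorProduct F fun i => MvPolynomial.homogeneousSubmodule (Fin 2) F (n i))
      p σ b c a (mu σ m n)}

end Predicted

end SerreWeights

end

/-!
The tame character `g ↦ g π / π` maps inertia onto the units of the residue field, so the
conditions on characters are congruences modulo `p ^ f - 1` between numbers with given digits in
base `p`. By uniqueness of such digits, `W'` consists of the weights indexed by the pairs `(a, J)`
with `a` in `A` and `J` compatible with `a` (apart from the exceptional ones), and this indexing is
injective.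

The constituents of the reduction of `θ'_a` are found by comparing traces with values in `F`. For a
matrix with distinct eigenvalues, the sum over all `J` of the traces of the corresponding weights is
the trace of a cyclic product of `2 × 2` transfer matrices, each a product `Uᵢ Vᵢ`. Since
`Vᵢ₊₁ Uᵢ` is diagonal if the eigenvalues lie in `k`, and one of these matrices has zero diagonal
otherwise, this trace is that of the principal series; equal eigenvalues are treated similarly. The
weights are pairwise distinct and have only scalar endomorphisms, so by the density theorem each of
them is a constituent, and their dimensions add up to `p ^ f + 1`, which leaves room for no others.
-/

noncomputable section

namespace SerreWeights

/-! ### Constituents of finite-dimensional modules -/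

section Subquotients

variable {A : Type*} [Ring A]

/-- `S` is isomorphic to a subquotient of `V`, encoded as a surjection onto `S` from a submodule
of `V`. For simple `S` this says that `S` is a Jordan–Hölder constituent of `V`. -/
def IsSubquotient (A : Type*) [Ring A] (S V : Type*) [AddCommGroup S] [Module A S]
    [AddCommGroup V] [Module A V] : Prop :=
  ∃ (M : Submodule A V) (φ : M →ₗ[A] S), Function.Surjective φ

variable {S V : Type*} [AddCommGroup S] [Module A S] [AddCommGroup V] [Module A V]

theorem IsSubquotient.of_surjective (φ : V →ₗ[A] S) (hφ : Function.Surjective φ) :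
    IsSubquotient A S V :=
  ⟨⊤, φ ∘ₗ Submodule.topEquiv.toLinearMap, hφ.comp (LinearEquiv.surjective _)⟩

theorem IsSubquotient.of_submodule {N : Submodule A V} (h : IsSubquotient A S N) :
    IsSubquotient A S V := by
  obtain ⟨M, φ, hφ⟩ := h
  let e := Submodule.equivMapOfInjective _ N.injective_subtype M
  exact ⟨M.map N.subtype, φ ∘ₗ e.symm.toLinearMap, hφ.comp e.symm.surjective⟩

theorem IsSubquotient.of_quotient {N : Submodule A V} (h : IsSubquotient A S (V ⧸ N)) :
    IsSubquotient A S V := by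
  obtain ⟨M, φ, hφ⟩ := h
  refine ⟨M.comap N.mkQ, φ ∘ₗ N.mkQ.restrict fun _ hx => hx, hφ.comp ?_⟩
  rintro ⟨y, hy⟩
  obtain ⟨x, rfl⟩ := N.mkQ_surjective y
  exact ⟨⟨x, hy⟩, rfl⟩

theorem IsSubquotient.congr_left {S' : Type*} [AddCommGroup S'] [Module A S']
    (h : IsSubquotient A S V) (e : S ≃ₗ[A] S') : IsSubquotient A S' V := by
  obtain ⟨M, φ, hφ⟩ := h
  exact ⟨M, e.toLinearMap ∘ₗ φ, e.surjective.comp hφ⟩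

theorem not_isSubquotient_of_subsingleton [Nontrivial S] [Subsingleton V] :
    ¬ IsSubquotient A S V := by
  rintro ⟨M, φ, hφ⟩
  exact absurd hφ.subsingleton (not_subsingleton S)

theorem IsSubquotient.submodule_or_quotient [IsSimpleModule A S] (N : Submodule A V)
    (h : IsSubquotient A S V) : IsSubquotient A S N ∨ IsSubquotient A S (V ⧸ N) := by
  obtain ⟨M, φ, hφ⟩ := h
  let j : M.comap N.subtype →ₗ[A] M := N.subtype.restrict fun _ hx => hx
  rcases LinearMap.surjective_or_eq_zero (φ ∘ₗ j) with hsurj | hzero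
  · exact Or.inl ⟨_, _, hsurj⟩
  · let q : M →ₗ[A] V ⧸ N := N.mkQ ∘ₗ M.subtype
    have hq : LinearMap.ker q ≤ LinearMap.ker φ := fun x hx =>
      LinearMap.congr_fun hzero
        (⟨⟨x, (Submodule.Quotient.mk_eq_zero N).1 hx⟩, x.2⟩ : M.comap N.subtype)
    refine Or.inr ⟨LinearMap.range q,
      (LinearMap.ker q).liftQ φ hq ∘ₗ q.quotKerEquivRange.symm.toLinearMap, ?_⟩
    rw [← LinearMap.range_eq_top, LinearEquiv.range_comp, Submodule.range_liftQ,
      LinearMap.range_eq_top.2 hφ]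

theorem IsSubquotient.nonempty_equiv [IsSimpleModule A S] [IsSimpleModule A V]
    (h : IsSubquotient A S V) : Nonempty (V ≃ₗ[A] S) := by
  have := IsSimpleModule.nontrivial A S
  obtain ⟨M, φ, hφ⟩ := h
  rcases eq_bot_or_eq_top M with rfl | rfl
  · exact absurd hφ.subsingleton (not_subsingleton S)
  · let ψ : V →ₗ[A] S := φ ∘ₗ Submodule.topEquiv.symm.toLinearMap
    have hψ : Function.Surjective ψ := hφ.comp (LinearEquiv.surjective _)
    refine ⟨LinearEquiv.ofBijective ψ <| LinearMap.bijective_of_ne_zero fun hzero => ?_⟩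
    obtain ⟨s, hs⟩ := exists_ne (0 : S)
    obtain ⟨x, rfl⟩ := hψ s
    exact hs (LinearMap.congr_fun hzero x)

section Density

theorem linearMap_eq_zero_of_isEmpty_equiv {M N : Type*} [AddCommGroup M] [Module A M]
    [AddCommGroup N] [Module A N] [IsSimpleModule A M] [IsSimpleModule A N]
    (h : IsEmpty (M ≃ₗ[A] N)) (φ : M →ₗ[A] N) : φ = 0 :=
  (LinearMap.bijective_or_eq_zero φ).resolve_left fun hφ =>
    h.false (LinearEquiv.ofBijective φ hφ)

variable {M N : Type*} [AddCommGroup M] [Module A M] [AddCommGroup N] [Module A N]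

/-- As there are no nonzero maps between `M` and `N`, every endomorphism of `M × N` is diagonal,
so `(x, y) ↦ (0, f y)` lies in its double centralizer. -/
theorem exists_smul_eq_zero_and_smul_eq [IsSemisimpleModule A M] [IsSemisimpleModule A N]
    (hMN : ∀ φ : M →ₗ[A] N, φ = 0) (hNM : ∀ φ : N →ₗ[A] M, φ = 0)
    (f : Module.End (Module.End A N) N) (s : Finset M) (t : Finset N) :
    ∃ a : A, (∀ x ∈ s, a • x = 0) ∧ ∀ y ∈ t, a • y = f y := by
  classical
  have : IsSemisimpleModule A (M × N) := by
    have := IsSemisimpleModule.sup (IsSemisimpleModule.range (LinearMap.inl A M N))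
      (IsSemisimpleModule.range (LinearMap.inr A M N))
    rw [LinearMap.sup_range_inl_inr] at this
    exact IsSemisimpleModule.congr Submodule.topEquiv.symm
  let g : Module.End (Module.End A (M × N)) (M × N) :=
    { toFun := fun x => (0, f x.2)
      map_add' := fun x y => by simp
      map_smul' := fun φ x => by
        have hdecomp : φ x = φ (x.1, 0) + φ (0, x.2) := by rw [← map_add]; simp
        have hfst : (φ (x.1, 0)).2 = 0 :=
          LinearMap.congr_fun (hMN (LinearMap.snd A M N ∘ₗ φ ∘ₗ LinearMap.inl A M N)) x.1
        have hsnd (y : N) : (φ (0, y)).1 = 0 :=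
          LinearMap.congr_fun (hNM (LinearMap.fst A M N ∘ₗ φ ∘ₗ LinearMap.inr A M N)) y
        let φN : Module.End A N := LinearMap.snd A M N ∘ₗ φ ∘ₗ LinearMap.inr A M N
        have hf : f (φ (0, x.2)).2 = (φ (0, f x.2)).2 := f.map_smul φN x.2
        simp only [Module.End.smul_def, RingHom.id_apply]
        refine Prod.ext (hsnd _).symm ?_
        rw [hdecomp, Prod.snd_add, hfst, zero_add, hf] }
  obtain ⟨a, ha⟩ := jacobson_density g (s.image (·, 0) ∪ t.image (0, ·))
  refine ⟨a, fun x hx => ?_, fun y hy => ?_⟩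
  · exact (congrArg Prod.fst (ha (x, 0)
      (Finset.mem_union_left _ (Finset.mem_image_of_mem _ hx)))).symm
  · exact (congrArg Prod.snd (ha (0, y)
      (Finset.mem_union_right _ (Finset.mem_image_of_mem _ hy)))).symm

end Density

variable {F : Type*} [Field F] [Algebra F A] [Module F V] [IsScalarTower F A V]

theorem smul_eq_of_forall_basis {ι : Type*} (b : Module.Basis ι F V) {a : A} {y : V →ₗ[F] V}
    (h : ∀ i, a • b i = y (b i)) (v : V) : a • v = y v :=
  LinearMap.congr_fun (b.ext h : Algebra.lsmul F F V a = y) v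

section FiniteDimensional

theorem finiteDimensional_induction (F : Type*) [Field F] [Algebra F A]
    {motive : ∀ (V : Type*) [AddCommGroup V] [Module A V] [Module F V], Prop}
    (subsingleton : ∀ (V : Type _) [AddCommGroup V] [Module A V] [Module F V] [Subsingleton V],
      motive V)
    (simple_quotient : ∀ (V : Type _) [AddCommGroup V] [Module A V] [Module F V]
      [IsScalarTower F A V] [FiniteDimensional F V] (N : Submodule A V) [IsSimpleModule A (V ⧸ N)],
      motive N → motive V)
    (V : Type _) [AddCommGroup V] [Module A V] [hF : Module F V] [htower : IsScalarTower F A V]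
    [hfin : FiniteDimensional F V] : motive V := by
  have hV : IsFiniteLength A V := isFiniteLength_iff_isNoetherian_isArtinian.2
    ⟨isNoetherian_of_tower F inferInstance, isArtinian_of_tower F inferInstance⟩
  revert hF htower hfin
  induction hV with
  | of_subsingleton =>
    intro _ _ _
    exact subsingleton _
  | @of_simple_quotient V _ _ N _ _ ih =>
    intro _ _ _
    have : FiniteDimensional F N := inferInstanceAs (FiniteDimensional F (N.restrictScalars F))
    exact simple_quotient V N ih

theorem nonempty_equiv_of_annihilator_le (F : Type*) [Field F] [Algebra F A] [Module F V]
    [IsScalarTower F A V] [FiniteDimensional F V] [IsSimpleModule A V] [IsSimpleModule A S]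
    (h : ∀ a : A, (∀ v : V, a • v = 0) → ∀ s : S, a • s = 0) : Nonempty (V ≃ₗ[A] S) := by
  classical
  by_contra hne
  have hVS : IsEmpty (V ≃ₗ[A] S) := not_nonempty_iff.1 hne
  have hSV : IsEmpty (S ≃ₗ[A] V) := ⟨fun e => hVS.false e.symm⟩
  have := IsSimpleModule.nontrivial A S
  obtain ⟨s, hs⟩ := exists_ne (0 : S)
  let b := Module.finBasis F V
  obtain ⟨a, hab, has⟩ := exists_smul_eq_zero_and_smul_eq (linearMap_eq_zero_of_isEmpty_equiv hVS)
    (linearMap_eq_zero_of_isEmpty_equiv hSV) LinearMap.id (Finset.univ.image b) {s}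
  have haV (v : V) : a • v = 0 := smul_eq_of_forall_basis b (y := 0)
    (fun i => hab _ (Finset.mem_image_of_mem b (Finset.mem_univ i))) v
  exact hs ((has s (Finset.mem_singleton_self s)).symm.trans (h a haV s))

/-- If some `b` kills the simple quotient `V ⧸ N` but not `S`, say `b • s₀ ≠ 0`, then
`b • V ⊆ N` and `b • s₀` generates `S`, so every `a` that kills `N` kills `S`. -/
theorem isSubquotient_of_annihilator_le (F : Type*) [Field F] [Algebra F A] [Module F V]
    [IsScalarTower F A V] [FiniteDimensional F V] [IsSimpleModule A S]
    (h : ∀ a : A, (∀ v : V, a • v = 0) → ∀ s : S, a • s = 0) : IsSubquotient A S V := by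
  revert h
  refine finiteDimensional_induction F (A := A) (motive := fun V _ _ _ =>
    (∀ a : A, (∀ v : V, a • v = 0) → ∀ s : S, a • s = 0) → IsSubquotient A S V) ?_ ?_ V
  · intro V _ _ _ _ h
    have := IsSimpleModule.nontrivial A S
    obtain ⟨s, hs⟩ := exists_ne (0 : S)
    exact absurd (by simpa using h 1 (fun v => Subsingleton.elim _ _) s) hs
  · intro V _ _ _ _ _ N _ ih h
    by_cases hQ : ∀ a : A, (∀ v : V ⧸ N, a • v = 0) → ∀ s : S, a • s = 0
    · have : FiniteDimensional F (V ⧸ N) :=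
        inferInstanceAs (FiniteDimensional F (V ⧸ N.restrictScalars F))
      obtain ⟨e⟩ := nonempty_equiv_of_annihilator_le F hQ
      exact (IsSubquotient.of_surjective e.toLinearMap e.surjective).of_quotient
    · push Not at hQ
      obtain ⟨b, hb, s₀, hs₀⟩ := hQ
      have hbN (v : V) : b • v ∈ N :=
        (Submodule.Quotient.mk_eq_zero N).1 (hb (Submodule.Quotient.mk v))
      refine (ih fun a ha s => ?_).of_submodule
      obtain ⟨c, rfl⟩ := Submodule.mem_span_singleton.1
        ((IsSimpleModule.span_singleton_eq_top A hs₀).ge (Submodule.mem_top : s ∈ ⊤))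
      rw [← mul_smul, ← mul_smul]
      refine h _ (fun v => ?_) s₀
      rw [mul_assoc, mul_smul, mul_smul]
      exact congrArg Subtype.val (ha (c • ⟨b • v, hbN v⟩))

section Family

variable [FiniteDimensional F V]
universe w

variable {ι : Type*} (S : ι → Type w) [∀ i, AddCommGroup (S i)] [∀ i, Module A (S i)]
  [∀ i, Module F (S i)] [∀ i, IsScalarTower F A (S i)] [∀ i, IsSimpleModule A (S i)]

theorem sum_finrank_le_of_isSubquotient (s : Finset ι)
    (hS : ∀ i ∈ s, ∀ j ∈ s, Nonempty (S i ≃ₗ[A] S j) → i = j)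
    (h : ∀ i ∈ s, IsSubquotient A (S i) V) :
    ∑ i ∈ s, Module.finrank F (S i) ≤ Module.finrank F V := by
  classical
  have hnontrivial (i : ι) := IsSimpleModule.nontrivial A (S i)
  revert s
  refine finiteDimensional_induction F (A := A) (motive := fun V _ _ _ => ∀ s : Finset ι,
    (∀ i ∈ s, ∀ j ∈ s, Nonempty (S i ≃ₗ[A] S j) → i = j) → (∀ i ∈ s, IsSubquotient A (S i) V) →
    ∑ i ∈ s, Module.finrank F (S i) ≤ Module.finrank F V) ?_ ?_ V
  · intro V _ _ _ _ s _ h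
    rw [Finset.eq_empty_of_forall_notMem fun i hi => not_isSubquotient_of_subsingleton (h i hi)]
    exact Nat.zero_le _
  · intro V _ _ _ _ _ N _ ih s hS h
    have hdim : Module.finrank F (V ⧸ N) + Module.finrank F N = Module.finrank F V :=
      Submodule.finrank_quotient_add_finrank (N.restrictScalars F)
    by_cases hQ : ∃ i ∈ s, IsSubquotient A (S i) (V ⧸ N)
    · obtain ⟨i, hi, hiQ⟩ := hQ
      obtain ⟨e⟩ := hiQ.nonempty_equiv
      have herase : ∀ j ∈ s.erase i, IsSubquotient A (S j) N := fun j hj => by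
        refine ((h j (Finset.mem_of_mem_erase hj)).submodule_or_quotient N).resolve_right
          fun hjQ => ?_
        obtain ⟨e'⟩ := hjQ.nonempty_equiv
        exact Finset.ne_of_mem_erase hj
          (hS j (Finset.mem_of_mem_erase hj) i hi ⟨e'.symm.trans e⟩)
      rw [← Finset.add_sum_erase _ _ hi, ← (e.restrictScalars F).finrank_eq, ← hdim]
      gcongr
      exact ih _ (fun i hi j hj =>
        hS i (Finset.mem_of_mem_erase hi) j (Finset.mem_of_mem_erase hj)) herase
    · push Not at hQ
      exact (ih s hS fun i hi => ((h i hi).submodule_or_quotient N).resolve_right (hQ i hi)).trans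
        (hdim ▸ Nat.le_add_left _ _)

theorem exists_nonempty_equiv_of_finrank_eq [Fintype ι]
    (hS : ∀ i j, Nonempty (S i ≃ₗ[A] S j) → i = j) (h : ∀ i, IsSubquotient A (S i) V)
    (hdim : Module.finrank F V = ∑ i, Module.finrank F (S i))
    {T : Type w} [AddCommGroup T] [Module A T] [Module F T] [IsScalarTower F A T]
    [FiniteDimensional F T] [IsSimpleModule A T] (hT : IsSubquotient A T V) :
    ∃ i, Nonempty (S i ≃ₗ[A] T) := by
  by_contra! hne
  have := IsSimpleModule.nontrivial A T
  -- The family `S` together with `T` would be too large for `V`.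
  let S' : Option ι → Type w := fun o => o.elim T S
  let : ∀ o, AddCommGroup (S' o) := Option.rec ‹_› ‹_›
  let : ∀ o, Module A (S' o) := Option.rec ‹_› ‹_›
  let : ∀ o, Module F (S' o) := Option.rec ‹_› ‹_›
  have : ∀ o, IsScalarTower F A (S' o) := Option.rec ‹_› ‹_›
  have hsimple : ∀ o, IsSimpleModule A (S' o) := Option.rec ‹_› ‹_›
  have hle : ∑ o, Module.finrank F (S' o) ≤ Module.finrank F V := by
    refine @sum_finrank_le_of_isSubquotient A _ V _ _ F _ _ _ _ _ _ S' _ _ _ _ hsimple _ ?_ ?_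
    · rintro (_ | i) - (_ | j) - ⟨e⟩
      · rfl
      · exact ((hne j).false e.symm).elim
      · exact ((hne i).false e).elim
      · rw [hS i j ⟨e⟩]
    · rintro (_ | i) -
      exacts [hT, h i]
  have hsum : ∑ o, Module.finrank F (S' o) = Module.finrank F T + Module.finrank F V := by
    rw [hdim]
    exact Fintype.sum_option _
  have hpos : 0 < Module.finrank F T := Module.finrank_pos
  exact (Nat.lt_add_of_pos_left hpos).not_ge (hsum ▸ hle)

variable [∀ i, FiniteDimensional F (S i)]

theorem exists_smul_eq_and_smul_eq_zero [Finite ι]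
    (hS : ∀ i j, Nonempty (S i ≃ₗ[A] S j) → i = j) (j : ι)
    (hend : ∀ φ : S j →ₗ[A] S j, ∃ c : F, ∀ x, φ x = c • x) (y : S j →ₗ[F] S j) :
    ∃ a : A, (∀ x : S j, a • x = y x) ∧ ∀ i, i ≠ j → ∀ x : S i, a • x = 0 := by
  classical
  have := Fintype.ofFinite ι
  let M := ∀ i : {i // i ≠ j}, S i
  have hMj (φ : M →ₗ[A] S j) : φ = 0 := LinearMap.pi_ext' fun i =>
    linearMap_eq_zero_of_isEmpty_equiv ⟨fun e => i.2 (hS i j ⟨e⟩)⟩ _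
  have hjM (φ : S j →ₗ[A] M) : φ = 0 := LinearMap.ext fun x => funext fun i =>
    LinearMap.congr_fun (linearMap_eq_zero_of_isEmpty_equiv ⟨fun e => i.2 (hS j i ⟨e⟩).symm⟩
      (LinearMap.proj i ∘ₗ φ)) x
  let f : Module.End (Module.End A (S j)) (S j) :=
    { toFun := y
      map_add' := y.map_add
      map_smul' := fun φ x => by
        obtain ⟨c, hc⟩ := hend φ
        simp only [Module.End.smul_def, RingHom.id_apply, hc, map_smul] }
  let bM := Module.finBasis F M
  let b := Module.finBasis F (S j)
  obtain ⟨a, haM, haj⟩ := exists_smul_eq_zero_and_smul_eq hMj hjM f (Finset.univ.image bM)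
    (Finset.univ.image b)
  refine ⟨a, smul_eq_of_forall_basis b fun i =>
    haj _ (Finset.mem_image_of_mem b (Finset.mem_univ i)), fun i hi x => ?_⟩
  have ha (v : M) : a • v = 0 := smul_eq_of_forall_basis bM (y := 0)
    (fun i => haM _ (Finset.mem_image_of_mem bM (Finset.mem_univ i))) v
  have hax : a • (Pi.single ⟨i, hi⟩ x : M) ⟨i, hi⟩ = 0 := congrFun (ha _) ⟨i, hi⟩
  rwa [Pi.single_eq_same] at hax

variable [Fintype ι]

/-- If `a` kills `V`, then so does `a * b` for a `b` that acts on `S i` as a given endomorphism of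
rank one and kills the other `S j`, and the trace of `a * b` is then a matrix coefficient of `a` on
`S i`. -/
theorem isSubquotient_of_trace_eq_sum (hS : ∀ i j, Nonempty (S i ≃ₗ[A] S j) → i = j) {i : ι}
    (hend : ∀ φ : S i →ₗ[A] S i, ∃ c : F, ∀ x, φ x = c • x)
    (htr : ∀ a : A, LinearMap.trace F V (Algebra.lsmul F F V a) =
      ∑ i, LinearMap.trace F (S i) (Algebra.lsmul F F (S i) a)) : IsSubquotient A (S i) V := by
  refine isSubquotient_of_annihilator_le F fun a ha w => ?_
  rw [← Module.forall_dual_apply_eq_zero_iff F]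
  intro ℓ
  obtain ⟨b, hb, hb'⟩ := exists_smul_eq_and_smul_eq_zero S hS i hend (ℓ.smulRight w)
  have hV : Algebra.lsmul F F V (a * b) = 0 := LinearMap.ext fun v => by simp [ha]
  have hi : Algebra.lsmul F F (S i) (a * b) = ℓ.smulRight (a • w) :=
    LinearMap.ext fun x => by simp [hb]
  have hj (j : ι) (hj : j ≠ i) : Algebra.lsmul F F (S j) (a * b) = 0 :=
    LinearMap.ext fun v => by simp [hb' j hj]
  have htrace := htr (a * b)
  rw [hV, map_zero, Fintype.sum_eq_single i fun j hji => by rw [hj j hji, map_zero], hi,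
    LinearMap.trace_smulRight] at htrace
  exact htrace.symm

theorem isSubquotient_iff_of_trace_eq (hS : ∀ i j, Nonempty (S i ≃ₗ[A] S j) → i = j)
    (hend : ∀ i, ∀ φ : S i →ₗ[A] S i, ∃ c : F, ∀ x, φ x = c • x)
    (htr : ∀ a : A, LinearMap.trace F V (Algebra.lsmul F F V a) =
      ∑ i, LinearMap.trace F (S i) (Algebra.lsmul F F (S i) a))
    (hdim : Module.finrank F V = ∑ i, Module.finrank F (S i))
    (T : Type w) [AddCommGroup T] [Module A T] [Module F T] [IsScalarTower F A T]
    [FiniteDimensional F T] [IsSimpleModule A T] :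
    IsSubquotient A T V ↔ ∃ i, Nonempty (S i ≃ₗ[A] T) := by
  have hmem (i : ι) : IsSubquotient A (S i) V := isSubquotient_of_trace_eq_sum S hS (hend i) htr
  exact ⟨exists_nonempty_equiv_of_finrank_eq S hS hmem hdim,
    fun ⟨i, ⟨e⟩⟩ => (hmem i).congr_left e⟩

end Family

end FiniteDimensional

end Subquotients

section Constituents

universe u

variable {F G : Type*} [Field F] [Group G]

section Characterisation

variable {U W : Type*} [AddCommGroup U] [Module F U] [AddCommGroup W] [Module F W]
  {σ : Representation F G U} {ρ : Representation F G W}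

theorem isJHConstituent_iff_isSubquotient :
    IsJHConstituent σ ρ ↔
      σ.IsIrreducible ∧ IsSubquotient (MonoidAlgebra F G) σ.asModule ρ.asModule := by
  refine and_congr_right fun _ => ⟨?_, ?_⟩
  · rintro ⟨N, M, -, ⟨e⟩⟩
    exact ⟨M, e.toLinearMap ∘ₗ (N.submoduleOf M).mkQ,
      e.surjective.comp (Submodule.mkQ_surjective _)⟩
  · rintro ⟨M, φ, hφ⟩
    refine ⟨(LinearMap.ker φ).map M.subtype, M, Submodule.map_subtype_le _ _, ⟨?_⟩⟩
    exact (Submodule.quotEquivOfEq _ _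
      (Submodule.comap_map_eq_of_injective M.injective_subtype _)).trans
        (φ.quotKerEquivOfSurjective hφ)

theorem isoRep_iff_nonempty_asModule_equiv :
    IsoRep σ ρ ↔ Nonempty (σ.asModule ≃ₗ[MonoidAlgebra F G] ρ.asModule) := by
  constructor
  · rintro ⟨φ⟩
    exact ⟨LinearEquiv.ofBijective
      (Representation.IntertwiningMap.equivLinearMapAsModule σ ρ φ.toIntertwiningMap)
      φ.toLinearEquiv.bijective⟩
  · rintro ⟨e⟩
    exact ⟨Representation.IntertwiningMap.ofBijective
      ((Representation.IntertwiningMap.equivLinearMapAsModule σ ρ).symm e.toLinearMap)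
      e.bijective⟩

theorem IsoRep.isIrreducible (h : IsoRep σ ρ) (hσ : σ.IsIrreducible) : ρ.IsIrreducible := by
  obtain ⟨e⟩ := isoRep_iff_nonempty_asModule_equiv.1 h
  rw [Representation.irreducible_iff_isSimpleModule_asModule] at hσ ⊢
  exact IsSimpleModule.congr e.symm

theorem trace_lsmul_single (ρ : Representation F G W) (g : G) (r : F) :
    LinearMap.trace F ρ.asModule (Algebra.lsmul F F ρ.asModule (MonoidAlgebra.single g r)) =
      r * LinearMap.trace F W (ρ g) := by
  rw [← smul_eq_mul, ← map_smul]
  exact congrArg _ (LinearMap.ext fun x => Representation.single_smul ρ r g x)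

theorem exists_eq_smul_of_asModule_hom
    (h : ∀ φ : U →ₗ[F] U, (∀ g x, φ (σ g x) = σ g (φ x)) → ∃ c : F, ∀ x, φ x = c • x)
    (φ : σ.asModule →ₗ[MonoidAlgebra F G] σ.asModule) : ∃ c : F, ∀ x, φ x = c • x := by
  have hsingle (g : G) (y : σ.asModule) : MonoidAlgebra.single g (1 : F) • y = σ g y :=
    (Representation.single_smul σ 1 g y).trans (one_smul F _)
  exact h (φ.restrictScalars F) fun g x =>
    (congrArg φ (hsingle g x).symm).trans ((φ.map_smul _ _).trans (hsingle g _))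

end Characterisation

theorem isJHConstituent_iff_of_trace_eq {V : Type u} [AddCommGroup V] [Module F V]
    [FiniteDimensional F V] (ρ : Representation F G V) {ι : Type*} [Fintype ι] {S : ι → Type u}
    [∀ i, AddCommGroup (S i)] [∀ i, Module F (S i)] [∀ i, FiniteDimensional F (S i)]
    (τ : ∀ i, Representation F G (S i)) (hτ : ∀ i, (τ i).IsIrreducible)
    (hne : ∀ i j, IsoRep (τ i) (τ j) → i = j)
    (hend : ∀ i, ∀ φ : S i →ₗ[F] S i, (∀ g x, φ (τ i g x) = τ i g (φ x)) →
      ∃ c : F, ∀ x, φ x = c • x)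
    (htr : ∀ g, LinearMap.trace F V (ρ g) = ∑ i, LinearMap.trace F (S i) (τ i g))
    (hdim : Module.finrank F V = ∑ i, Module.finrank F (S i))
    {T : Type u} [AddCommGroup T] [Module F T] [FiniteDimensional F T]
    (σ : Representation F G T) :
    IsJHConstituent σ ρ ↔ ∃ i, IsoRep (τ i) σ := by
  have (i : ι) : IsSimpleModule (MonoidAlgebra F G) (τ i).asModule :=
    (Representation.irreducible_iff_isSimpleModule_asModule _).1 (hτ i)
  have htr' (a : MonoidAlgebra F G) :
      LinearMap.trace F ρ.asModule (Algebra.lsmul F F ρ.asModule a) =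
        ∑ i, LinearMap.trace F (τ i).asModule (Algebra.lsmul F F (τ i).asModule a) := by
    induction a using MonoidAlgebra.induction_linear with
    | zero => simp only [map_zero, Finset.sum_const_zero]
    | add a b ha hb => simp only [map_add, ha, hb, Finset.sum_add_distrib]
    | single g r =>
      rw [trace_lsmul_single ρ, htr, Finset.mul_sum]
      exact Finset.sum_congr rfl fun i _ => (trace_lsmul_single (τ i) g r).symm
  have hsub (hσ : σ.IsIrreducible) :
      IsSubquotient (MonoidAlgebra F G) σ.asModule ρ.asModule ↔ ∃ i, IsoRep (τ i) σ := by
    have := (Representation.irreducible_iff_isSimpleModule_asModule _).1 hσ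
    have : FiniteDimensional F ρ.asModule := ‹FiniteDimensional F V›
    have : FiniteDimensional F σ.asModule := ‹FiniteDimensional F T›
    have (i : ι) : FiniteDimensional F (τ i).asModule := ‹∀ i, FiniteDimensional F (S i)› i
    simp only [isoRep_iff_nonempty_asModule_equiv]
    exact isSubquotient_iff_of_trace_eq (F := F) (V := ρ.asModule) (fun i => (τ i).asModule)
      (fun i j h => hne i j (isoRep_iff_nonempty_asModule_equiv.2 h))
      (fun i => exists_eq_smul_of_asModule_hom (hend i)) htr' hdim σ.asModule
  rw [isJHConstituent_iff_isSubquotient]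
  refine ⟨fun ⟨hσ, h⟩ => (hsub hσ).1 h, fun ⟨i, hi⟩ => ?_⟩
  have hσ := hi.isIrreducible (hτ i)
  exact ⟨hσ, (hsub hσ).2 ⟨i, hi⟩⟩

end Constituents

/-! ### Symmetric powers and the weights `μ_{m,n}` -/

section SymmetricPowers

open MvPolynomial

variable (F : Type*) [Field F] (n : ℕ)

/-- The monomials of degree `n` in two variables, numbered by the exponent of the second
variable. -/
def degreeEquivFin : {d : Fin 2 →₀ ℕ | d.degree = n} ≃ Fin (n + 1) where
  toFun d := ⟨d.1 1, Nat.lt_succ_of_le ((Finsupp.le_degree 1 d.1).trans_eq d.2)⟩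
  invFun i := ⟨Finsupp.equivFunOnFinite.symm ![n - i, i], by
    simpa [Finsupp.degree_eq_sum] using Nat.sub_add_cancel i.is_le⟩
  left_inv := by
    rintro ⟨d, hd⟩
    have hd : d 0 + d 1 = n := by simpa [Finsupp.degree_eq_sum] using hd
    ext i
    fin_cases i
    · simp [← hd]
    · rfl
  right_inv _ := rfl

/-- The basis `X 0 ^ (n - i) * X 1 ^ i` of the homogeneous polynomials of degree `n`, the first
element of which is a highest weight vector of `Sym ^ n`. -/
def symBasis : Module.Basis (Fin (n + 1)) F (homogeneousSubmodule (Fin 2) F n) :=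
  ((basisRestrictSupport F {d : Fin 2 →₀ ℕ | d.degree = n}).map (LinearEquiv.ofEq _ _
    (homogeneousSubmodule_eq_finsupp_supported (Fin 2) F n).symm)).reindex (degreeEquivFin n)

theorem coe_basisRestrictSupport {R τ : Type*} [CommSemiring R] {s : Set (τ →₀ ℕ)} (d : s) :
    (basisRestrictSupport R s d : MvPolynomial τ R) = monomial d.1 1 :=
  congrArg AddMonoidAlgebra.ofCoeff (Finsupp.supportedEquivFinsupp_symm_single (R := R) s d 1)

theorem coe_symBasis (i : Fin (n + 1)) :
    (symBasis F n i : MvPolynomial (Fin 2) F) = X 0 ^ (n - i.1) * X 1 ^ i.1 := by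
  have hmonomial : (symBasis F n i : MvPolynomial (Fin 2) F) =
      monomial (Finsupp.equivFunOnFinite.symm ![n - i, i]) 1 := by
    rw [symBasis, Module.Basis.reindex_apply, Module.Basis.map_apply]
    exact coe_basisRestrictSupport _
  rw [hmonomial, monomial_eq, Finsupp.prod_fintype _ _ fun _ => pow_zero _]
  simp

/-- Dehomogenisation, `X 0 ↦ 1` and `X 1 ↦ X`, by which coordinates with respect to `symBasis` are
read off as coefficients. -/
def dehomogenize : MvPolynomial (Fin 2) F →ₐ[F] Polynomial F :=
  aeval ![1, Polynomial.X]

theorem symBasis_repr (P : homogeneousSubmodule (Fin 2) F n) (j : Fin (n + 1)) :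
    (symBasis F n).repr P j = (dehomogenize F P.1).coeff j := by
  have hcoord : (symBasis F n).coord j =
      Polynomial.lcoeff F j ∘ₗ (dehomogenize F).toLinearMap ∘ₗ Submodule.subtype _ :=
    (symBasis F n).ext fun i => by
      simp [coe_symBasis, dehomogenize, Polynomial.coeff_X_pow, Finsupp.single_apply, Fin.ext_iff,
        eq_comm]
  exact LinearMap.congr_fun hcoord P

variable {F}

/-- The coefficient at `X 0 ^ (n - b) * X 1 ^ b` of the image of `X 0 ^ (n - a) * X 1 ^ a` under
the action of a matrix on `Sym ^ n`. -/
def symCoeff (n : ℕ) (g : Matrix (Fin 2) (Fin 2) F) (a b : ℕ) : F :=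
  ((Polynomial.C (g 0 0) + Polynomial.C (g 1 0) * Polynomial.X) ^ (n - a) *
    (Polynomial.C (g 0 1) + Polynomial.C (g 1 1) * Polynomial.X) ^ a).coeff b

theorem symBasis_repr_symRep (g : GL (Fin 2) F) (a b : Fin (n + 1)) :
    (symBasis F n).repr (symRep F n g (symBasis F n a)) b = symCoeff n g.1 a b := by
  have hcoe : (symRep F n g (symBasis F n a) : MvPolynomial (Fin 2) F) =
      symSubst g (symBasis F n a) := rfl
  rw [symBasis_repr, hcoe, coe_symBasis]
  simp [symSubst, dehomogenize, symCoeff, Fin.sum_univ_two]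

/-- The trace of the action of a matrix on `Sym ^ n`. -/
def symTrace (n : ℕ) (g : Matrix (Fin 2) (Fin 2) F) : F :=
  ∑ a : Fin (n + 1), symCoeff n g a a

theorem trace_eq_sum_repr {R ι V : Type*} [CommRing R] [Fintype ι] [AddCommMonoid V] [Module R V]
    (b : Module.Basis ι R V) (φ : V →ₗ[R] V) :
    LinearMap.trace R V φ = ∑ i, b.repr (φ (b i)) i := by
  classical
  simp only [LinearMap.trace_eq_matrix_trace R b, Matrix.trace, Matrix.diag_apply,
    LinearMap.toMatrix_apply]

theorem trace_symRep (g : GL (Fin 2) F) :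
    LinearMap.trace F _ (symRep F n g) = symTrace n g.1 := by
  simp only [trace_eq_sum_repr (symBasis F n), symBasis_repr_symRep, symTrace]

theorem exists_mulVec_eq_smul_of_trace_of_det {g : Matrix (Fin 2) (Fin 2) F} {α β : F}
    (htr : g.trace = α + β) (hdet : g.det = α * β) :
    ∃ v : Fin 2 → F, v ≠ 0 ∧ g.mulVec v = α • v := by
  have hdet0 : (g - Matrix.scalar (Fin 2) α).det = 0 := by
    rw [Matrix.trace_fin_two] at htr
    rw [Matrix.det_fin_two] at hdet ⊢
    simp only [Matrix.scalar_apply, Matrix.sub_apply, Matrix.diagonal_apply_eq, ne_eq,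
      zero_ne_one, one_ne_zero, not_false_eq_true, Matrix.diagonal_apply_ne, sub_zero]
    linear_combination hdet - α * htr
  obtain ⟨v, hv, hgv⟩ := Matrix.exists_mulVec_eq_zero_iff.2 hdet0
  refine ⟨v, hv, ?_⟩
  rw [Matrix.sub_mulVec, sub_eq_zero] at hgv
  rw [hgv, Matrix.scalar_apply, ← Matrix.smul_one_eq_diagonal, Matrix.smul_mulVec,
    Matrix.one_mulVec]

theorem exists_generalLinearGroup_col_zero_eq {v : Fin 2 → F} (hv : v ≠ 0) :
    ∃ P : GL (Fin 2) F, P.1.col 0 = v := by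
  by_cases h0 : v 0 = 0
  · have h1 : v 1 ≠ 0 := fun h1 => hv (funext fun i => by fin_cases i <;> assumption)
    refine ⟨Matrix.GeneralLinearGroup.mkOfDetNeZero !![0, 1; v 1, 0] (by simpa using h1), ?_⟩
    ext i
    fin_cases i
    exacts [h0.symm, rfl]
  · refine ⟨Matrix.GeneralLinearGroup.mkOfDetNeZero !![v 0, 0; v 1, 1] (by simpa using h0), ?_⟩
    ext i
    fin_cases i <;> rfl

theorem exists_conj_upperTriangular (g : GL (Fin 2) F) {α β : F} (htr : g.1.trace = α + β)
    (hdet : g.1.det = α * β) : ∃ (P : GL (Fin 2) F) (u : F), (P⁻¹ * g * P).1 = !![α, u; 0, β] := by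
  obtain ⟨v, hv, hgv⟩ := exists_mulVec_eq_smul_of_trace_of_det htr hdet
  obtain ⟨P, hP⟩ := exists_generalLinearGroup_col_zero_eq hv
  rw [← Matrix.mulVec_single_one] at hP
  have hcol : (P⁻¹ * g * P).1.col 0 = Pi.single 0 α := by
    rw [← Matrix.mulVec_single_one, Units.val_mul, Units.val_mul, ← Matrix.mulVec_mulVec,
      ← Matrix.mulVec_mulVec, hP, hgv, Matrix.mulVec_smul, ← hP, Matrix.mulVec_mulVec,
      ← Units.val_mul, inv_mul_cancel, Units.val_one, Matrix.one_mulVec, ← Pi.single_smul,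
      smul_eq_mul, mul_one]
  have h00 : (P⁻¹ * g * P).1 0 0 = α := congrFun hcol 0
  have h10 : (P⁻¹ * g * P).1 1 0 = 0 := congrFun hcol 1
  have htr' : (P⁻¹ * g * P).1.trace = α + β := by
    rw [Units.val_mul, Matrix.trace_mul_comm, ← Units.val_mul, mul_inv_cancel_left, htr]
  refine ⟨P, (P⁻¹ * g * P).1 0 1, ?_⟩
  rw [Matrix.trace_fin_two, h00] at htr'
  rw [Matrix.eta_fin_two (P⁻¹ * g * P).1, h00, h10, add_left_cancel htr']
  rfl

theorem symTrace_upperTriangular (α u β : F) :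
    symTrace n !![α, u; 0, β] = ∑ i ∈ Finset.range (n + 1), α ^ (n - i) * β ^ i := by
  rw [symTrace, Finset.sum_range]
  refine Finset.sum_congr rfl fun i _ => ?_
  have hdeg : (Polynomial.C u + Polynomial.C β * Polynomial.X).natDegree ≤ 1 := by
    rw [add_comm]
    exact Polynomial.natDegree_linear_le
  have hlead := Polynomial.coeff_pow_of_natDegree_le (m := i) hdeg
  rw [mul_one] at hlead
  simp [symCoeff, ← map_pow, hlead]

theorem symTrace_eq (g : GL (Fin 2) F) {α β : F} (htr : g.1.trace = α + β)
    (hdet : g.1.det = α * β) :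
    symTrace n g.1 = ∑ i ∈ Finset.range (n + 1), α ^ (n - i) * β ^ i := by
  obtain ⟨P, u, hP⟩ := exists_conj_upperTriangular g htr hdet
  rw [← symTrace_upperTriangular n α u β, ← hP, ← trace_symRep, ← trace_symRep, map_mul _ _ P,
    LinearMap.trace_mul_comm, ← map_mul, mul_inv_cancel_left]

end SymmetricPowers

/-! ### Characters of `kˣ` and expansions in base `p` -/

section Digits

variable {f : ℕ} [NeZero f]

/-- The indexing of the embeddings for which `j` corresponds to `σ 0 ^ (p ^ j)`. -/
def embIndex (f : ℕ) [NeZero f] : Fin f ≃ ZMod f :=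
  Equiv.ofBijective (fun j => -((j : ℕ) : ZMod f)) <| by
    refine (Fintype.bijective_iff_injective_and_card _).2 ⟨fun i j h => ?_, by simp⟩
    have hij : ((i : ℕ) : ZMod f) = ((j : ℕ) : ZMod f) := neg_injective h
    rw [ZMod.natCast_eq_natCast_iff', Nat.mod_eq_of_lt i.2, Nat.mod_eq_of_lt j.2] at hij
    exact Fin.ext hij

theorem embIndex_apply (j : Fin f) : embIndex f j = -((j : ℕ) : ZMod f) := rfl

/-- The integer `∑ j, s (-j) * p ^ j`, so that `∏ i, σ i ^ s i = σ 0 ^ digitSum p s`. -/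
def digitSum (p : ℕ) (s : ZMod f → ℤ) : ℤ := ∑ j : Fin f, s (embIndex f j) * (p : ℤ) ^ (j : ℕ)

/-- The version of `digitSum` for natural numbers. -/
def natDigitSum (p : ℕ) (s : ZMod f → ℕ) : ℕ := ∑ j : Fin f, s (embIndex f j) * p ^ (j : ℕ)

theorem digitSum_natCast (p : ℕ) (s : ZMod f → ℕ) :
    digitSum p (fun i => (s i : ℤ)) = natDigitSum p s := by
  simp [digitSum, natDigitSum]

theorem digitSum_add (p : ℕ) (s t : ZMod f → ℤ) :
    digitSum p (fun i => s i + t i) = digitSum p s + digitSum p t := by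
  simp [digitSum, add_mul, Finset.sum_add_distrib]

theorem digitSum_sub (p : ℕ) (s t : ZMod f → ℤ) :
    digitSum p (fun i => s i - t i) = digitSum p s - digitSum p t := by
  simp [digitSum, sub_mul, Finset.sum_sub_distrib]

theorem digitSum_mul_left (p : ℕ) (c : ℤ) (s : ZMod f → ℤ) :
    digitSum p (fun i => c * s i) = c * digitSum p s := by
  simp only [digitSum, Finset.mul_sum, mul_assoc]

theorem digitSum_shift (p : ℕ) (s : ZMod f → ℤ) :
    digitSum p (fun i => s (i + 1)) = p * digitSum p s - ((p : ℤ) ^ f - 1) * s 1 := by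
  obtain ⟨g, rfl⟩ : ∃ g, f = g + 1 := ⟨f - 1, (Nat.sub_add_cancel NeZero.one_le).symm⟩
  have hzero : embIndex (g + 1) 0 + 1 = 1 := by simp [embIndex_apply]
  have hlast : embIndex (g + 1) (Fin.last g) = 1 := by
    rw [embIndex_apply, Fin.val_last, neg_eq_iff_add_eq_zero]
    exact_mod_cast ZMod.natCast_self (g + 1)
  have hsucc (j : Fin g) : embIndex (g + 1) j.succ + 1 = embIndex (g + 1) j.castSucc := by
    rw [embIndex_apply, embIndex_apply, Fin.val_succ, Fin.val_castSucc]
    push_cast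
    ring
  rw [digitSum, digitSum, Fin.sum_univ_succ,
    Fin.sum_univ_castSucc (fun j : Fin (g + 1) => s (embIndex (g + 1) j) * _), mul_add,
    Finset.mul_sum]
  simp only [hzero, hlast, hsucc, Fin.val_zero, Fin.val_succ, Fin.val_castSucc, Fin.val_last,
    pow_succ, mul_left_comm (p : ℤ), mul_comm (p : ℤ)]
  ring

theorem digitSum_telescope (p : ℕ) (x : ZMod f → ℤ) :
    digitSum p (fun i => p * x i - x (i + 1)) = ((p : ℤ) ^ f - 1) * x 1 := by
  rw [digitSum_sub, digitSum_mul_left, digitSum_shift]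
  ring

theorem natDigitSum_eq_finFunctionFinEquiv {p : ℕ} (s : ZMod f → Fin p) :
    natDigitSum p (fun i => s i) = finFunctionFinEquiv (fun j => s (embIndex f j)) := by
  rw [finFunctionFinEquiv_apply]
  rfl

theorem natDigitSum_lt {p : ℕ} {s : ZMod f → ℕ} (hs : ∀ i, s i < p) :
    natDigitSum p s < p ^ f := by
  rw [natDigitSum_eq_finFunctionFinEquiv fun i => ⟨s i, hs i⟩]
  exact Fin.is_lt _

theorem natDigitSum_injOn {p : ℕ} {s t : ZMod f → ℕ} (hs : ∀ i, s i < p) (ht : ∀ i, t i < p)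
    (h : natDigitSum p s = natDigitSum p t) : s = t := by
  rw [natDigitSum_eq_finFunctionFinEquiv fun i => ⟨s i, hs i⟩,
    natDigitSum_eq_finFunctionFinEquiv fun i => ⟨t i, ht i⟩] at h
  have hdigits := finFunctionFinEquiv.injective (Fin.ext h)
  ext i
  simpa using congrFun hdigits ((embIndex f).symm i)

theorem natDigitSum_zero (p : ℕ) : natDigitSum p (0 : ZMod f → ℕ) = 0 := by
  simp [natDigitSum]

theorem natDigitSum_sub_one {p : ℕ} (hp : 0 < p) :
    natDigitSum p (fun _ : ZMod f => p - 1) = p ^ f - 1 := by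
  rw [natDigitSum, ← Finset.mul_sum, Fin.sum_univ_eq_sum_range (fun i => p ^ i), mul_comm]
  exact geom_sum_mul_of_one_le hp f

end Digits

section ExpCong

variable {p f : ℕ} [NeZero f]

/-- The congruence of exponents `s` and `t` which expresses that `∏ i, σ i ^ s i` and
`∏ i, σ i ^ t i` agree on `kˣ`. -/
def ExpCong (p : ℕ) (s t : ZMod f → ℤ) : Prop :=
  digitSum p s ≡ digitSum p t [ZMOD (p : ℤ) ^ f - 1]

theorem ExpCong.refl (s : ZMod f → ℤ) : ExpCong p s s := Int.ModEq.refl _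

theorem ExpCong.symm {s t : ZMod f → ℤ} (h : ExpCong p s t) : ExpCong p t s := Int.ModEq.symm h

theorem ExpCong.trans {s t u : ZMod f → ℤ} (h : ExpCong p s t) (h' : ExpCong p t u) :
    ExpCong p s u :=
  Int.ModEq.trans h h'

theorem ExpCong.add {s t s' t' : ZMod f → ℤ} (h : ExpCong p s t) (h' : ExpCong p s' t') :
    ExpCong p (fun i => s i + s' i) (fun i => t i + t' i) := by
  simpa only [ExpCong, digitSum_add] using Int.ModEq.add h h'

theorem ExpCong.sub {s t s' t' : ZMod f → ℤ} (h : ExpCong p s t) (h' : ExpCong p s' t') :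
    ExpCong p (fun i => s i - s' i) (fun i => t i - t' i) := by
  simpa only [ExpCong, digitSum_sub] using Int.ModEq.sub h h'

theorem ExpCong.of_sub_congr {s t s' t' : ZMod f → ℤ} (h : ExpCong p s t)
    (hst : ∀ i, s' i - t' i = s i - t i) : ExpCong p s' t' := by
  convert (h.sub (refl t)).add (refl t') using 2
  · rw [← hst, sub_add_cancel]
  · rw [sub_self, zero_add]

theorem ExpCong.of_sub_eq {s t : ZMod f → ℤ} (x : ZMod f → ℤ)
    (h : ∀ i, s i - t i = p * x i - x (i + 1)) : ExpCong p s t := by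
  refine (Int.modEq_iff_dvd.2 ?_).symm
  rw [← digitSum_sub, funext h, digitSum_telescope]
  exact dvd_mul_right _ _

theorem eq_or_of_modEq_sub_one {q x y : ℕ} (hq : 1 < q) (hx : x < q) (hy : y < q)
    (h : x ≡ y [MOD q - 1]) : x = y ∨ (x = 0 ∧ y = q - 1) ∨ (x = q - 1 ∧ y = 0) := by
  rcases Nat.lt_or_ge x (q - 1) with hx' | hx' <;> rcases Nat.lt_or_ge y (q - 1) with hy' | hy'
  · exact Or.inl (h.eq_of_lt_of_lt hx' hy')
  · obtain rfl : y = q - 1 := by omega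
    exact Or.inr (Or.inl ⟨Nat.eq_zero_of_dvd_of_lt ((Nat.modEq_zero_iff_dvd).1
      (h.trans (Nat.modEq_zero_iff_dvd.2 dvd_rfl))) hx', rfl⟩)
  · obtain rfl : x = q - 1 := by omega
    exact Or.inr (Or.inr ⟨rfl, Nat.eq_zero_of_dvd_of_lt ((Nat.modEq_zero_iff_dvd).1
      (h.symm.trans (Nat.modEq_zero_iff_dvd.2 dvd_rfl))) hy'⟩)
  · exact Or.inl (by omega)

theorem natCast_pow_sub_one (hp : 0 < p) (f : ℕ) : ((p ^ f - 1 : ℕ) : ℤ) = (p : ℤ) ^ f - 1 := by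
  rw [Nat.cast_pred (pow_pos hp f), Nat.cast_pow]

theorem ExpCong.natCast_eq_or (hp : 1 < p) {s t : ZMod f → ℕ} (hs : ∀ i, s i < p)
    (ht : ∀ i, t i < p) (h : ExpCong p (fun i => (s i : ℤ)) fun i => (t i : ℤ)) :
    s = t ∨ (s = 0 ∧ t = fun _ => p - 1) ∨ (s = (fun _ => p - 1) ∧ t = 0) := by
  rw [ExpCong, digitSum_natCast, digitSum_natCast, ← natCast_pow_sub_one (by omega),
    Int.natCast_modEq_iff] at h
  have hzero {u : ZMod f → ℕ} (hu : ∀ i, u i < p) (h0 : natDigitSum p u = 0) : u = 0 :=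
    natDigitSum_injOn hu (fun _ => by simp; omega) (h0.trans (natDigitSum_zero p).symm)
  have hmax {u : ZMod f → ℕ} (hu : ∀ i, u i < p) (h1 : natDigitSum p u = p ^ f - 1) :
      u = fun _ => p - 1 :=
    natDigitSum_injOn hu (fun _ => by omega) (h1.trans (natDigitSum_sub_one (by omega)).symm)
  rcases eq_or_of_modEq_sub_one (Nat.one_lt_pow (NeZero.ne f) hp) (natDigitSum_lt hs)
    (natDigitSum_lt ht) h with heq | ⟨h0, h1⟩ | ⟨h1, h0⟩
  · exact Or.inl (natDigitSum_injOn hs ht heq)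
  · exact Or.inr (Or.inl ⟨hzero hs h0, hmax ht h1⟩)
  · exact Or.inr (Or.inr ⟨hmax hs h1, hzero ht h0⟩)

theorem ExpCong.eq_or (hp : 1 < p) {s t : ZMod f → ℤ} (hs : ∀ i, 0 ≤ s i ∧ s i ≤ p - 1)
    (ht : ∀ i, 0 ≤ t i ∧ t i ≤ p - 1) (h : ExpCong p s t) :
    s = t ∨ (∀ i, s i = 0 ∧ t i = p - 1) ∨ (∀ i, s i = p - 1 ∧ t i = 0) := by
  lift s to ZMod f → ℕ using fun i => (hs i).1
  lift t to ZMod f → ℕ using fun i => (ht i).1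
  rcases h.natCast_eq_or hp (fun i => by zify; linarith [(hs i).2])
    (fun i => by zify; linarith [(ht i).2]) with rfl | ⟨rfl, rfl⟩ | ⟨rfl, rfl⟩
  · exact Or.inl rfl
  · exact Or.inr (Or.inl fun _ => ⟨rfl, Nat.cast_pred (by omega)⟩)
  · exact Or.inr (Or.inr fun _ => ⟨Nat.cast_pred (by omega), rfl⟩)

end ExpCong

section Characters

variable {p : ℕ} {f : ℕ} [NeZero f] {k F : Type*} [Field k] [Field F]

theorem zpow_sum {G ι : Type*} [CommGroup G] (g : G) (S : Finset ι) (t : ι → ℤ) :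
    g ^ (∑ j ∈ S, t j) = ∏ j ∈ S, g ^ t j := by
  classical
  induction S using Finset.induction_on with
  | empty => simp only [Finset.sum_empty, Finset.prod_empty, zpow_zero]
  | insert j S hj ih => rw [Finset.sum_insert hj, Finset.prod_insert hj, zpow_add, ih]

theorem forall_zpow_eq_zpow_iff {G : Type*} [Group G] [IsCyclic G] (a b : ℤ) :
    (∀ g : G, g ^ a = g ^ b) ↔ a ≡ b [ZMOD Nat.card G] := by
  rw [Int.modEq_comm, Int.modEq_iff_dvd, ← IsCyclic.exponent_eq_card,
    Group.exponent_dvd_iff_forall_zpow_eq_one]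
  exact forall_congr' fun g => by rw [zpow_sub, mul_inv_eq_one]

theorem finite_of_natCard_eq_pow [hp : Fact p.Prime] {X : Type*} {d : ℕ}
    (hX : Nat.card X = p ^ d) : Finite X :=
  Nat.finite_of_card_ne_zero (hX ▸ pow_ne_zero _ hp.out.ne_zero)

theorem charP_of_natCard_eq_pow [Fact p.Prime] {d : ℕ} (hk : Nat.card k = p ^ d) : CharP k p := by
  have := finite_of_natCard_eq_pow hk
  have := Fintype.ofFinite k
  exact charP_of_card_eq_prime_pow (Nat.card_eq_fintype_card.symm.trans hk)

theorem charP_of_ringHom_of_natCard_eq_pow [Fact p.Prime] {d : ℕ} (hk : Nat.card k = p ^ d)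
    (φ : k →+* F) : CharP F p :=
  have := charP_of_natCard_eq_pow hk
  charP_of_injective_ringHom φ.injective p

variable {σ : ZMod f → k →+* F} (hσ : ∀ i x, σ (i + 1) x ^ p = σ i x)

include hσ

theorem embedding_embIndex (j : Fin f) (x : k) : σ (embIndex f j) x = σ 0 x ^ p ^ (j : ℕ) := by
  have hneg (l : ℕ) : σ (-(l : ZMod f)) x = σ 0 x ^ p ^ l := by
    induction l with
    | zero => simp
    | succ l ih =>
      rw [← hσ, pow_succ, pow_mul, ← ih]
      congr 3
      push_cast
      ring
  exact hneg j

theorem prod_embedding_pow (s : ZMod f → ℕ) (x : k) :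
    ∏ i, σ i x ^ s i = σ 0 x ^ natDigitSum p s := by
  rw [← (embIndex f).prod_comp, natDigitSum, ← Finset.prod_pow_eq_pow_sum]
  refine Finset.prod_congr rfl fun j _ => ?_
  rw [embedding_embIndex hσ, ← pow_mul, mul_comm]

theorem prod_embedding_zpow (s : ZMod f → ℤ) (x : kˣ) :
    ∏ i, σ i x ^ s i = σ 0 ((x ^ digitSum p s : kˣ) : k) := by
  rw [← (embIndex f).prod_comp, digitSum, zpow_sum, Units.coe_prod, map_prod]
  refine Finset.prod_congr rfl fun j _ => ?_
  rw [embedding_embIndex hσ, Units.val_zpow_eq_zpow_val, map_zpow₀, ← zpow_natCast, ← zpow_mul,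
    mul_comm, Nat.cast_pow]

theorem prod_embedding_eq_iff [hp : Fact p.Prime] (hk : Nat.card k = p ^ f) (s t : ZMod f → ℤ) :
    (∀ x : k, x ≠ 0 → ∏ i, σ i x ^ s i = ∏ i, σ i x ^ t i) ↔ ExpCong p s t := by
  have := finite_of_natCard_eq_pow hk
  rw [ExpCong, ← natCast_pow_sub_one hp.out.pos, ← hk, ← Nat.card_units, ← forall_zpow_eq_zpow_iff]
  refine ⟨fun h x => ?_, fun h x hx => ?_⟩
  · have hx := h x x.ne_zero
    rw [prod_embedding_zpow hσ, prod_embedding_zpow hσ] at hx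
    exact Units.ext ((σ 0).injective hx)
  · rw [← Units.val_mk0 hx, prod_embedding_zpow hσ, prod_embedding_zpow hσ, h]

theorem eq_zero_of_sum_prod_embedding_eq_zero [Fact p.Prime] (hk : Nat.card k = p ^ f)
    {ι : Type*} [Fintype ι] (e : ι → ZMod f → ℕ) (he : ∀ a i, e a i < p)
    (hinj : Function.Injective e) (c : ι → F)
    (h : ∀ x : k, ∑ a, c a * ∏ i, σ i x ^ e a i = 0) (a : ι) : c a = 0 := by
  classical
  have := finite_of_natCard_eq_pow hk
  have := Fintype.ofFinite k
  simp only [prod_embedding_pow hσ] at h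
  -- In terms of `σ 0` the sum is a polynomial function of degree less than `#k` vanishing on `k`.
  let Q : Polynomial F := ∑ a, Polynomial.C (c a) * Polynomial.X ^ natDigitSum p (e a)
  have hQ : Q = 0 := by
    refine Polynomial.eq_zero_of_degree_lt_of_eval_finset_eq_zero (Finset.univ.image (σ 0)) ?_ ?_
    · rw [Finset.card_image_of_injective _ (σ 0).injective, Finset.card_univ,
        ← Nat.card_eq_fintype_card, hk]
      refine (Polynomial.degree_sum_le _ _).trans_lt ?_
      rw [Finset.sup_lt_iff (WithBot.bot_lt_coe _)]
      exact fun a _ => (Polynomial.degree_C_mul_X_pow_le _ _).trans_lt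
        (WithBot.coe_lt_coe.2 (natDigitSum_lt (he a)))
    · simpa [Q, Polynomial.eval_finsetSum] using h
  have hcoeff : Q.coeff (natDigitSum p (e a)) = c a := by
    simp only [Q, Polynomial.finsetSum_coeff, Polynomial.coeff_C_mul_X_pow]
    rw [Finset.sum_eq_single a (fun b _ hb => if_neg fun h =>
      hb (hinj (natDigitSum_injOn (he b) (he a) h.symm))) (by simp), if_pos rfl]
  rw [← hcoeff, hQ, Polynomial.coeff_zero]

end Characters

section FixedVector

theorem exists_mem_ne_zero_forall_apply_eq {p : ℕ} [hp : Fact p.Prime] {F V G : Type*} [Field F]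
    [CharP F p] [AddCommGroup V] [Module F V] [Group G] [Finite G] (hG : IsPGroup p G)
    (ρ : Representation F G V) {W : Submodule F V} (hW : ∀ g, ∀ v ∈ W, ρ g v ∈ W) (hbot : W ≠ ⊥) :
    ∃ v ∈ W, v ≠ 0 ∧ ∀ g, ρ g v = v := by
  -- `G` acts on the subgroup spanned by the orbit of a vector, which is a finite `p`-group.
  obtain ⟨w, hwW, hw⟩ := W.exists_mem_ne_zero_of_ne_bot hbot
  let M : AddSubgroup V := AddSubgroup.closure (Set.range fun g => ρ g w)
  have hwM : w ∈ M := AddSubgroup.subset_closure ⟨1, by simp⟩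
  have hMW : M ≤ W.toAddSubgroup :=
    (AddSubgroup.closure_le _).2 (Set.range_subset_iff.2 fun g => hW g w hwW)
  have hM (g : G) : M ≤ M.comap (ρ g).toAddMonoidHom := by
    refine (AddSubgroup.closure_le _).2 (Set.range_subset_iff.2 fun h => ?_)
    exact AddSubgroup.subset_closure ⟨g * h, by simp⟩
  let _ : MulAction G M :=
    { smul g x := ⟨ρ g x, hM g x.2⟩
      one_smul x := Subtype.ext (by change ρ 1 x.1 = x.1; simp)
      mul_smul g h x := Subtype.ext (by change ρ (g * h) x.1 = ρ g (ρ h x.1); simp) }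
  have hsmul (x : M) : p • x = 0 := Subtype.ext <| by
    rw [AddSubgroup.coe_nsmul, ← Nat.cast_smul_eq_nsmul F, CharP.cast_eq_zero, zero_smul,
      AddSubgroup.coe_zero]
  have : AddGroup.FG M := AddGroup.closure_finite_fg _
  have : Finite M := AddCommGroup.finite_of_fg_isAddTorsion M fun x =>
    isOfFinAddOrder_iff_nsmul_eq_zero.2 ⟨p, hp.out.pos, hsmul x⟩
  have hdvd : p ∣ Nat.card M := by
    rw [← addOrderOf_eq_prime (hsmul ⟨w, hwM⟩) fun h => hw (congrArg Subtype.val h)]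
    exact addOrderOf_dvd_natCard _
  obtain ⟨v, hv, hv0⟩ := hG.exists_fixed_point_of_prime_dvd_card_of_fixed_point M hdvd (a := 0)
    fun g => Subtype.ext (map_zero (ρ g))
  exact ⟨v, hMW v.2, fun h => hv0 (Subtype.ext h.symm), fun g => congrArg Subtype.val (hv g)⟩

end FixedVector

section Mu

/-- The underlying space of `μ_{m,n}`. -/
abbrev MuSpace (F : Type*) [Field F] {f : ℕ} (n : ZMod f → ℕ) : Type _ :=
  PiTensorProduct F fun i => MvPolynomial.homogeneousSubmodule (Fin 2) F (n i)

variable {k F : Type*} [Field k] [Field F] {f : ℕ} [NeZero f] (σ : ZMod f → k →+* F)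
  (m : ZMod f → ℤ) (n : ZMod f → ℕ)

/-- The basis of `μ_{m,n}` consisting of the tensor products of monomials. The element with index
`0` is a highest weight vector. -/
def muBasis (F : Type*) [Field F] (n : ZMod f → ℕ) :
    Module.Basis (∀ i, Fin (n i + 1)) F (MuSpace F n) :=
  Basis.piTensorProduct fun i => symBasis F (n i)

omit [NeZero f] in
theorem mu_tprod (g : GL (Fin 2) k)
    (x : ∀ i, MvPolynomial.homogeneousSubmodule (Fin 2) F (n i)) :
    mu σ m n g (PiTensorProduct.tprod F x) = PiTensorProduct.tprod F fun i =>
      (σ i g.1.det) ^ m i •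
        symRep F (n i) (Matrix.GeneralLinearGroup.map (σ i) g) (x i) := by
  have hdet (i : ZMod f) : (((Matrix.GeneralLinearGroup.det ^ m i)
      (Matrix.GeneralLinearGroup.map (σ i) g) : Fˣ) : F) = σ i g.1.det ^ m i := by
    rw [MonoidHom.zpow_apply, Matrix.GeneralLinearGroup.map_det]
    simp
  refine (PiTensorProduct.map_tprod _ _).trans (congrArg _ (funext fun i => ?_))
  rw [← hdet]
  rfl

theorem muBasis_repr_mu (g : GL (Fin 2) k) (a b : ∀ i, Fin (n i + 1)) :
    (muBasis F n).repr (mu σ m n g (muBasis F n a)) b =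
      ∏ i, (σ i g.1.det) ^ m i * symCoeff (n i) (g.1.map (σ i)) (a i) (b i) := by
  rw [muBasis, Basis.piTensorProduct_apply, mu_tprod, Basis.piTensorProduct_repr_tprod_apply]
  refine Finset.prod_congr rfl fun i _ => ?_
  rw [map_smul, Finsupp.smul_apply, smul_eq_mul, symBasis_repr_symRep]
  rfl

theorem trace_mu (g : GL (Fin 2) k) :
    LinearMap.trace F _ (mu σ m n g) =
      ∏ i, (σ i g.1.det) ^ m i * symTrace (n i) (g.1.map (σ i)) := by
  simp only [trace_eq_sum_repr (muBasis F n), muBasis_repr_mu, symTrace, Finset.mul_sum]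
  rw [Finset.prod_univ_sum, Fintype.piFinset_univ]

instance finiteDimensional_mu : FiniteDimensional F (MuSpace F n) :=
  Module.Basis.finiteDimensional_of_finite (muBasis F n)

theorem finrank_mu : Module.finrank F (MuSpace F n) = ∏ i, (n i + 1) := by
  rw [Module.finrank_eq_card_basis (muBasis F n)]
  simp

theorem mu_congr {m m' : ZMod f → ℤ}
    (h : ∀ x : k, x ≠ 0 → ∏ i, σ i x ^ m i = ∏ i, σ i x ^ m' i) : mu σ m n = mu σ m' n := by
  ext1 g
  refine (muBasis F n).ext fun a => (muBasis F n).ext_elem fun b => ?_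
  rw [muBasis_repr_mu, muBasis_repr_mu, Finset.prod_mul_distrib, Finset.prod_mul_distrib, h]
  exact ((Matrix.isUnit_iff_isUnit_det _).1 g.isUnit).ne_zero

/-- The upper triangular unipotent matrices, as a homomorphism from the additive group. -/
def upperUnipotent : Multiplicative k →* GL (Fin 2) k where
  toFun t := Matrix.GeneralLinearGroup.mkOfDetNeZero !![1, t.toAdd; 0, 1] (by simp)
  map_one' := Units.ext Matrix.one_fin_two.symm
  map_mul' s t := Units.ext <| by
    simp [Matrix.GeneralLinearGroup.mkOfDetNeZero, add_comm]

theorem coe_upperUnipotent (t : Multiplicative k) :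
    (upperUnipotent t).1 = !![1, t.toAdd; 0, 1] := rfl

/-- The lower triangular unipotent matrices. -/
def lowerUnipotent (t : k) : GL (Fin 2) k :=
  Matrix.GeneralLinearGroup.mkOfDetNeZero !![1, 0; t, 1] (by simp)

theorem coe_lowerUnipotent (t : k) : (lowerUnipotent t).1 = !![1, 0; t, 1] := rfl

theorem symCoeff_lowerUnipotent (n : ℕ) (t : F) (b : ℕ) :
    symCoeff n !![1, 0; t, 1] 0 b = n.choose b * t ^ b := by
  have hcomp : ((1 + Polynomial.X) ^ n : Polynomial F).comp (Polynomial.C t * Polynomial.X) =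
      (1 + Polynomial.C t * Polynomial.X) ^ n := by simp
  rw [← Polynomial.coeff_one_add_X_pow, ← Polynomial.comp_C_mul_X_coeff, hcomp]
  simp [symCoeff]

theorem symCoeff_zero_left (n : ℕ) {g : Matrix (Fin 2) (Fin 2) F} (hg : g 1 0 = 0) (b : ℕ) :
    symCoeff n g 0 b = if b = 0 then g 0 0 ^ n else 0 := by
  simp [symCoeff, hg, ← map_pow, Polynomial.coeff_C]

theorem repr_mu_upperUnipotent (t : k) (a : ∀ i, Fin (n i + 1)) :
    (muBasis F n).repr (mu σ m n (upperUnipotent (.ofAdd t)) (muBasis F n a)) 0 =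
      ∏ i, σ i t ^ (a i : ℕ) := by
  rw [muBasis_repr_mu]
  refine Finset.prod_congr rfl fun i _ => ?_
  simp [coe_upperUnipotent, symCoeff, Polynomial.coeff_zero_eq_eval_zero]

theorem repr_mu_lowerUnipotent (t : k) (b : ∀ i, Fin (n i + 1)) :
    (muBasis F n).repr (mu σ m n (lowerUnipotent t) (muBasis F n 0)) b =
      (∏ i, ((n i).choose (b i) : F)) * ∏ i, σ i t ^ (b i : ℕ) := by
  rw [muBasis_repr_mu, ← Finset.prod_mul_distrib]
  refine Finset.prod_congr rfl fun i _ => ?_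
  have hmap : (!![1, 0; t, 1] : Matrix (Fin 2) (Fin 2) k).map (σ i) = !![1, 0; σ i t, 1] := by
    ext i j
    fin_cases i <;> fin_cases j <;> simp
  rw [coe_lowerUnipotent, hmap, Pi.zero_apply, Fin.val_zero, symCoeff_lowerUnipotent]
  simp

theorem mu_upperTriangular {g : GL (Fin 2) k} (hg : g.1 1 0 = 0) :
    mu σ m n g (muBasis F n 0) =
      (∏ i, σ i g.1.det ^ m i * σ i (g.1 0 0) ^ n i) • muBasis F n 0 := by
  classical
  refine (muBasis F n).ext_elem fun b => ?_
  rw [muBasis_repr_mu, map_smul, Finsupp.smul_apply, Module.Basis.repr_self,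
    Finsupp.single_apply, smul_eq_mul]
  have hcoeff (i : ZMod f) : symCoeff (n i) (g.1.map (σ i)) ((0 : ∀ i, Fin (n i + 1)) i) (b i) =
      if b i = 0 then σ i (g.1 0 0) ^ n i else 0 := by
    rw [Pi.zero_apply, Fin.val_zero, symCoeff_zero_left _ (by rw [Matrix.map_apply, hg, map_zero]),
      Matrix.map_apply]
    simp only [Fin.val_eq_zero_iff]
  simp only [hcoeff]
  split_ifs with hb
  · simp [← hb]
  · obtain ⟨i, hi⟩ := Function.ne_iff.1 (Ne.symm hb)
    rw [mul_zero]
    exact Finset.prod_eq_zero (Finset.mem_univ i) (by rw [if_neg (id hi : b i ≠ 0), mul_zero])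

theorem mu_upperUnipotent (t : Multiplicative k) :
    mu σ m n (upperUnipotent t) (muBasis F n 0) = muBasis F n 0 := by
  rw [mu_upperTriangular _ _ _ (by simp [coe_upperUnipotent])]
  simp [coe_upperUnipotent]

theorem not_dvd_choose {p n : ℕ} (hp : p.Prime) (hn : n < p) {b : ℕ} (hb : b ≤ n) :
    ¬ p ∣ n.choose b := fun h =>
  (hp.factorization_pos_of_dvd (Nat.choose_pos hb).ne' h).ne'
    (Nat.factorization_choose_eq_zero_of_lt hn)

theorem eq_of_expCong_of_prod_add_one_eq {p : ℕ} (hp : 1 < p) {n n' : ZMod f → ℕ}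
    (hn : ∀ i, n i < p) (hn' : ∀ i, n' i < p)
    (h : ExpCong p (fun i => (n i : ℤ)) fun i => (n' i : ℤ))
    (hprod : ∏ i, (n i + 1) = ∏ i, (n' i + 1)) : n = n' := by
  have hlt : 1 < p ^ f := Nat.one_lt_pow (NeZero.ne f) hp
  rcases h.natCast_eq_or hp hn hn' with h | ⟨rfl, rfl⟩ | ⟨rfl, rfl⟩
  · exact h
  all_goals
    simp only [Pi.zero_apply, zero_add, Finset.prod_const, one_pow, Finset.card_univ, ZMod.card,
      Nat.sub_add_cancel hp.le] at hprod
    omega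

variable {p : ℕ} [hp : Fact p.Prime] {σ} (hσ : ∀ i x, σ (i + 1) x ^ p = σ i x)
  (hk : Nat.card k = p ^ f) {n} (hn : ∀ i, n i ≤ p - 1)

include hσ hk hn

theorem eq_zero_of_sum_mul_prod_embedding_pow_eq_zero {c : (∀ i, Fin (n i + 1)) → F}
    (h : ∀ t : k, ∑ a, c a * ∏ i, σ i t ^ (a i : ℕ) = 0) (a : ∀ i, Fin (n i + 1)) : c a = 0 :=
  eq_zero_of_sum_prod_embedding_eq_zero hσ hk (fun a i => (a i : ℕ))
    (fun a i => by have := (a i).2; have := hn i; have := hp.out.pos; omega)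
    (fun _ _ h => funext fun i => Fin.ext (congrFun h i)) c h a

theorem eq_smul_of_upperUnipotent_fixed {v : MuSpace F n}
    (hv : ∀ t, mu σ m n (upperUnipotent t) v = v) :
    v = (muBasis F n).repr v 0 • muBasis F n 0 := by
  classical
  have hsum (t : k) : ∑ a, (muBasis F n).repr v a * ∏ i, σ i t ^ (a i : ℕ) =
      (muBasis F n).repr v 0 := by
    conv_rhs => rw [← hv (.ofAdd t), ← (muBasis F n).sum_repr v, map_sum, map_sum,
      Finsupp.coe_finsetSum, Finset.sum_apply]
    refine Finset.sum_congr rfl fun a _ => ?_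
    rw [map_smul, map_smul, Finsupp.smul_apply, smul_eq_mul, repr_mu_upperUnipotent]
  have hcoord := eq_zero_of_sum_mul_prod_embedding_pow_eq_zero hσ hk hn
    (c := fun a => (muBasis F n).repr v a - if a = 0 then (muBasis F n).repr v 0 else 0)
    fun t => by simp [sub_mul, Finset.sum_sub_distrib, hsum]
  refine (muBasis F n).ext_elem fun a => ?_
  rw [sub_eq_zero.1 (hcoord a)]
  simp [Finsupp.single_apply, eq_comm]

theorem eq_top_of_muBasis_zero_mem (W : Submodule F (MuSpace F n))
    (hW : ∀ g, ∀ v ∈ W, mu σ m n g v ∈ W) (h0 : muBasis F n 0 ∈ W) : W = ⊤ := by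
  have := charP_of_ringHom_of_natCard_eq_pow hk (σ 0)
  have hn' (i : ZMod f) : n i < p := by have := hn i; have := hp.out.pos; omega
  by_contra hne
  obtain ⟨ℓ, hℓ, hℓW⟩ :=
    Submodule.exists_le_ker_of_lt_top (V := MuSpace F n) W (lt_top_iff_ne_top.2 hne)
  have hcoeff := eq_zero_of_sum_mul_prod_embedding_pow_eq_zero hσ hk hn
    (c := fun a => (∏ i, ((n i).choose (a i) : F)) * ℓ (muBasis F n a)) fun t => by
      have hker : ℓ (mu σ m n (lowerUnipotent t) (muBasis F n 0)) = 0 := hℓW (hW _ _ h0)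
      rw [← (muBasis F n).sum_repr (mu σ m n (lowerUnipotent t) (muBasis F n 0)), map_sum] at hker
      rw [← hker]
      refine Finset.sum_congr rfl fun a _ => ?_
      rw [map_smul, repr_mu_lowerUnipotent, smul_eq_mul]
      ring
  refine hℓ ((muBasis F n).ext fun b => (mul_eq_zero.1 (hcoeff b)).resolve_left ?_)
  refine Finset.prod_ne_zero_iff.2 fun i _ => ?_
  rw [Ne, CharP.cast_eq_zero_iff F p]
  exact not_dvd_choose hp.out (hn' i) (b i).is_le

theorem mu_isIrreducible : Representation.IsIrreducible (V := MuSpace F n) (mu σ m n) := by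
  have := charP_of_ringHom_of_natCard_eq_pow hk (σ 0)
  have : Finite (Multiplicative k) := finite_of_natCard_eq_pow hk
  have hG : IsPGroup p (Multiplicative k) := IsPGroup.of_card (n := f) hk
  have hbot_or_top (W : Subrepresentation (mu σ m n)) :
      W.toSubmodule = ⊥ ∨ W.toSubmodule = ⊤ := by
    refine or_iff_not_imp_left.2 fun hW => ?_
    have hstable (g) (v) (hv : v ∈ W.toSubmodule) : mu σ m n g v ∈ W.toSubmodule :=
      W.apply_mem_toSubmodule g hv
    obtain ⟨v, hvW, hv0, hv⟩ := exists_mem_ne_zero_forall_apply_eq (V := MuSpace F n) hG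
      ((mu σ m n).comp upperUnipotent) (fun t => hstable _) hW
    have hsmul := eq_smul_of_upperUnipotent_fixed m hσ hk hn hv
    have hc : (muBasis F n).repr v 0 ≠ 0 := fun hc => hv0 (by rw [hsmul, hc, zero_smul])
    refine eq_top_of_muBasis_zero_mem m hσ hk hn _ hstable ?_
    rwa [← Submodule.smul_mem_iff _ hc, ← hsmul]
  have : Nontrivial (Subrepresentation (mu σ m n)) := by
    refine ⟨⊥, ⊤, fun h => (muBasis F n).ne_zero 0 ((Submodule.mem_bot F).1 ?_)⟩
    have htop : muBasis F n 0 ∈ (⊤ : Subrepresentation (mu σ m n)) := Submodule.mem_top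
    rwa [← h] at htop
  exact
    { eq_bot_or_eq_top := fun W => (hbot_or_top W).imp
        (fun h => Subrepresentation.toSubmodule_injective h)
        (fun h => Subrepresentation.toSubmodule_injective h) }

theorem exists_eq_smul_of_commute_mu (φ : MuSpace F n →ₗ[F] MuSpace F n)
    (hφ : ∀ g x, φ (mu σ m n g x) = mu σ m n g (φ x)) : ∃ c : F, ∀ x, φ x = c • x := by
  have hsmul := eq_smul_of_upperUnipotent_fixed m hσ hk hn (v := φ (muBasis F n 0)) fun t => by
    rw [← hφ, mu_upperUnipotent]
  refine ⟨(muBasis F n).repr (φ (muBasis F n 0)) 0, fun x => ?_⟩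
  have htop := eq_top_of_muBasis_zero_mem m hσ hk hn
    (LinearMap.eqLocus φ ((muBasis F n).repr (φ (muBasis F n 0)) 0 • LinearMap.id))
    (fun g v hv => by
      rw [LinearMap.mem_eqLocus] at hv ⊢
      rw [hφ, hv]
      simp)
    (LinearMap.mem_eqLocus.2 hsmul)
  exact LinearMap.mem_eqLocus.1 (htop.ge Submodule.mem_top)

omit hn in
theorem prod_eq_prod_of_isoRep_mu {m m' : ZMod f → ℤ} {n' : ZMod f → ℕ} (hn' : ∀ i, n' i ≤ p - 1)
    (h : IsoRep (mu σ m n) (mu σ m' n')) {g : GL (Fin 2) k} (hg : g.1 1 0 = 0) :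
    ∏ i, σ i g.1.det ^ m i * σ i (g.1 0 0) ^ n i =
      ∏ i, σ i g.1.det ^ m' i * σ i (g.1 0 0) ^ n' i := by
  obtain ⟨φ⟩ := h
  have hφ (g x) : φ.toLinearEquiv (mu σ m n g x) = mu σ m' n' g (φ.toLinearEquiv x) :=
    LinearMap.congr_fun (φ.isIntertwining' g) x
  have hsmul := eq_smul_of_upperUnipotent_fixed m' hσ hk hn'
    (v := φ.toLinearEquiv (muBasis F n 0)) fun t => by rw [← hφ, mu_upperUnipotent]
  have hc : (muBasis F n').repr (φ.toLinearEquiv (muBasis F n 0)) 0 ≠ 0 := fun hc =>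
    φ.toLinearEquiv.map_ne_zero_iff.2 ((muBasis F n).ne_zero 0) (by rw [hsmul, hc, zero_smul])
  have hact := hφ g (muBasis F n 0)
  rw [mu_upperTriangular _ _ _ hg, map_smul, hsmul, map_smul, mu_upperTriangular _ _ _ hg,
    smul_comm] at hact
  exact smul_left_injective F ((muBasis F n').ne_zero 0)
    (smul_right_injective (MuSpace F n') hc hact)

theorem isoRep_mu_iff {m m' : ZMod f → ℤ} {n' : ZMod f → ℕ} (hn' : ∀ i, n' i ≤ p - 1) :
    IsoRep (mu σ m n) (mu σ m' n') ↔ n = n' ∧ ExpCong p m m' := by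
  rw [← prod_embedding_eq_iff hσ hk]
  constructor
  swap
  · rintro ⟨rfl, h⟩
    rw [mu_congr σ n h]
    exact ⟨Representation.Equiv.refl _⟩
  intro h
  have hdiag {s t : k} (hs : s ≠ 0) (ht : t ≠ 0) : ∏ i, σ i (s * t) ^ m i * σ i s ^ n i =
      ∏ i, σ i (s * t) ^ m' i * σ i s ^ n' i := by
    simpa [Matrix.GeneralLinearGroup.mkOfDetNeZero] using prod_eq_prod_of_isoRep_mu hσ hk hn' h
      (g := Matrix.GeneralLinearGroup.mkOfDetNeZero !![s, 0; 0, t] (by simp [hs, ht])) rfl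
  have hm (x : k) (hx : x ≠ 0) : ∏ i, σ i x ^ m i = ∏ i, σ i x ^ m' i := by
    simpa using hdiag one_ne_zero hx
  refine ⟨?_, hm⟩
  have hexp : ExpCong p (fun i => (n i : ℤ)) fun i => (n' i : ℤ) := by
    rw [← prod_embedding_eq_iff hσ hk]
    intro x hx
    have hx' := hdiag hx one_ne_zero
    rw [Finset.prod_mul_distrib, Finset.prod_mul_distrib, mul_one, hm x hx] at hx'
    simpa only [zpow_natCast] using mul_left_cancel₀ (Finset.prod_ne_zero_iff.2 fun i _ =>
      zpow_ne_zero _ ((map_ne_zero _).2 hx)) hx'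
  have hdim := h.some.toLinearEquiv.finrank_eq
  rw [finrank_mu, finrank_mu] at hdim
  have hpos := hp.out.pos
  exact eq_of_expCong_of_prod_add_one_eq hp.out.one_lt (fun i => by have := hn i; omega)
    (fun i => by have := hn' i; omega) hexp hdim

end Mu

/-! ### The character of the reduction of a principal series -/

section PrincipalSeries

variable {R k : Type*} [CommRing R] [Field k] (ψ₁ ψ₂ : kˣ →* Rˣ)

theorem charRep_borelChar (b : borel k) (r : R) :
    charRep (borelChar ψ₁ ψ₂) b r =
      MulChar.ofUnitHom ψ₁ (b.1.1 0 0) * MulChar.ofUnitHom ψ₂ (b.1.1 1 1) * r := by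
  have h0 : b.1.1 0 0 = (borelDiag 0 b : kˣ) := rfl
  have h1 : b.1.1 1 1 = (borelDiag 1 b : kˣ) := rfl
  rw [h0, h1, MulChar.ofUnitHom_coe, MulChar.ofUnitHom_coe]
  rfl

/-- Representatives of `B \ GL₂(k)`, which is the projective line over `k`; `none` is the point
at infinity. -/
def cosetRep : Option k → GL (Fin 2) k
  | none => 1
  | some y => Matrix.GeneralLinearGroup.mkOfDetNeZero !![0, 1; 1, y] (by simp)

theorem coe_cosetRep_some (y : k) : (cosetRep (some y)).1 = !![0, 1; 1, y] := rfl

open Classical in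
/-- The extension of a function on the coset representatives to an element of the principal
series. -/
def principalExtend (c : Option k → R) (g : GL (Fin 2) k) : R :=
  if g.1 1 0 = 0 then
    MulChar.ofUnitHom ψ₁ (g.1 0 0) * MulChar.ofUnitHom ψ₂ (g.1 1 1) * c none
  else
    MulChar.ofUnitHom ψ₁ (-g.1.det / g.1 1 0) * MulChar.ofUnitHom ψ₂ (g.1 1 0) *
      c (some (g.1 1 1 / g.1 1 0))

theorem principalExtend_mul (c : Option k → R) (b : borel k) (g : GL (Fin 2) k) :
    principalExtend ψ₁ ψ₂ c (b.1 * g) =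
      MulChar.ofUnitHom ψ₁ (b.1.1 0 0) * MulChar.ofUnitHom ψ₂ (b.1.1 1 1) *
        principalExtend ψ₁ ψ₂ c g := by
  have hb : b.1.1 1 0 = 0 := b.2
  have h1 : b.1.1 1 1 ≠ 0 := (borelDiag 1 b).ne_zero
  have hrow (j : Fin 2) : (b.1 * g).1 1 j = b.1.1 1 1 * g.1 1 j := by
    rw [Units.val_mul, Matrix.mul_apply, Fin.sum_univ_two, hb, zero_mul, zero_add]
  have hentry : (b.1 * g).1 0 0 = b.1.1 0 0 * g.1 0 0 + b.1.1 0 1 * g.1 1 0 := by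
    rw [Units.val_mul, Matrix.mul_apply, Fin.sum_univ_two]
  have hdet : (b.1 * g).1.det = b.1.1 0 0 * b.1.1 1 1 * g.1.det := by
    rw [Units.val_mul, Matrix.det_mul, Matrix.det_fin_two b.1.1, hb, mul_zero, sub_zero]
  unfold principalExtend
  rw [hrow, hrow, hentry, hdet]
  by_cases hg : g.1 1 0 = 0
  · rw [if_pos (by rw [hg, mul_zero]), if_pos hg, hg, mul_zero, add_zero, map_mul, map_mul]
    ring
  · have hdiv : -(b.1.1 0 0 * b.1.1 1 1 * g.1.det) / (b.1.1 1 1 * g.1 1 0) =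
        b.1.1 0 0 * (-g.1.det / g.1 1 0) := by
      field_simp
    rw [if_neg (mul_ne_zero h1 hg), if_neg hg, mul_div_mul_left _ _ h1, hdiv, map_mul, map_mul]
    ring

theorem principalExtend_cosetRep (c : Option k → R) (o : Option k) :
    principalExtend ψ₁ ψ₂ c (cosetRep o) = c o := by
  cases o with
  | none => simp [principalExtend, cosetRep]
  | some y => simp [principalExtend, coe_cosetRep_some]

theorem exists_borel_mul_cosetRep (g : GL (Fin 2) k) :
    ∃ (b : borel k) (o : Option k), g = b.1 * cosetRep o := by
  by_cases hg : g.1 1 0 = 0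
  · exact ⟨⟨g, hg⟩, none, (mul_one g).symm⟩
  have hdet : g.1.det ≠ 0 := Matrix.GeneralLinearGroup.det_ne_zero g
  refine ⟨⟨Matrix.GeneralLinearGroup.mkOfDetNeZero
    !![-g.1.det / g.1 1 0, g.1 0 0; 0, g.1 1 0] ?_, rfl⟩, some (g.1 1 1 / g.1 1 0), Units.ext ?_⟩
  · simp [hdet, hg]
  · rw [Units.val_mul, coe_cosetRep_some]
    change g.1 = !![-g.1.det / g.1 1 0, g.1 0 0; 0, g.1 1 0] * _
    rw [Matrix.mul_fin_two, Matrix.det_fin_two]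
    ext i j
    fin_cases i <;> fin_cases j <;> simp <;> field_simp
    ring

theorem eq_principalExtend (φ : GL (Fin 2) k → R)
    (hφ : φ ∈ Representation.coindV (borel k).subtype (charRep (borelChar ψ₁ ψ₂)))
    (g : GL (Fin 2) k) : φ g = principalExtend ψ₁ ψ₂ (fun o => φ (cosetRep o)) g := by
  obtain ⟨b, o, rfl⟩ := exists_borel_mul_cosetRep g
  rw [principalExtend_mul, principalExtend_cosetRep, ← charRep_borelChar]
  exact hφ b _

/-- The basis of the principal series dual to evaluation at the points of the projective line. -/
def principalBasis [Fintype k] : Module.Basis (Option k) R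
    (Representation.coindV (borel k).subtype (charRep (borelChar ψ₁ ψ₂))) :=
  Module.Basis.ofEquivFun
    { toFun := fun φ o => φ.1 (cosetRep o)
      map_add' := fun φ φ' => rfl
      map_smul' := fun r φ => rfl
      invFun := fun c => ⟨principalExtend ψ₁ ψ₂ c, fun b g => by
        rw [charRep_borelChar]
        exact principalExtend_mul ψ₁ ψ₂ c b g⟩
      left_inv := fun φ => Subtype.ext (funext fun g => (eq_principalExtend ψ₁ ψ₂ φ.1 φ.2 g).symm)
      right_inv := fun c => funext fun o => principalExtend_cosetRep ψ₁ ψ₂ c o }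

theorem coe_cosetRep_some_mul (y : k) (g : GL (Fin 2) k) : (cosetRep (some y) * g).1 =
    !![g.1 1 0, g.1 1 1; g.1 0 0 + y * g.1 1 0, g.1 0 1 + y * g.1 1 1] := by
  rw [Units.val_mul, coe_cosetRep_some]
  conv_lhs => rw [Matrix.eta_fin_two g.1, Matrix.mul_fin_two]
  simp

theorem det_cosetRep_some_mul (y : k) (g : GL (Fin 2) k) :
    (cosetRep (some y) * g).1.det = -g.1.det := by
  rw [Units.val_mul, Matrix.det_mul, coe_cosetRep_some]
  simp

open Classical in
theorem trace_principalSeries [Fintype k] (g : GL (Fin 2) k) :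
    LinearMap.trace R _ (principalSeries (R := R) ψ₁ ψ₂ g) =
      (if g.1 1 0 = 0 then MulChar.ofUnitHom ψ₁ (g.1 0 0) * MulChar.ofUnitHom ψ₂ (g.1 1 1) else 0) +
      ∑ y : k, if g.1 0 0 + y * g.1 1 0 ≠ 0 ∧
          g.1 0 1 + y * g.1 1 1 = y * (g.1 0 0 + y * g.1 1 0) then
        MulChar.ofUnitHom ψ₁ (g.1.det / (g.1 0 0 + y * g.1 1 0)) *
          MulChar.ofUnitHom ψ₂ (g.1 0 0 + y * g.1 1 0) else 0 := by
  have hdiag (o : Option k) : (principalBasis (R := R) ψ₁ ψ₂).repr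
      (principalSeries ψ₁ ψ₂ g (principalBasis ψ₁ ψ₂ o)) o =
        principalExtend ψ₁ ψ₂ (Pi.single o 1) (cosetRep o * g) := by
    rw [principalBasis, Module.Basis.coe_ofEquivFun]
    rfl
  simp only [trace_eq_sum_repr (principalBasis ψ₁ ψ₂), hdiag, Fintype.sum_option]
  congr 1
  · simp [principalExtend, cosetRep]
  · refine Finset.sum_congr rfl fun y _ => ?_
    rw [principalExtend, det_cosetRep_some_mul, coe_cosetRep_some_mul]
    simp only [Matrix.of_apply, Matrix.cons_val', Matrix.cons_val_zero, Matrix.cons_val_one,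
      Matrix.cons_val_fin_one, neg_neg]
    by_cases h0 : g.1 0 0 + y * g.1 1 0 = 0
    · simp [h0]
    · rw [if_neg h0]
      simp only [Pi.single_apply, Option.some.injEq, div_eq_iff h0, ne_eq, h0, not_false_eq_true,
        true_and, mul_ite, mul_one, mul_zero]

open Classical in
theorem trace_principalSeries_of_upperTriangular [Fintype k] {g : GL (Fin 2) k} {α u β : k}
    (hg : g.1 = !![α, u; 0, β]) : LinearMap.trace R _ (principalSeries (R := R) ψ₁ ψ₂ g) =
      MulChar.ofUnitHom ψ₁ α * MulChar.ofUnitHom ψ₂ β +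
        Finset.card {y : k | u + y * β = y * α} *
          (MulChar.ofUnitHom ψ₁ β * MulChar.ofUnitHom ψ₂ α) := by
  have hα : α ≠ 0 := by
    rintro rfl
    exact Matrix.GeneralLinearGroup.det_ne_zero g (by simp [hg])
  rw [trace_principalSeries, hg]
  simp [hα, Finset.sum_ite]

theorem trace_principalSeries_eq_zero [Finite k] {g : GL (Fin 2) k}
    (h : ∀ α β : k, g.1.trace = α + β → g.1.det ≠ α * β) :
    LinearMap.trace R _ (principalSeries (R := R) ψ₁ ψ₂ g) = 0 := by
  classical
  have := Fintype.ofFinite k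
  rw [trace_principalSeries, if_neg, zero_add, Finset.sum_eq_zero]
  · intro y _
    refine if_neg fun hy => h (g.1 0 0 + y * g.1 1 0) (g.1 1 1 - y * g.1 1 0) ?_ ?_
    · rw [Matrix.trace_fin_two]
      ring
    · rw [Matrix.det_fin_two]
      linear_combination -g.1 1 0 * hy.2
  · intro h0
    refine h (g.1 0 0) (g.1 1 1) (Matrix.trace_fin_two _) ?_
    rw [Matrix.det_fin_two, h0]
    ring

end PrincipalSeries

section ReductionTrace

open Classical in
theorem natCast_card_filter_add_mul_eq (p : ℕ) {k F : Type*} [Field k] [Fintype k] [Field F]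
    [CharP k p] [CharP F p] (α u β : k) :
    ((Finset.card {y : k | u + y * β = y * α} : ℕ) : F) = if α = β then 0 else 1 := by
  split_ifs with hαβ
  · have hcard : (Fintype.card k : F) = 0 := by
      obtain ⟨r, -, hr⟩ := FiniteField.card k p
      rw [hr, Nat.cast_pow, CharP.cast_eq_zero, zero_pow r.ne_zero]
    by_cases hu : u = 0 <;> simp [hαβ, hu, hcard]
  · have hset : ({y : k | u + y * β = y * α} : Finset k) = {u / (α - β)} := by
      ext y
      rw [Finset.mem_filter_univ, Finset.mem_singleton, eq_div_iff (sub_ne_zero.2 hαβ)]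
      constructor <;> intro h <;> linear_combination -h
    rw [hset, Finset.card_singleton, Nat.cast_one]

variable {p : ℕ} [Fact p.Prime] {F k : Type*} [Field F] [Field k] [Finite k]

instance free_principalSeries {R : Type*} [CommRing R] (ψ₁ ψ₂ : kˣ →* Rˣ) :
    Module.Free R (Representation.coindV (borel k).subtype (charRep (borelChar ψ₁ ψ₂))) := by
  have : Fintype k := Fintype.ofFinite k
  exact Module.Free.of_basis (principalBasis ψ₁ ψ₂)

instance finite_principalSeries {R : Type*} [CommRing R] (ψ₁ ψ₂ : kˣ →* Rˣ) :
    Module.Finite R (Representation.coindV (borel k).subtype (charRep (borelChar ψ₁ ψ₂))) := by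
  have : Fintype k := Fintype.ofFinite k
  exact Module.Finite.of_basis (principalBasis ψ₁ ψ₂)

variable (ψ₁ ψ₂ : kˣ →* (WittVector p F)ˣ)

theorem finrank_reduction_principalSeries :
    Module.finrank F (F ⊗[WittVector p F]
      Representation.coindV (borel k).subtype (charRep (borelChar ψ₁ ψ₂))) = Nat.card k + 1 := by
  have : Fintype k := Fintype.ofFinite k
  rw [Module.finrank_eq_card_basis (Algebra.TensorProduct.basis F (principalBasis ψ₁ ψ₂)),
    Fintype.card_option, Nat.card_eq_fintype_card]

open Classical in
theorem trace_reduction_principalSeries [CharP k p] [CharP F p] {χ₁ χ₂ : k → F}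
    (h1 : ∀ u : kˣ, WittVector.constantCoeff (ψ₁ u : WittVector p F) = χ₁ u)
    (h2 : ∀ u : kˣ, WittVector.constantCoeff (ψ₂ u : WittVector p F) = χ₂ u)
    (g : GL (Fin 2) k) {α β : k} (htr : g.1.trace = α + β) (hdet : g.1.det = α * β) :
    LinearMap.trace F _ (reduction (principalSeries ψ₁ ψ₂) g) =
      χ₁ α * χ₂ β + if α = β then 0 else χ₁ β * χ₂ α := by
  have : Fintype k := Fintype.ofFinite k
  have hαβ : α * β ≠ 0 := hdet ▸ Matrix.GeneralLinearGroup.det_ne_zero g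
  have hcoeff {ψ : kˣ →* (WittVector p F)ˣ} {χ : k → F}
      (h : ∀ u : kˣ, WittVector.constantCoeff (ψ u : WittVector p F) = χ u) {x : k} (hx : x ≠ 0) :
      WittVector.constantCoeff (MulChar.ofUnitHom ψ x) = χ x := by
    rw [← Units.val_mk0 hx, MulChar.ofUnitHom_coe, h]
  obtain ⟨P, u, hU⟩ := exists_conj_upperTriangular g htr hdet
  have hconj := (reduction (principalSeries ψ₁ ψ₂)).char_conj g P⁻¹
  rw [inv_inv] at hconj
  refine hconj.symm.trans <| (LinearMap.trace_baseChange _ F).trans ?_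
  rw [trace_principalSeries_of_upperTriangular ψ₁ ψ₂ hU]
  change WittVector.constantCoeff _ = _
  simp only [map_add, map_mul, map_natCast, natCast_card_filter_add_mul_eq p, ite_mul, zero_mul,
    one_mul, hcoeff h1 (left_ne_zero_of_mul hαβ), hcoeff h1 (right_ne_zero_of_mul hαβ),
    hcoeff h2 (left_ne_zero_of_mul hαβ), hcoeff h2 (right_ne_zero_of_mul hαβ)]

theorem trace_reduction_principalSeries_eq_zero {g : GL (Fin 2) k}
    (h : ∀ α β : k, g.1.trace = α + β → g.1.det ≠ α * β) :
    LinearMap.trace F _ (reduction (principalSeries ψ₁ ψ₂) g) = 0 := by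
  refine (LinearMap.trace_baseChange (principalSeries ψ₁ ψ₂ g) F).trans ?_
  rw [trace_principalSeries_eq_zero ψ₁ ψ₂ h, map_zero]

end ReductionTrace

/-! ### Cyclic products of transfer matrices -/

section CyclicSums

variable {f : ℕ} [NeZero f]

/-- The trace of a cyclic product of matrices `Uᵢ Vᵢ` is that of the cyclic product of the
`Vᵢ₊₁ Uᵢ`, written out as sums over closed paths. -/
theorem sum_prod_cyclic_comm {K X Y : Type*} [CommRing K] [Fintype X] [Fintype Y]
    {T : ZMod f → X → X → K} {U : ZMod f → X → Y → K} {V : ZMod f → Y → X → K}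
    (hT : ∀ i x y, T i x y = ∑ u, U i x u * V i u y) :
    ∑ s : ZMod f → X, ∏ i, T i (s (i + 1)) (s i) =
      ∑ u : ZMod f → Y, ∏ i, ∑ x, V (i + 1) (u (i + 1)) x * U i x (u i) := by
  classical
  simp only [hT, Finset.prod_univ_sum, Fintype.piFinset_univ]
  rw [Finset.sum_comm]
  refine Finset.sum_congr rfl fun u _ => ?_
  rw [← ((Equiv.addRight (1 : ZMod f)).arrowCongr (Equiv.refl X)).sum_comp]
  refine Finset.sum_congr rfl fun s _ => ?_
  rw [Finset.prod_mul_distrib, Finset.prod_mul_distrib, mul_comm,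
    ← Equiv.prod_comp (Equiv.addRight (1 : ZMod f))]
  simp [Equiv.arrowCongr]

theorem forall_zmod_of_add_one {P : ZMod f → Prop} (h : ∀ i, P i → P (i + 1)) {i : ZMod f}
    (hi : P i) (j : ZMod f) : P j := by
  have hadd (l : ℕ) : P (i + l) := by
    induction l with
    | zero => simpa using hi
    | succ l ih => simpa [add_assoc] using h _ ih
  simpa [ZMod.natCast_zmod_val] using hadd (j - i).val

theorem sum_prod_cyclic_of_triangular {K : Type*} [CommRing K] {T : ZMod f → Bool → Bool → K}
    (hT : ∀ i, T i false true = 0) :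
    ∑ s : ZMod f → Bool, ∏ i, T i (s (i + 1)) (s i) =
      ∏ i, T i true true + ∏ i, T i false false := by
  have hne : (fun _ : ZMod f => true) ≠ fun _ => false := fun h => by simpa using congrFun h 0
  rw [← Finset.sum_subset (Finset.subset_univ {fun _ : ZMod f => true, fun _ => false}),
    Finset.sum_pair hne]
  intro s _ hs
  by_contra h0
  have hstep (i) (hi : s i = true) : s (i + 1) = true := by
    by_contra hi'
    rw [Bool.not_eq_true] at hi'
    exact h0 (Finset.prod_eq_zero (Finset.mem_univ i) (by rw [hi, hi', hT]))
  simp only [Finset.mem_insert, Finset.mem_singleton, not_or] at hs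
  obtain ⟨i, hi⟩ : ∃ i, s i = true := by
    by_contra! h
    exact hs.2 (funext fun i => by simpa using h i)
  exact hs.1 (funext (forall_zmod_of_add_one hstep hi))

theorem sum_prod_cyclic_of_swap {K : Type*} [CommRing K] {T : ZMod f → Bool → Bool → K}
    (hT : ∀ i, i ≠ 0 → ∀ x y, x ≠ y → T i x y = 0) (h0 : ∀ x, T 0 x x = 0) :
    ∑ s : ZMod f → Bool, ∏ i, T i (s (i + 1)) (s i) = 0 := by
  refine Finset.sum_eq_zero fun s _ => ?_
  by_contra hne
  have hstep (i) (hi : i ≠ 0) : s (i + 1) = s i := by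
    by_contra hi'
    exact hne (Finset.prod_eq_zero (Finset.mem_univ i) (hT i hi _ _ hi'))
  have hconst : ∀ i, s i = s 1 := by
    refine forall_zmod_of_add_one (i := 1) (fun i hi => ?_) rfl
    by_cases h : i = 0
    · rw [h, zero_add]
    · rw [hstep i h, hi]
  refine hne (Finset.prod_eq_zero (Finset.mem_univ 0) ?_)
  rw [zero_add, hconst 0, h0]

/-- The constituents of the reduction of a principal series are indexed by `s : ZMod f → Bool`; the
`i`-th exponent `nᵢ` of the one with index `s` is `transferDim p (r i) (s (i + 1)) (s i) - 1`, which
is to be read as the absence of the constituent where it is `-1`. -/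
def transferDim (p r : ℕ) : Bool → Bool → ℕ
  | true, true => r + 1
  | false, true => r
  | true, false => p - 1 - r
  | false, false => p - r

/-- The exponent `mᵢ` of the constituent with index `s` of the reduction of a principal series,
up to a common twist, is `transferDet (r i) (s (i + 1)) (s i)`. -/
def transferDet (r : ℕ) : Bool → Bool → ℕ
  | _, true => 0
  | true, false => r + 1
  | false, false => r

theorem sum_prod_transferDim (p : ℕ) (r : ZMod f → ℕ) (hr : ∀ i, r i < p) :
    ∑ s : ZMod f → Bool, ∏ i, transferDim p (r i) (s (i + 1)) (s i) = p ^ f + 1 := by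
  let U (_ : ZMod f) (x u : Bool) : ℤ := if u = true ∨ x = false then 1 else 0
  let V (i : ZMod f) (u y : Bool) : ℤ :=
    if u = true then if y = true then r i + 1 else p - 1 - r i else if y = true then -1 else 1
  have hUV (i x y) : (transferDim p (r i) x y : ℤ) = ∑ u, U i x u * V i u y := by
    have := hr i
    cases x <;> cases y <;> simp [transferDim, U, V] <;> omega
  have hVU := sum_prod_cyclic_of_triangular (T := fun i u' u => ∑ x, V (i + 1) u' x * U i x u)
    fun i => by simp [U, V]
  zify
  have hsum (i) : (r i : ℤ) + 1 + (p - 1 - r i) = p := by ring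
  rw [sum_prod_cyclic_comm hUV, hVU]
  simp [U, V, hsum, ZMod.card]

variable {K : Type*} [Field K]

/-- The trace of `Sym ^ (N - 1)` in terms of the eigenvalues; it is `0` for `N = 0`. -/
def eigenSum (N : ℕ) (A B : K) : K := ∑ i ∈ Finset.range N, A ^ i * B ^ (N - 1 - i)

theorem eigenSum_mul_sub (N : ℕ) (A B : K) : eigenSum N A B * (A - B) = A ^ N - B ^ N :=
  (Commute.all A B).geom_sum₂_mul N

theorem eigenSum_self (N : ℕ) (A : K) : eigenSum N A A * A = N * A ^ N := by
  rw [eigenSum, geom_sum₂_self]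
  cases N <;> simp [pow_succ, mul_assoc]

/-- The `i`-th tensor factor of the trace of the constituent with index `s` of the reduction of a
principal series, at a matrix with eigenvalues `A` and `B`, as a function of `x = s (i + 1)` and
`y = s i`. -/
def transfer (p r : ℕ) (A B : K) (x y : Bool) : K :=
  (A * B) ^ transferDet r x y * eigenSum (transferDim p r x y) A B

/-- The left factor in the factorisation of the `2 × 2`-matrix `transfer`. -/
def transferCol (r : ℕ) (A B : K) (x u : Bool) : K :=
  if u = true then A ^ r * (if x = true then A else 1) / (A - B)
  else -(B ^ r * (if x = true then B else 1)) / (A - B)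

/-- The right factor in the factorisation of the `2 × 2`-matrix `transfer`. -/
def transferRow (A B : K) (u y : Bool) : K :=
  if y = true then 1 else if u = true then -B else -A

theorem transfer_eq {p r : ℕ} (hr : r < p) {A B : K} (hAB : A ≠ B) (x y : Bool) :
    transfer p r A B x y = ∑ u, transferCol r A B x u * transferRow (A ^ p) (B ^ p) u y := by
  have h0 : A - B ≠ 0 := sub_ne_zero.2 hAB
  have hgeom (N : ℕ) : eigenSum N A B = (A ^ N - B ^ N) / (A - B) := by
    rw [eq_div_iff h0, eigenSum_mul_sub]
  obtain ⟨t, rfl⟩ : ∃ t, p = r + 1 + t := ⟨p - (r + 1), by omega⟩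
  have hsub : r + 1 + t - r = t + 1 := by omega
  rw [transfer, hgeom, Fintype.sum_bool]
  cases x <;> cases y <;> simp [transferDet, transferDim, transferCol, transferRow, hsub] <;>
    field_simp <;> ring

theorem sum_transferRow_mul_transferCol (r : ℕ) {A B : K} (hAB : A ≠ B) (u' u : Bool) :
    ∑ x, transferRow A B u' x * transferCol r A B x u =
      if u' = u then (if u = true then A ^ r else B ^ r) else 0 := by
  have h0 : A - B ≠ 0 := sub_ne_zero.2 hAB
  rw [Fintype.sum_bool]
  cases u' <;> cases u <;> simp [transferCol, transferRow] <;> field_simp <;> ring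

theorem sum_transferRow_swap_mul_transferCol (r : ℕ) {A B : K} (hAB : A ≠ B) (u : Bool) :
    ∑ x, transferRow B A u x * transferCol r A B x u = 0 := by
  have h0 : A - B ≠ 0 := sub_ne_zero.2 hAB
  rw [Fintype.sum_bool]
  cases u <;> simp [transferCol, transferRow] <;> field_simp <;> ring

theorem sum_prod_transfer_of_ne {p : ℕ} {r : ZMod f → ℕ} (hr : ∀ i, r i < p) {A B : ZMod f → K}
    (hA : ∀ i, A (i + 1) ^ p = A i) (hB : ∀ i, B (i + 1) ^ p = B i) (hAB : ∀ i, A i ≠ B i) :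
    ∑ s : ZMod f → Bool, ∏ i, transfer p (r i) (A i) (B i) (s (i + 1)) (s i) =
      ∏ i, A i ^ r i + ∏ i, B i ^ r i := by
  rw [sum_prod_cyclic_comm fun i x y => transfer_eq (hr i) (hAB i) x y]
  simp only [hA, hB, fun i => sum_transferRow_mul_transferCol (r i) (hAB i)]
  rw [sum_prod_cyclic_of_triangular (T := fun i x y =>
    if x = y then (if y = true then A i ^ r i else B i ^ r i) else 0) (fun i => by simp)]
  simp

theorem sum_prod_transfer_of_swap {p : ℕ} {r : ZMod f → ℕ} (hr : ∀ i, r i < p) {A B : ZMod f → K}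
    (hA : ∀ i, i ≠ 0 → A (i + 1) ^ p = A i) (hB : ∀ i, i ≠ 0 → B (i + 1) ^ p = B i)
    (hA0 : A 1 ^ p = B 0) (hB0 : B 1 ^ p = A 0) (hAB : ∀ i, A i ≠ B i) :
    ∑ s : ZMod f → Bool, ∏ i, transfer p (r i) (A i) (B i) (s (i + 1)) (s i) = 0 := by
  rw [sum_prod_cyclic_comm fun i x y => transfer_eq (hr i) (hAB i) x y]
  refine sum_prod_cyclic_of_swap (T := fun i x y =>
    ∑ z, transferRow (A (i + 1) ^ p) (B (i + 1) ^ p) x z * transferCol (r i) (A i) (B i) z y)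
    (fun i hi x y hxy => ?_) fun x => ?_
  · simp only [hA i hi, hB i hi, sum_transferRow_mul_transferCol (r i) (hAB i), if_neg hxy]
  · simp only [zero_add, hA0, hB0]
    exact sum_transferRow_swap_mul_transferCol _ (hAB 0) x

theorem transfer_self {p r : ℕ} [CharP K p] (hr : r < p) {A : K} (hA : A ≠ 0) (x y : Bool) :
    transfer p r A A x y =
      (if x = true then (r + 1) * A ^ r else r * A ^ r / A) * if y = true then 1 else -A ^ p := by
  have hself (N : ℕ) : eigenSum N A A = N * A ^ N / A := by rw [eq_div_iff hA, eigenSum_self]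
  obtain ⟨t, rfl⟩ : ∃ t, p = r + 1 + t := ⟨p - (r + 1), by omega⟩
  have ht : (t : K) = -1 - r := by
    have := CharP.cast_eq_zero K (r + 1 + t)
    push_cast at this
    linear_combination this
  have hsub : r + 1 + t - 1 - r = t ∧ r + 1 + t - r = t + 1 := by omega
  rw [transfer, hself]
  cases x <;> cases y <;> simp [transferDet, transferDim, hsub, ht] <;> field_simp <;> ring

theorem sum_prod_transfer_self {p : ℕ} [CharP K p] {r : ZMod f → ℕ} (hr : ∀ i, r i < p)
    {A : ZMod f → K} (hA : ∀ i, A (i + 1) ^ p = A i) (hA0 : ∀ i, A i ≠ 0) :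
    ∑ s : ZMod f → Bool, ∏ i, transfer p (r i) (A i) (A i) (s (i + 1)) (s i) =
      ∏ i, A i ^ r i := by
  rw [sum_prod_cyclic_comm (Y := Unit)
    (U := fun i x _ => if x = true then (r i + 1) * A i ^ r i else r i * A i ^ r i / A i)
    (V := fun i _ y => if y = true then 1 else -A i ^ p) fun i x y => by
      rw [transfer_self (hr i) (hA0 i), Fintype.sum_unique], Fintype.sum_unique]
  refine Finset.prod_congr rfl fun i _ => ?_
  have := hA0 i
  simp only [hA, Fintype.sum_bool, if_true, Bool.false_eq_true, if_false]
  field_simp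
  ring

end CyclicSums

section TraceIdentity

variable {k F K : Type*} [Field k] [Field F] [Field K] {f : ℕ} [NeZero f]

theorem map_symTrace (n : ℕ) (φ : F →+* K) (g : Matrix (Fin 2) (Fin 2) F) :
    φ (symTrace n g) = symTrace n (g.map φ) := by
  simp only [symTrace, symCoeff, map_sum, ← Polynomial.coeff_map, Polynomial.map_mul,
    Polynomial.map_pow, Polynomial.map_add, Polynomial.map_C, Polynomial.map_X, Matrix.map_apply]

/-- The trace of `Sym ^ (N - 1)`, which is to be read as the zero representation if `N = 0`. -/
def predSymTrace (N : ℕ) (g : Matrix (Fin 2) (Fin 2) K) : K :=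
  if N = 0 then 0 else symTrace (N - 1) g

theorem predSymTrace_eq (N : ℕ) (g : GL (Fin 2) K) {A B : K} (htr : g.1.trace = A + B)
    (hdet : g.1.det = A * B) : predSymTrace N g.1 = eigenSum N A B := by
  cases N with
  | zero => simp [predSymTrace, eigenSum]
  | succ n =>
    rw [predSymTrace, if_neg n.succ_ne_zero, Nat.add_sub_cancel,
      symTrace_eq n g (htr.trans (add_comm _ _)) (hdet.trans (mul_comm _ _)), eigenSum]
    exact Finset.sum_congr rfl fun i _ => by rw [Nat.add_sub_cancel, mul_comm]

/-- The sum of the traces of all potential constituents of the reduction of a principal series, up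
to a common twist. -/
def transferTrace (p : ℕ) (r : ZMod f → ℕ) (σ : ZMod f → k →+* K) (g : GL (Fin 2) k) : K :=
  ∑ s : ZMod f → Bool, ∏ i, σ i g.1.det ^ transferDet (r i) (s (i + 1)) (s i) *
    predSymTrace (transferDim p (r i) (s (i + 1)) (s i)) (g.1.map (σ i))

theorem map_transferTrace (p : ℕ) (r : ZMod f → ℕ) (σ : ZMod f → k →+* F) (φ : F →+* K)
    (g : GL (Fin 2) k) :
    φ (transferTrace p r σ g) = transferTrace p r (fun i => φ.comp (σ i)) g := by
  simp only [transferTrace, map_sum, map_prod, map_mul, map_pow, predSymTrace,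
    apply_ite φ, map_zero, map_symTrace, Matrix.map_map]
  rfl

theorem transferTrace_eq (p : ℕ) (r : ZMod f → ℕ) (σ : ZMod f → k →+* K) (g : GL (Fin 2) k)
    {A B : ZMod f → K} (htr : ∀ i, σ i g.1.trace = A i + B i)
    (hdet : ∀ i, σ i g.1.det = A i * B i) :
    transferTrace p r σ g =
      ∑ s : ZMod f → Bool, ∏ i, transfer p (r i) (A i) (B i) (s (i + 1)) (s i) := by
  refine Finset.sum_congr rfl fun s _ => Finset.prod_congr rfl fun i _ => ?_
  have htr' : (Matrix.GeneralLinearGroup.map (σ i) g).1.trace = A i + B i := by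
    simp [← htr i, Matrix.trace_fin_two]
  have hdet' : (Matrix.GeneralLinearGroup.map (σ i) g).1.det = A i * B i := by
    simp [← hdet i, Matrix.det_fin_two]
  rw [transfer, hdet, ← predSymTrace_eq _ _ htr' hdet']
  rfl

theorem mem_range_of_pow_natCard_eq [Finite k] (φ : k →+* K) {x : K} (hx : x ^ Nat.card k = x) :
    x ∈ φ.range := by
  have := Fintype.ofFinite k
  have hsplits := (FiniteField.isSplittingField_sub k k).splits
  rw [Algebra.algebraMap_self, Polynomial.map_id] at hsplits
  refine hsplits.mem_range_of_isRoot
    (FiniteField.X_pow_card_sub_X_ne_zero _ Fintype.one_lt_card) ?_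
  rw [Nat.card_eq_fintype_card] at hx
  simp [hx]

theorem exists_eq_add_and_eq_mul [IsAlgClosed K] (t d : K) : ∃ α β, t = α + β ∧ d = α * β := by
  let P : Polynomial K := Polynomial.X ^ 2 - Polynomial.C t * Polynomial.X + Polynomial.C d
  have hP : P.natDegree = 2 := by
    unfold P
    compute_degree!
  obtain ⟨α, hα⟩ := IsAlgClosed.exists_root P fun h => by
    simp [Polynomial.natDegree_eq_of_degree_eq_some h] at hP
  have hroot : α ^ 2 - t * α + d = 0 := by simpa [P, Polynomial.IsRoot] using hα
  exact ⟨α, t - α, by ring, by linear_combination hroot⟩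

variable {p : ℕ}

-- The Frobenius of `k` permutes the two roots, and a root which it fixes would lie in `k`.
theorem ne_and_pow_eq_of_forall_ne [Fact p.Prime] [CharP K p] {q : ℕ} (hk : Nat.card k = p ^ q)
    (φ : k →+* K) {t d : k} {α β : K} (ht : φ t = α + β) (hd : φ d = α * β)
    (h : ∀ a b, t = a + b → d ≠ a * b) : α ≠ β ∧ α ^ p ^ q = β := by
  have := finite_of_natCard_eq_pow hk
  have := Fintype.ofFinite k
  have hfix (x : k) : φ x ^ p ^ q = φ x := by
    rw [← hk, ← map_pow, Nat.card_eq_fintype_card, FiniteField.pow_card]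
  have hne : α ^ p ^ q ≠ α := fun hα => by
    obtain ⟨a, ha⟩ := mem_range_of_pow_natCard_eq φ (hk ▸ hα)
    refine h a (t - a) (by ring) (φ.injective ?_)
    rw [map_mul, map_sub, ha, hd, ht]
    ring
  have hsum : (α + β) ^ p ^ q = α + β := by rw [← ht, hfix]
  have hmul : (α * β) ^ p ^ q = α * β := by rw [← hd, hfix]
  rw [add_pow_char_pow] at hsum
  rw [mul_pow] at hmul
  have hpow : α ^ p ^ q = β := by
    refine sub_eq_zero.1 ((mul_eq_zero.1 ?_).resolve_left (sub_ne_zero.2 hne))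
    linear_combination α ^ p ^ q * hsum - hmul
  exact ⟨hpow ▸ hne.symm, hpow⟩

theorem zmod_val_neg_add_one {i : ZMod f} (hi : i ≠ 0) : (-(i + 1)).val + 1 = (-i).val := by
  have hpos : (-i).val ≠ 0 := by simpa [ZMod.val_eq_zero] using hi
  have hcast : -(i + 1) = (((-i).val - 1 : ℕ) : ZMod f) := by
    rw [Nat.cast_sub (by lia), ZMod.natCast_zmod_val]
    push_cast
    ring
  have hlt := ZMod.val_lt (-i)
  rw [hcast, ZMod.val_natCast, Nat.mod_eq_of_lt (by lia)]
  lia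

theorem zmod_val_neg_one_add_one : (-1 : ZMod f).val + 1 = f := by
  obtain ⟨g, rfl⟩ := Nat.exists_eq_succ_of_ne_zero (NeZero.ne f)
  rw [ZMod.val_neg_one]

variable {σ : ZMod f → k →+* F} (hσ : ∀ i x, σ (i + 1) x ^ p = σ i x) {r : ZMod f → ℕ}
  (hr : ∀ i, r i < p) (g : GL (Fin 2) k)

include hσ

theorem embedding_eq_pow (i : ZMod f) (x : k) : σ i x = σ 0 x ^ p ^ (-i).val := by
  have h := embedding_embIndex hσ ⟨(-i).val, ZMod.val_lt _⟩ x
  rwa [embIndex_apply, ZMod.natCast_zmod_val, neg_neg] at h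

include hr

theorem transferTrace_of_split [DecidableEq k] [CharP F p] {α β : k} (htr : g.1.trace = α + β)
    (hdet : g.1.det = α * β) :
    transferTrace p r σ g =
      ∏ i, σ i α ^ r i + if α = β then 0 else ∏ i, σ i β ^ r i := by
  have hα : α ≠ 0 := left_ne_zero_of_mul (hdet ▸ Matrix.GeneralLinearGroup.det_ne_zero g)
  rw [transferTrace_eq p r σ g (A := fun i => σ i α) (B := fun i => σ i β)
    (fun i => by rw [htr, map_add]) fun i => by rw [hdet, map_mul]]
  split_ifs with h
  · subst h
    rw [add_zero]
    exact sum_prod_transfer_self hr (fun i => hσ i α) fun i => (map_ne_zero _).2 hα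
  · exact sum_prod_transfer_of_ne hr (fun i => hσ i α) (fun i => hσ i β)
      fun i h' => h ((σ i).injective h')

theorem transferTrace_of_nonsplit [Fact p.Prime] (hk : Nat.card k = p ^ f)
    (h : ∀ α β : k, g.1.trace = α + β → g.1.det ≠ α * β) : transferTrace p r σ g = 0 := by
  let K := AlgebraicClosure F
  have : CharP F p := charP_of_ringHom_of_natCard_eq_pow hk (σ 0)
  have : CharP K p := charP_of_injective_algebraMap (algebraMap F K).injective p
  refine (algebraMap F K).injective ?_
  rw [map_transferTrace, map_zero]
  let τ (i : ZMod f) : k →+* K := (algebraMap F K).comp (σ i)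
  have hτ (i x) : τ i x = τ 0 x ^ p ^ (-i).val := by
    rw [RingHom.comp_apply, embedding_eq_pow hσ, map_pow, RingHom.comp_apply]
  obtain ⟨α, β, htr, hdet⟩ := exists_eq_add_and_eq_mul (τ 0 g.1.trace) (τ 0 g.1.det)
  obtain ⟨hαβ, hα⟩ := ne_and_pow_eq_of_forall_ne hk (τ 0) htr hdet h
  obtain ⟨-, hβ⟩ := ne_and_pow_eq_of_forall_ne hk (τ 0) (htr.trans (add_comm _ _))
    (hdet.trans (mul_comm _ _)) h
  have hpow (γ : K) (i : ZMod f) (hi : i ≠ 0) :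
      (γ ^ p ^ (-(i + 1)).val) ^ p = γ ^ p ^ (-i).val := by
    rw [← pow_mul, ← pow_succ, zmod_val_neg_add_one hi]
  have hpow_last (γ : K) : (γ ^ p ^ (-1 : ZMod f).val) ^ p = γ ^ p ^ f := by
    rw [← pow_mul, ← pow_succ, zmod_val_neg_one_add_one]
  rw [transferTrace_eq p r τ g (A := fun i => α ^ p ^ (-i).val) (B := fun i => β ^ p ^ (-i).val)
    (fun i => by rw [hτ, htr, add_pow_char_pow]) fun i => by rw [hτ, hdet, mul_pow]]
  refine sum_prod_transfer_of_swap hr (hpow α) (hpow β) ?_ ?_ fun i hi => ?_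
  · rw [hpow_last, hα]
    simp
  · rw [hpow_last, hβ]
    simp
  · exact hαβ (iterateFrobenius_inj K p (-i).val (by simpa [iterateFrobenius_def] using hi))

end TraceIdentity

section Constituents

universe u

variable {p : ℕ} {k : Type} {F : Type u} [Field k] [Field F] {f : ℕ} [NeZero f]
  {σ : ZMod f → k →+* F}

/-- One more than the exponents `n` of the constituent of the reduction of a principal series
indexed by `J`, which is absent if one of these numbers is `0`. -/
def constDim (p : ℕ) (r : ZMod f → ℕ) (J : Finset (ZMod f)) (i : ZMod f) : ℕ :=
  transferDim p (r i) (decide (i + 1 ∈ J)) (decide (i ∈ J))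

/-- The exponents `m` of the constituent of the reduction of a principal series indexed by `J`. -/
def constDet (r : ZMod f → ℕ) (y : ZMod f → ℤ) (J : Finset (ZMod f)) (i : ZMod f) : ℤ :=
  y i + transferDet (r i) (decide (i + 1 ∈ J)) (decide (i ∈ J))

omit [NeZero f] in
theorem constDim_le {r : ZMod f → ℕ} (hr : ∀ i, r i < p) (J : Finset (ZMod f)) (i : ZMod f) :
    constDim p r J i ≤ p := by
  have := hr i
  unfold constDim
  cases decide (i + 1 ∈ J) <;> cases decide (i ∈ J) <;> simp only [transferDim] <;> lia

/-- Subsets of `ZMod f` correspond to their indicator functions. -/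
def finsetEquivBool (f : ℕ) [NeZero f] : Finset (ZMod f) ≃ (ZMod f → Bool) where
  toFun J i := decide (i ∈ J)
  invFun s := Finset.univ.filter fun i => s i = true
  left_inv J := by ext; simp
  right_inv s := by ext; simp

theorem sum_subtype_constDim {M : Type*} [AddCommMonoid M] (p : ℕ) (r : ZMod f → ℕ)
    {φ : (ZMod f → Bool) → M}
    (hφ : ∀ J i, constDim p r J i = 0 → φ (finsetEquivBool f J) = 0) :
    ∑ J : {J : Finset (ZMod f) // ∀ i, constDim p r J i ≠ 0}, φ (finsetEquivBool f J.1) =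
      ∑ s, φ s := by
  rw [← (finsetEquivBool f).sum_comp φ,
    ← Fintype.sum_subtype_add_sum_subtype (fun J => ∀ i, constDim p r J i ≠ 0),
    Fintype.sum_eq_zero (fun J : {J // ¬ ∀ i, constDim p r J i ≠ 0} => φ (finsetEquivBool f J.1)),
    add_zero]
  intro J
  obtain ⟨i, hi⟩ := not_forall_not.1 J.2
  exact hφ J i hi

theorem sum_trace_mu_constDim (p : ℕ) (r : ZMod f → ℕ) (σ : ZMod f → k →+* F) (y : ZMod f → ℤ)
    (g : GL (Fin 2) k) :
    ∑ J : {J : Finset (ZMod f) // ∀ i, constDim p r J i ≠ 0},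
        LinearMap.trace F _ (mu σ (constDet r y J.1) (fun i => constDim p r J.1 i - 1) g) =
      (∏ i, σ i g.1.det ^ y i) * transferTrace p r σ g := by
  have hdet : g.1.det ≠ 0 := Matrix.GeneralLinearGroup.det_ne_zero g
  rw [transferTrace, ← sum_subtype_constDim p r, Finset.mul_sum]
  swap
  · exact fun J i hi => Finset.prod_eq_zero (Finset.mem_univ i) (mul_eq_zero_of_right _ (if_pos hi))
  refine Finset.sum_congr rfl fun J _ => ?_
  rw [trace_mu, ← Finset.prod_mul_distrib]
  refine Finset.prod_congr rfl fun i _ => ?_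
  have hsym : predSymTrace (transferDim p (r i) (finsetEquivBool f J.1 (i + 1))
      (finsetEquivBool f J.1 i)) (g.1.map (σ i)) =
        symTrace (constDim p r J.1 i - 1) (g.1.map (σ i)) := if_neg (J.2 i)
  rw [hsym, constDet, zpow_add₀ ((map_ne_zero _).2 hdet), mul_assoc, zpow_natCast]
  rfl

theorem sum_finrank_mu_constDim {r : ZMod f → ℕ} (hr : ∀ i, r i < p) :
    ∑ J : {J : Finset (ZMod f) // ∀ i, constDim p r J i ≠ 0},
        Module.finrank F (MuSpace F fun i => constDim p r J.1 i - 1) = p ^ f + 1 := by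
  rw [← sum_prod_transferDim p r hr, ← sum_subtype_constDim p r]
  swap
  · exact fun J i hi => Finset.prod_eq_zero (Finset.mem_univ i) hi
  refine Finset.sum_congr rfl fun J _ => (finrank_mu _).trans (Finset.prod_congr rfl fun i _ => ?_)
  exact Nat.sub_one_add_one (J.2 i)

variable [Fact p.Prime] (hσ : ∀ i x, σ (i + 1) x ^ p = σ i x) (hk : Nat.card k = p ^ f)
  {r : ZMod f → ℕ} (hr : ∀ i, r i < p) (y : ZMod f → ℤ)

include hσ hk hr

theorem eq_of_isoRep_mu_constDet
    (hne : ∀ J J' : Finset (ZMod f), (∀ i, constDim p r J i ≠ 0) → (∀ i, constDim p r J' i ≠ 0) →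
      (∀ i, constDim p r J i = constDim p r J' i) →
      ExpCong p (constDet r y J) (constDet r y J') → J = J')
    (J J' : {J : Finset (ZMod f) // ∀ i, constDim p r J i ≠ 0})
    (h : IsoRep (mu σ (constDet r y J.1) fun i => constDim p r J.1 i - 1)
      (mu σ (constDet r y J'.1) fun i => constDim p r J'.1 i - 1)) : J = J' := by
  have hn (J) (i) : constDim p r J i - 1 ≤ p - 1 := Nat.sub_le_sub_right (constDim_le hr J i) 1
  obtain ⟨hdim, hdet⟩ := (isoRep_mu_iff hσ hk (hn J.1) (hn J'.1)).1 h
  refine Subtype.ext (hne _ _ J.2 J'.2 (fun i => ?_) hdet)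
  exact Nat.sub_one_cancel (Nat.pos_of_ne_zero (J.2 i)) (Nat.pos_of_ne_zero (J'.2 i))
    (congrFun hdim i)

theorem prod_mul_transferTrace_eq [DecidableEq k] {t : GL (Fin 2) k → F}
    (hs : ∀ g α β, g.1.trace = α + β → g.1.det = α * β → t g =
      (∏ i, σ i g.1.det ^ y i) * (∏ i, σ i α ^ r i + if α = β then 0 else ∏ i, σ i β ^ r i))
    (hns : ∀ g : GL (Fin 2) k, (∀ α β : k, g.1.trace = α + β → g.1.det ≠ α * β) → t g = 0)
    (g : GL (Fin 2) k) : (∏ i, σ i g.1.det ^ y i) * transferTrace p r σ g = t g := by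
  have : CharP F p := charP_of_ringHom_of_natCard_eq_pow hk (σ 0)
  by_cases h : ∀ α β : k, g.1.trace = α + β → g.1.det ≠ α * β
  · rw [hns g h, transferTrace_of_nonsplit hσ hr g hk h, mul_zero]
  · push Not at h
    obtain ⟨α, β, htr, hdet⟩ := h
    rw [hs g α β htr hdet, transferTrace_of_split hσ hr g htr hdet]

theorem isJHConstituent_iff_of_trace [DecidableEq k] {V : Type u} [AddCommGroup V] [Module F V]
    [FiniteDimensional F V] (ρ : Representation F (GL (Fin 2) k) V)
    (hV : Module.finrank F V = p ^ f + 1)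
    (hs : ∀ g α β, g.1.trace = α + β → g.1.det = α * β → LinearMap.trace F V (ρ g) =
      (∏ i, σ i g.1.det ^ y i) * (∏ i, σ i α ^ r i + if α = β then 0 else ∏ i, σ i β ^ r i))
    (hns : ∀ g : GL (Fin 2) k, (∀ α β : k, g.1.trace = α + β → g.1.det ≠ α * β) →
      LinearMap.trace F V (ρ g) = 0)
    (hne : ∀ J J' : Finset (ZMod f), (∀ i, constDim p r J i ≠ 0) → (∀ i, constDim p r J' i ≠ 0) →
      (∀ i, constDim p r J i = constDim p r J' i) →
      ExpCong p (constDet r y J) (constDet r y J') → J = J')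
    {T : Type u} [AddCommGroup T] [Module F T] [FiniteDimensional F T]
    (τ : Representation F (GL (Fin 2) k) T) :
    IsJHConstituent τ ρ ↔ ∃ J : Finset (ZMod f), (∀ i, constDim p r J i ≠ 0) ∧
      IsoRep (mu σ (constDet r y J) fun i => constDim p r J i - 1) τ := by
  have hn (J) (i) : constDim p r J i - 1 ≤ p - 1 := Nat.sub_le_sub_right (constDim_le hr J i) 1
  refine (isJHConstituent_iff_of_trace_eq ρ
    (S := fun J => MuSpace F fun i => constDim p r J.1 i - 1)
    (fun J : {J : Finset (ZMod f) // ∀ i, constDim p r J i ≠ 0} =>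
      mu σ (constDet r y J.1) fun i => constDim p r J.1 i - 1)
    (fun J => mu_isIrreducible _ hσ hk (hn J.1)) (eq_of_isoRep_mu_constDet hσ hk hr y hne)
    (fun J => exists_eq_smul_of_commute_mu (constDet r y J.1) hσ hk (hn J.1)) ?_ ?_ τ).trans ?_
  · exact fun g => ((sum_trace_mu_constDim p r σ y g).trans
      (prod_mul_transferTrace_eq hσ hk hr y hs hns g)).symm
  · exact hV.trans (sum_finrank_mu_constDim hr).symm
  · exact ⟨fun ⟨J, h⟩ => ⟨J.1, J.2, h⟩, fun ⟨J, hJ, h⟩ => ⟨⟨J, hJ⟩, h⟩⟩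

end Constituents

section Types

universe u

variable {p : ℕ} [Fact p.Prime] {k : Type} {F : Type u} [Field k] [Field F] {f : ℕ} [NeZero f]
  {σ : ZMod f → k →+* F}

omit [NeZero f] in
theorem Weight.mk_eq_mk_iff {m m' : ZMod f → ℤ} {n n' : ZMod f → ℕ} :
    Weight.mk σ m n = Weight.mk σ m' n' ↔ IsoRep (mu σ m n) (mu σ m' n') :=
  Quotient.eq (r := weightSetoid σ)

theorem teichmullerChar_apply (s : ZMod f → ℤ) (u : kˣ) :
    (teichmullerChar p σ s u : WittVector p F) =
      WittVector.teichmuller p (∏ i, σ i (u : k) ^ s i) := by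
  have h : teichmullerChar p σ s u = Units.map (WittVector.teichmuller p : F →* WittVector p F)
      (∏ i, (Units.map (σ i : k →* F) u) ^ s i) := by
    rw [map_prod]
    simp only [teichmullerChar, MonoidHom.finsetProd_apply, map_zpow]
    rfl
  rw [h, Units.coe_map]
  simp

theorem constantCoeff_teichmullerChar (s : ZMod f → ℤ) (u : kˣ) :
    WittVector.constantCoeff (teichmullerChar p σ s u : WittVector p F) =
      ∏ i, σ i (u : k) ^ s i := by
  rw [teichmullerChar_apply]
  exact WittVector.teichmuller_coeff_zero p _

theorem teichmullerChar_eq_iff (hσ : ∀ i x, σ (i + 1) x ^ p = σ i x) (hk : Nat.card k = p ^ f)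
    (s t : ZMod f → ℤ) :
    teichmullerChar p σ s = teichmullerChar p σ t ↔ ExpCong p s t := by
  rw [← prod_embedding_eq_iff hσ hk]
  constructor
  · intro h x hx
    have hs := constantCoeff_teichmullerChar (p := p) (σ := σ) s (Units.mk0 x hx)
    rw [h, constantCoeff_teichmullerChar] at hs
    exact hs.symm
  · intro h
    refine MonoidHom.ext fun u => Units.ext ?_
    rw [teichmullerChar_apply, teichmullerChar_apply, h _ u.ne_zero]

theorem typeChar_eq_iff (hσ : ∀ i x, σ (i + 1) x ^ p = σ i x) (hk : Nat.card k = p ^ f)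
    (b c a : ZMod f → ℤ) :
    typeChar₁ p σ b c a = typeChar₂ p σ c a ↔
      ExpCong p (fun i => b i + 2 * a i) fun _ => 0 := by
  rw [typeChar₁, typeChar₂, teichmullerChar_eq_iff hσ hk]
  have hadd := (ExpCong.refl (p := p) fun i => c i - a i)
  refine ⟨fun h => ?_, fun h => ?_⟩
  · convert h.sub hadd using 1 <;> funext i <;> ring
  · convert h.add hadd using 1 <;> funext i <;> ring

theorem trace_reduction {G V : Type*} [Group G] [AddCommGroup V] [Module (WittVector p F) V]
    [Module.Free (WittVector p F) V] [Module.Finite (WittVector p F) V]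
    (ρ : Representation (WittVector p F) G V) (g : G) :
    LinearMap.trace F _ (reduction ρ g) =
      WittVector.constantCoeff (LinearMap.trace (WittVector p F) V (ρ g)) :=
  LinearMap.trace_baseChange (ρ g) F

theorem trace_reduction_twist {G V : Type*} [Group G] [AddCommGroup V]
    [Module (WittVector p F) V] [Module.Free (WittVector p F) V] [Module.Finite (WittVector p F) V]
    (χ : G →* (WittVector p F)ˣ) (ρ : Representation (WittVector p F) G V) (g : G) :
    LinearMap.trace F _ (reduction (twist χ ρ) g) =
      WittVector.constantCoeff (χ g : WittVector p F) * LinearMap.trace F _ (reduction ρ g) := by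
  rw [trace_reduction, trace_reduction, ← map_mul]
  exact congrArg _ (map_smul (LinearMap.trace (WittVector p F) V) _ _)

variable {r : ZMod f → ℕ} {b c a : ZMod f → ℤ}

theorem constantCoeff_typeChar₁ (hra : ∀ i, b i + 2 * a i = r i) (u : kˣ) :
    WittVector.constantCoeff (typeChar₁ p σ b c a u : WittVector p F) =
      (∏ i, σ i (u : k) ^ (c i - a i)) * ∏ i, σ i (u : k) ^ r i := by
  have h (i) : c i + b i + a i = c i - a i + r i := by rw [← hra]; ring
  rw [typeChar₁, constantCoeff_teichmullerChar, ← Finset.prod_mul_distrib]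
  refine Finset.prod_congr rfl fun i _ => ?_
  rw [h, zpow_add₀ ((map_ne_zero _).2 u.ne_zero), zpow_natCast]

theorem constantCoeff_detChar_typeChar₁ (h : typeChar₁ p σ b c a = typeChar₂ p σ c a)
    (g : GL (Fin 2) k) :
    WittVector.constantCoeff (detChar (typeChar₁ p σ b c a) g : WittVector p F) =
      ∏ i, σ i g.1.det ^ (c i - a i) := by
  rw [h]
  exact constantCoeff_teichmullerChar _ _

section Traces

variable [CharP F p] [CharP k p] [Finite k] (hra : ∀ i, b i + 2 * a i = r i)
  (g : GL (Fin 2) k) {α β : k} (htr : g.1.trace = α + β) (hdet : g.1.det = α * β)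

include hra htr hdet

open Classical in
theorem trace_reduction_principalSeries_typeChar :
    LinearMap.trace F _ (reduction (principalSeries (typeChar₁ p σ b c a) (typeChar₂ p σ c a)) g) =
      (∏ i, σ i g.1.det ^ (c i - a i)) *
        (∏ i, σ i α ^ r i + if α = β then 0 else ∏ i, σ i β ^ r i) := by
  refine (trace_reduction_principalSeries
    (χ₁ := fun x => (∏ i, σ i x ^ (c i - a i)) * ∏ i, σ i x ^ r i)
    (χ₂ := fun x => ∏ i, σ i x ^ (c i - a i)) _ _ (constantCoeff_typeChar₁ hra)
    (constantCoeff_teichmullerChar _) g htr hdet).trans ?_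
  simp only [hdet, map_mul, mul_zpow, Finset.prod_mul_distrib]
  split_ifs <;> ring

open Classical in
theorem trace_reduction_twist_detChar_typeChar (h : typeChar₁ p σ b c a = typeChar₂ p σ c a) :
    LinearMap.trace F _ (reduction (twist (detChar (typeChar₁ p σ b c a))
        (principalSeries (k := k) (R := WittVector p F) 1 1)) g) =
      (∏ i, σ i g.1.det ^ (c i - a i)) *
        (∏ i, σ i α ^ r i + if α = β then 0 else ∏ i, σ i β ^ r i) := by
  have hαβ : α * β ≠ 0 := hdet ▸ Matrix.GeneralLinearGroup.det_ne_zero g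
  have hone {x : k} (hx : x ≠ 0) : ∏ i, σ i x ^ r i = 1 := by
    have hx₁ := constantCoeff_typeChar₁ (p := p) (σ := σ) (c := c) hra (Units.mk0 x hx)
    rw [h, typeChar₂, constantCoeff_teichmullerChar] at hx₁
    refine (mul_eq_left₀ ?_).1 hx₁.symm
    exact Finset.prod_ne_zero_iff.2 fun i _ => zpow_ne_zero _ ((map_ne_zero _).2 hx)
  rw [trace_reduction_twist, constantCoeff_detChar_typeChar₁ h,
    trace_reduction_principalSeries (χ₁ := fun _ => 1) (χ₂ := fun _ => 1) 1 1 (fun u => by simp)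
      (fun u => by simp) g htr hdet, hone (left_ne_zero_of_mul hαβ),
    hone (right_ne_zero_of_mul hαβ), mul_one]

end Traces

/-- The constituent of a principal series indexed by `J`. -/
def constWeight (σ : ZMod f → k →+* F) (p : ℕ) (r : ZMod f → ℕ) (y : ZMod f → ℤ)
    (J : Finset (ZMod f)) : Weight σ :=
  Weight.mk σ (constDet r y J) fun i => constDim p r J i - 1

variable (hσ : ∀ i x, σ (i + 1) x ^ p = σ i x) (hk : Nat.card k = p ^ f)

include hσ hk

theorem isConstituentTheta'_iff (hr : ∀ i, r i < p) (hra : ∀ i, b i + 2 * a i = r i)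
    (hne : ∀ J J' : Finset (ZMod f), (∀ i, constDim p r J i ≠ 0) → (∀ i, constDim p r J' i ≠ 0) →
      (∀ i, constDim p r J i = constDim p r J' i) →
      ExpCong p (constDet r (fun i => c i - a i) J) (constDet r (fun i => c i - a i) J') → J = J')
    (m : ZMod f → ℤ) (n : ZMod f → ℕ) :
    IsConstituentTheta' (U := MuSpace F n) p σ b c a (mu σ m n) ↔
      ∃ J : Finset (ZMod f), (∀ i, constDim p r J i ≠ 0) ∧
        Weight.mk σ m n = constWeight σ p r (fun i => c i - a i) J := by
  classical
  have : Finite k := finite_of_natCard_eq_pow hk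
  have : CharP k p := charP_of_natCard_eq_pow hk
  have : CharP F p := charP_of_ringHom_of_natCard_eq_pow hk (σ 0)
  simp only [fun J => eq_comm.trans (Weight.mk_eq_mk_iff (σ := σ) (m' := m) (n' := n)
    (m := constDet r (fun i => c i - a i) J) (n := fun i => constDim p r J i - 1)), constWeight]
  have hfin (ψ₁ ψ₂ : kˣ →* (WittVector p F)ˣ) := finrank_reduction_principalSeries ψ₁ ψ₂
  rw [hk] at hfin
  by_cases h : typeChar₁ p σ b c a = typeChar₂ p σ c a
  · rw [IsConstituentTheta', or_iff_right fun h' => h'.1 h, and_iff_right h]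
    refine isJHConstituent_iff_of_trace hσ hk hr _ _ (hfin _ _) (fun g α β htr hdet =>
      trace_reduction_twist_detChar_typeChar hra g htr hdet h) (fun g hg => ?_) hne _
    rw [trace_reduction_twist, trace_reduction_principalSeries_eq_zero _ _ hg, mul_zero]
  · rw [IsConstituentTheta', or_iff_left fun h' => h h'.1, and_iff_right h]
    exact isJHConstituent_iff_of_trace hσ hk hr _ _ (hfin _ _) (fun g α β htr hdet =>
      trace_reduction_principalSeries_typeChar hra g htr hdet)
      (fun g hg => trace_reduction_principalSeries_eq_zero _ _ hg) hne _

theorem isConstituentTheta_iff_of_eq (h : typeChar₁ p σ b c a = typeChar₂ p σ c a)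
    (m : ZMod f → ℤ) (n : ZMod f → ℕ) :
    IsConstituentTheta (U := MuSpace F n) p σ b c a (mu σ m n) ↔
      Weight.mk σ m n = Weight.mk σ (fun i => c i - a i) fun _ => 0 := by
  rw [eq_comm, Weight.mk_eq_mk_iff, IsConstituentTheta, or_iff_right fun h' => h'.1 h,
    and_iff_right h]
  refine (isJHConstituent_iff_of_trace_eq _ (ι := Unit) (S := fun _ => MuSpace F fun _ => 0)
    (fun _ => mu σ (fun i => c i - a i) fun _ => 0)
    (fun _ => mu_isIrreducible _ hσ hk fun _ => Nat.zero_le _) (fun _ _ _ => rfl)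
    (fun _ => exists_eq_smul_of_commute_mu _ hσ hk fun _ => Nat.zero_le _) (fun g => ?_) ?_ _).trans
    (exists_const Unit)
  · have htriv : LinearMap.trace F _ (reduction
        (Representation.trivial (WittVector p F) (GL (Fin 2) k) (WittVector p F)) g) = 1 := by
      rw [trace_reduction, Representation.trivial, MonoidHom.one_apply, LinearMap.trace_one,
        Module.finrank_self, Nat.cast_one, map_one]
    rw [charRep, trace_reduction_twist, htriv, mul_one, constantCoeff_detChar_typeChar₁ h,
      Fintype.sum_unique, trace_mu]
    simp [symTrace, symCoeff]
  · rw [Fintype.sum_unique, finrank_mu, Module.finrank_baseChange]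
    simp

end Types

/-! ### Indexing weights by tuples `a` and sets `J` -/

section Combinatorics

variable {p f : ℕ} [NeZero f]

/-- The exponents `n` of the constituent of the type `a` indexed by `J`, which is absent if one of
them is `-1`. -/
def typeN (p : ℕ) (b a : ZMod f → ℤ) (J : Finset (ZMod f)) (i : ZMod f) : ℤ :=
  if i ∈ J then if i + 1 ∈ J then b i + 2 * a i else b i + 2 * a i - 1
  else if i + 1 ∈ J then p - 2 - b i - 2 * a i else p - 1 - b i - 2 * a i

/-- The exponents `m` of the constituent of the type `a` indexed by `J`. -/
def typeM (b c a : ZMod f → ℤ) (J : Finset (ZMod f)) (i : ZMod f) : ℤ :=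
  if i ∈ J then c i - a i
  else if i + 1 ∈ J then c i + b i + a i + 1 else c i + b i + a i

theorem eq_or_eq_compl_of_mem_iff {J J' : Finset (ZMod f)}
    (h : ∀ i, (i ∈ J ↔ i ∈ J') ↔ (i + 1 ∈ J ↔ i + 1 ∈ J')) : J = J' ∨ J = J'ᶜ := by
  by_cases h0 : (0 : ZMod f) ∈ J ↔ (0 : ZMod f) ∈ J'
  · exact Or.inl (Finset.ext (forall_zmod_of_add_one (fun i => (h i).1) h0))
  · refine Or.inr (Finset.ext fun j => ?_)
    have hj := forall_zmod_of_add_one (P := fun i => ¬(i ∈ J ↔ i ∈ J')) (fun i => mt (h i).2) h0 j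
    rw [Finset.mem_compl]
    tauto

theorem not_expCong_typeM_compl (hp : 1 < p) {b c a a' : ZMod f → ℤ} {J : Finset (ZMod f)}
    (hN : ∀ i, typeN p b a Jᶜ i = typeN p b a' J i) :
    ¬ ExpCong p (typeM b c a Jᶜ) (typeM b c a' J) := by
  intro hM
  let s (i : ZMod f) : ℤ := if i ∈ J then 1 else -1
  have hs (i) : 2 * (typeM b c a Jᶜ i - typeM b c a' J i) = p * s i - s (i + 1) := by
    have := hN i
    unfold typeN at this
    simp only [s, typeM, Finset.mem_compl] at this ⊢
    split_ifs at this ⊢ <;> first | contradiction | lia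
  have hsum := digitSum_telescope p s
  rw [← funext hs, digitSum_mul_left, digitSum_sub] at hsum
  obtain ⟨z, hz⟩ := hM.symm.dvd
  rw [hz] at hsum
  have hq : (1 : ℤ) < (p : ℤ) ^ f := mod_cast Nat.one_lt_pow (NeZero.ne f) hp
  have hz : 2 * z = s 1 := mul_left_cancel₀ (by lia : (p : ℤ) ^ f - 1 ≠ 0) (by rw [← hsum]; ring)
  simp only [s] at hz
  split_ifs at hz <;> lia

theorem typeN_typeM_injective (hp : 1 < p) (hodd : Odd p) {b c a a' : ZMod f → ℤ}
    {J J' : Finset (ZMod f)} (hN : ∀ i, typeN p b a J i = typeN p b a' J' i)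
    (hM : ExpCong p (typeM b c a J) (typeM b c a' J')) : a = a' ∧ J = J' := by
  obtain ⟨t, ht⟩ := hodd
  have hparity (i) : (i ∈ J ↔ i ∈ J') ↔ (i + 1 ∈ J ↔ i + 1 ∈ J') := by
    have := hN i
    unfold typeN at this
    split_ifs at this <;> first | tauto | lia
  obtain rfl | rfl := eq_or_eq_compl_of_mem_iff hparity
  · refine ⟨funext fun i => ?_, rfl⟩
    have := hN i
    unfold typeN at this
    split_ifs at this <;> lia
  · exact absurd hM (not_expCong_typeM_compl hp hN)

/-- The tuples `a` and sets `J` for which the constituent of the type `a` indexed by `J` is of the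
form `μ(J, d)`. -/
def Compatible (e : ℕ) (a : ZMod f → ℤ) (J : Finset (ZMod f)) : Prop :=
  ∀ i, (i + 1 ∈ J → 0 ≤ a i ∧ a i ≤ e - 1) ∧ (i + 1 ∉ J → 1 ≤ a i ∧ a i ≤ e)

omit [NeZero f] in
theorem Compatible.mem_setA {e : ℕ} {a : ZMod f → ℤ} {J : Finset (ZMod f)} (h : Compatible e a J) :
    a ∈ setA f e := fun i => by
  have := h i
  by_cases hi : i + 1 ∈ J <;> simp only [hi, not_true, not_false_eq_true, true_imp_iff] at this <;>
    lia

/-- The tuple `a` for which `μ(J, d)` is a constituent of the type `a`. -/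
def typeOf (J : Finset (ZMod f)) (d : ZMod f → ℤ) (i : ZMod f) : ℤ :=
  d i + (if i ∈ J then 1 else 0) - if i + 1 ∈ J then 1 else 0

theorem sum_typeOf (J : Finset (ZMod f)) (d : ZMod f → ℤ) : ∑ i, typeOf J d i = ∑ i, d i := by
  have h : ∑ i, (if i + 1 ∈ J then (1 : ℤ) else 0) = ∑ i, if i ∈ J then (1 : ℤ) else 0 :=
    Equiv.sum_comp (Equiv.addRight (1 : ZMod f)) fun i => if i ∈ J then (1 : ℤ) else 0
  simp only [typeOf, Finset.sum_sub_distrib, Finset.sum_add_distrib]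
  rw [h, add_sub_cancel_right]

omit [NeZero f] in
theorem exists_typeOf_eq (J : Finset (ZMod f)) (a : ZMod f → ℤ) : ∃ d, typeOf J d = a := by
  refine ⟨fun i => a i - (if i ∈ J then 1 else 0) + if i + 1 ∈ J then 1 else 0, funext fun i => ?_⟩
  rw [typeOf]
  ring

omit [NeZero f] in
theorem compatible_typeOf_iff {e : ℕ} {J : Finset (ZMod f)} {d : ZMod f → ℤ} :
    Compatible e (typeOf J d) J ↔ Admissible e J d := by
  refine forall_congr' fun i => ?_
  unfold typeOf
  split_ifs with h1 h2 h2 <;> simp only [h1, h2, forall_const, not_true, not_false_eq_true,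
    false_imp_iff, and_true, true_and] <;> lia

omit [NeZero f] in
theorem typeN_typeOf (b : ZMod f → ℤ) (J : Finset (ZMod f)) (d : ZMod f → ℤ) (i : ZMod f) :
    typeN p b (typeOf J d) J i = muN p b J d i := by
  unfold typeN typeOf muN
  split_ifs <;> ring

theorem expCong_typeM_typeOf (b c : ZMod f → ℤ) (J : Finset (ZMod f)) (d : ZMod f → ℤ) :
    ExpCong p (muM p b c J d) (typeM b c (typeOf J d) J) := by
  refine ExpCong.of_sub_eq (fun i => if i ∈ J then 1 else 0) fun i => ?_
  unfold muM typeM typeOf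
  split_ifs <;> ring

theorem compatible_iff_mem_Icc {e : ℕ} {a : ZMod f → ℤ} (ha : a ∈ setA f e) (J : Finset (ZMod f)) :
    Compatible e a J ↔ J ∈ Finset.Icc (Finset.univ.filter fun i => a (i - 1) = 0)
      (Finset.univ.filter fun i => a (i - 1) ≠ e) := by
  have hIcc : J ∈ Finset.Icc (Finset.univ.filter fun i => a (i - 1) = 0)
      (Finset.univ.filter fun i => a (i - 1) ≠ e) ↔
        ∀ i, (a i = 0 → i + 1 ∈ J) ∧ (i + 1 ∈ J → a i ≠ e) := by
    rw [← (Equiv.subRight (1 : ZMod f)).forall_congr_right]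
    simp only [Finset.mem_Icc, Finset.subset_iff, Finset.mem_filter,
      Finset.mem_univ, true_and, Equiv.subRight_apply, sub_add_cancel, forall_and]
  rw [hIcc]
  refine forall_congr' fun i => ?_
  have := ha i
  by_cases hi : i + 1 ∈ J <;> simp only [hi, not_true, not_false_eq_true, true_imp_iff,
    false_imp_iff, imp_true_iff, imp_false, and_true, true_and] <;> lia

theorem card_filter_sub_one (P : ZMod f → Prop) [DecidablePred P] :
    (Finset.univ.filter fun i => P (i - 1)).card = (Finset.univ.filter P).card :=
  Finset.card_equiv (Equiv.subRight 1) fun i => by simp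

theorem card_compatible {e : ℕ} (he : 0 < e) {a : ZMod f → ℤ} (ha : a ∈ setA f e) :
    {J : Finset (ZMod f) | Compatible e a J}.ncard = 2 ^ (f - delta e a) := by
  have hsub : (Finset.univ.filter fun i => a (i - 1) = 0) ⊆
      Finset.univ.filter fun i => a (i - 1) ≠ e :=
    Finset.monotone_filter_right _ fun i _ hi => by lia
  have hdelta : delta e a = (Finset.univ.filter fun i => a i = 0).card +
      (Finset.univ.filter fun i => a i = e).card := by
    rw [delta, Finset.filter_or, Finset.card_union_of_disjoint]
    exact Finset.disjoint_filter.2 fun i _ h h' => by lia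
  have htotal := Finset.card_filter_add_card_filter_not (s := (Finset.univ : Finset (ZMod f)))
    (fun i => a i = e)
  rw [Finset.card_univ, ZMod.card] at htotal
  simp only [compatible_iff_mem_Icc ha, Finset.setOfPred_mem]
  rw [Set.ncard_coe_finset, Finset.card_Icc_finset hsub, card_filter_sub_one fun i => a i ≠ e,
    card_filter_sub_one fun i => a i = 0]
  congr 1
  lia

end Combinatorics

section PredictedWeights

universe u

variable {p : ℕ} {k : Type} {F : Type u} [Field k] [Field F] {f : ℕ} [NeZero f]
  {σ : ZMod f → k →+* F}

/-- The constituent of the reduction of the type `a` indexed by `J`. -/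
def typeWeight (σ : ZMod f → k →+* F) (p : ℕ) (b c a : ZMod f → ℤ) (J : Finset (ZMod f)) :
    Weight σ :=
  Weight.mk σ (typeM b c a J) fun i => (typeN p b a J i).toNat

/-- The pairs `(a, J)` for which the constituent of the type `a` indexed by `J` is predicted: it is
`μ(J, d)` in the first case and `μ'(Jᶜ, a)` in the second. -/
def IsPredicted (p e : ℕ) (b a : ZMod f → ℤ) (J : Finset (ZMod f)) : Prop :=
  Compatible e a J ∨ Exceptional p e b Jᶜ a

/-- The set `W'` of the predicted weights, with the conditions on the characters expressed as
congruences between exponents. -/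
def predictedSet (σ : ZMod f → k →+* F) (p e : ℕ) (b c : ZMod f → ℤ) : Set (Weight σ) :=
  {w | ∃ (m : ZMod f → ℤ) (n : ZMod f → ℕ), (∀ i, n i ≤ p - 1) ∧ w = Weight.mk σ m n ∧
    ∃ (J : Finset (ZMod f)) (d : ZMod f → ℤ), Admissible e J d ∧
      ExpCong p (fun i => if i ∈ J then m i + n i + e - d i else m i + e - d i)
        (fun i => c i + (b i + e)) ∧
      ExpCong p (fun i => if i ∈ J then m i + d i else m i + n i + d i) c}

theorem expCong_const : ExpCong p (fun _ : ZMod f => (p : ℤ) - 1) fun _ => 0 :=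
  ExpCong.of_sub_eq (fun _ => 1) fun _ => by ring

theorem expCong_muM {b d n : ZMod f → ℤ} {J : Finset (ZMod f)}
    (hn : ∀ i, n i = muN p b J d i) (c : ZMod f → ℤ) :
    ExpCong p (fun i => if i ∈ J then muM p b c J d i + d i
      else muM p b c J d i + n i + d i) c := by
  refine ExpCong.of_sub_eq (fun _ => 1) fun i => ?_
  simp only [hn, muM, muN]
  split_ifs <;> ring

theorem expCong_muN {b d n : ZMod f → ℤ} {J : Finset (ZMod f)} (hn : ∀ i, n i = muN p b J d i) :
    ExpCong p (fun i => if i ∈ J then n i else -n i) fun i => b i + 2 * d i := by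
  refine ExpCong.of_sub_eq (fun i => if i ∈ J then 0 else -1) fun i => ?_
  simp only [hn, muN]
  split_ifs <;> ring

theorem expCong_second_iff {e : ℕ} {b c m d : ZMod f → ℤ} {n : ZMod f → ℕ} {J : Finset (ZMod f)}
    (h : ExpCong p (fun i => if i ∈ J then m i + d i else m i + n i + d i) c) :
    ExpCong p (fun i => if i ∈ J then m i + n i + e - d i else m i + e - d i)
        (fun i => c i + (b i + e)) ↔
      ExpCong p (fun i => if i ∈ J then (n i : ℤ) else -n i) (fun i => b i + 2 * d i) := by
  constructor
  · refine fun h' => (h'.sub h).of_sub_congr fun i => ?_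
    split_ifs <;> ring
  · refine fun h' => (h'.add h).of_sub_congr fun i => ?_
    split_ifs <;> ring

theorem Exceptional.admissible {e : ℕ} (he : 0 < e) {b d : ZMod f → ℤ} {J : Finset (ZMod f)}
    (h : Exceptional p e b J d) : Admissible e J d := by
  rcases h with ⟨rfl, h⟩ | ⟨rfl, h⟩ <;> intro i <;> have := h i <;>
    simp only [Finset.mem_univ, Finset.notMem_empty, not_true, not_false_eq_true, true_imp_iff,
      false_imp_iff, and_true, true_and] <;> lia

omit [NeZero f] in
theorem typeN_le {e : ℕ} {b a : ZMod f → ℤ}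
    (hb : ∀ i, (e : ℤ) ≤ b i + e ∧ b i + e ≤ p - 1 - e) (ha : a ∈ setA f e)
    (J : Finset (ZMod f)) (i : ZMod f) : typeN p b a J i ≤ p - 1 := by
  have h1 := hb i
  have h2 := ha i
  unfold typeN
  split_ifs <;> lia

theorem IsPredicted.mem_setA {e : ℕ} {b a : ZMod f → ℤ} {J : Finset (ZMod f)}
    (h : IsPredicted p e b a J) : a ∈ setA f e := by
  rcases h with h | ⟨-, h⟩ | ⟨-, h⟩
  · exact h.mem_setA
  all_goals
    intro i
    have := h i
    lia

theorem IsPredicted.typeN_nonneg {e : ℕ} {b a : ZMod f → ℤ}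
    (hb : ∀ i, (e : ℤ) ≤ b i + e ∧ b i + e ≤ p - 1 - e) {J : Finset (ZMod f)}
    (h : IsPredicted p e b a J) (i : ZMod f) : 0 ≤ typeN p b a J i := by
  have h1 := hb i
  rcases h with h | ⟨hJ, h⟩ | ⟨hJ, h⟩ <;> have h2 := h i
  · unfold typeN
    split_ifs with h3 h4 h4 <;> simp only [h4, not_true, not_false_eq_true, false_imp_iff,
      true_imp_iff, and_true, true_and] at h2 <;> lia
  · obtain rfl := Finset.compl_eq_univ_iff J |>.1 hJ
    simp only [typeN, Finset.notMem_empty, if_false]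
    lia
  · obtain rfl := Finset.compl_eq_empty_iff J |>.1 hJ
    simp only [typeN, Finset.mem_univ, if_true]
    lia

theorem eq_muN_or_exceptional {e : ℕ} (hp : 1 < p) {b d : ZMod f → ℤ}
    (hb : ∀ i, (e : ℤ) ≤ b i + e ∧ b i + e ≤ p - 1 - e) {J : Finset (ZMod f)}
    (hd : Admissible e J d) {n : ZMod f → ℕ} (hn : ∀ i, n i ≤ p - 1)
    (h : ExpCong p (fun i => if i ∈ J then (n i : ℤ) else -n i) fun i => b i + 2 * d i) :
    (∀ i, n i = muN p b J d i) ∨ Exceptional p e b J d ∧ ∀ i, n i = p - 1 := by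
  have hN := muN_mem hb hd
  -- Both sides become digits in `[0, p - 1]` after adding `p - 1` at the indices outside `J`.
  have hdigits := ((h.trans (expCong_muN (J := J) fun _ => rfl).symm).add
    (ExpCong.refl fun i => if i ∈ J then (0 : ℤ) else p - 1)).eq_or hp
    (fun i => by have := hn i; split_ifs <;> lia) (fun i => by have := hN i; split_ifs <;> lia)
  rcases hdigits with hdigits | hdigits | hdigits
  · refine Or.inl fun i => ?_
    have := congrFun hdigits i
    split_ifs at this <;> lia
  · have hJ (i) : i ∉ J := fun hi => by
      have h1 := hdigits i
      have h2 := hN i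
      simp only [hi, if_true] at h1
      lia
    obtain rfl := Finset.eq_empty_of_forall_notMem hJ
    refine Or.inr ⟨Or.inr ⟨rfl, fun i => ?_⟩, fun i => ?_⟩ <;>
      have h1 := hdigits i <;> have h2 := hb i <;> have h3 := (hd i).2 (hJ i) <;>
      simp only [muN, Finset.notMem_empty, if_false] at h1 <;> lia
  · have hJ (i) : i ∈ J := by
      by_contra hi
      have h1 := hdigits i
      have h2 := hN i
      simp only [hi, if_false] at h1
      lia
    obtain rfl := Finset.eq_univ_of_forall hJ
    refine Or.inr ⟨Or.inl ⟨rfl, fun i => ?_⟩, fun i => ?_⟩ <;>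
      have h1 := hdigits i <;> have h2 := hb i <;> have h3 := (hd i).1 (hJ i) <;>
      simp only [muN, Finset.mem_univ, if_true] at h1 <;> lia

variable {e : ℕ} {b : ZMod f → ℤ} (c : ZMod f → ℤ)

theorem muJd_mem_predictedSet (hb : ∀ i, (e : ℤ) ≤ b i + e ∧ b i + e ≤ p - 1 - e)
    {J : Finset (ZMod f)} {d : ZMod f → ℤ} (hd : Admissible e J d) :
    muJd σ p b c J d ∈ predictedSet σ p e b c := by
  have hn := muN_mem hb hd
  have hcast (i) : ((muN p b J d i).toNat : ℤ) = muN p b J d i := Int.toNat_of_nonneg (hn i).1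
  have hfirst := expCong_muM hcast c
  exact ⟨_, _, fun i => by have := hn i; lia, rfl, J, d, hd,
    (expCong_second_iff hfirst).2 (expCong_muN hcast), hfirst⟩

theorem muPrimeJd_mem_predictedSet (hp : 0 < p) (he : 0 < e) {J : Finset (ZMod f)}
    {d : ZMod f → ℤ} (h : Exceptional p e b J d) :
    muPrimeJd σ p e c J ∈ predictedSet σ p e b c := by
  have hfirst : ExpCong p (fun i => if i ∈ J then (if i ∈ J then c i else c i - e) + d i
      else (if i ∈ J then c i else c i - e) + (p - 1 : ℕ) + d i) c := by
    refine ExpCong.of_sub_eq (fun i => if i ∈ J then 0 else 1) fun i => ?_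
    rcases h with ⟨rfl, h⟩ | ⟨rfl, h⟩ <;> have := h i <;>
      simp only [Finset.mem_univ, Finset.notMem_empty, if_true, if_false] <;> lia
  refine ⟨_, _, fun _ => le_rfl, rfl, J, d, h.admissible he, (expCong_second_iff hfirst).2 ?_,
    hfirst⟩
  refine ExpCong.of_sub_eq (fun i => if i ∈ J then 1 else -2) fun i => ?_
  rcases h with ⟨rfl, h⟩ | ⟨rfl, h⟩ <;> have := h i <;>
    simp only [Finset.mem_univ, Finset.notMem_empty, if_true, if_false] <;> lia

theorem muPrimeJd_eq_typeWeight (hp : 0 < p) {J : Finset (ZMod f)} {d : ZMod f → ℤ}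
    (h : Exceptional p e b J d) : muPrimeJd σ p e c J = typeWeight σ p b c d Jᶜ := by
  rw [muPrimeJd, typeWeight]
  congr 1 <;> funext i <;> rcases h with ⟨rfl, h⟩ | ⟨rfl, h⟩ <;> have := h i <;>
    simp only [typeM, typeN, Finset.compl_univ, Finset.compl_empty, Finset.mem_univ,
      Finset.notMem_empty, if_true, if_false] <;> lia

variable [Fact p.Prime] (hσ : ∀ i x, σ (i + 1) x ^ p = σ i x) (hk : Nat.card k = p ^ f)

include hσ hk

theorem Weight.mk_eq_mk_iff_expCong {m m' : ZMod f → ℤ} {n n' : ZMod f → ℕ}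
    (hn : ∀ i, n i ≤ p - 1) (hn' : ∀ i, n' i ≤ p - 1) :
    Weight.mk σ m n = Weight.mk σ m' n' ↔ n = n' ∧ ExpCong p m m' := by
  rw [Weight.mk_eq_mk_iff, isoRep_mu_iff hσ hk hn hn']

theorem Weight.mk_congr {m m' : ZMod f → ℤ} (n : ZMod f → ℕ) (h : ExpCong p m m') :
    Weight.mk σ m n = Weight.mk σ m' n := by
  rw [Weight.mk_eq_mk_iff, mu_congr σ n ((prod_embedding_eq_iff hσ hk m m').2 h)]
  exact ⟨Representation.Equiv.refl _⟩

theorem muJd_eq_typeWeight (b c : ZMod f → ℤ) (J : Finset (ZMod f)) (d : ZMod f → ℤ) :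
    muJd σ p b c J d = typeWeight σ p b c (typeOf J d) J := by
  rw [muJd, Weight.mk_congr hσ hk _ (expCong_typeM_typeOf b c J d), typeWeight]
  simp only [typeN_typeOf]

theorem setW_eq (e : ℕ) (b c : ZMod f → ℤ) :
    setW σ p e b c = {w | ∃ a J, Compatible e a J ∧ w = typeWeight σ p b c a J} := by
  ext w
  constructor
  · rintro ⟨J, d, hd, rfl⟩
    exact ⟨_, J, compatible_typeOf_iff.2 hd, muJd_eq_typeWeight hσ hk b c J d⟩
  · rintro ⟨a, J, h, rfl⟩
    obtain ⟨d, rfl⟩ := exists_typeOf_eq J a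
    exact ⟨J, d, compatible_typeOf_iff.1 h, (muJd_eq_typeWeight hσ hk b c J d).symm⟩

variable (hb : ∀ i, (e : ℤ) ≤ b i + e ∧ b i + e ≤ p - 1 - e)

include hb

theorem predictedSet_subset {w : Weight σ} (hw : w ∈ predictedSet σ p e b c) :
    (∃ J d, Admissible e J d ∧ w = muJd σ p b c J d) ∨
      ∃ J d, Exceptional p e b J d ∧ w = muPrimeJd σ p e c J := by
  have hp := (Fact.out : p.Prime).one_lt
  obtain ⟨m, n, hn, rfl, J, d, hd, h₂, h₁⟩ := hw
  rw [expCong_second_iff h₁] at h₂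
  rcases eq_muN_or_exceptional hp hb hd hn h₂ with hN | ⟨h, hN⟩
  · refine Or.inl ⟨J, d, hd, ?_⟩
    have hn' : (fun i => (muN p b J d i).toNat) = n := funext fun i => by
      rw [← hN, Int.toNat_natCast]
    rw [muJd, hn']
    refine Weight.mk_congr hσ hk n ((h₁.trans (expCong_muM hN c).symm).of_sub_congr fun i => ?_)
    split_ifs <;> ring
  · refine Or.inr ⟨J, d, h, ?_⟩
    obtain rfl := funext hN
    refine Weight.mk_congr hσ hk _ ?_
    rcases h with ⟨rfl, h⟩ | ⟨rfl, h⟩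
    · refine h₁.of_sub_congr fun i => ?_
      have := h i
      simp only [Finset.mem_univ, if_true]
      lia
    · refine (h₁.sub expCong_const).of_sub_congr fun i => ?_
      have := h i
      simp only [Finset.notMem_empty, if_false]
      lia

variable (he : 0 < e)

include he

theorem predictedSet_eq :
    predictedSet σ p e b c = {w | ∃ a J, IsPredicted p e b a J ∧ w = typeWeight σ p b c a J} := by
  have hp := (Fact.out : p.Prime).pos
  ext w
  constructor
  · intro hw
    obtain ⟨J, d, hd, rfl⟩ | ⟨J, d, h, rfl⟩ := predictedSet_subset c hσ hk hb hw
    · exact ⟨_, J, Or.inl (compatible_typeOf_iff.2 hd), muJd_eq_typeWeight hσ hk b c J d⟩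
    · exact ⟨d, Jᶜ, Or.inr (by rwa [compl_compl]), muPrimeJd_eq_typeWeight c hp h⟩
  · rintro ⟨a, J, h | h, rfl⟩
    · obtain ⟨d, rfl⟩ := exists_typeOf_eq J a
      rw [← muJd_eq_typeWeight hσ hk]
      exact muJd_mem_predictedSet c hb (compatible_typeOf_iff.1 h)
    · rw [← compl_compl J, ← muPrimeJd_eq_typeWeight c hp h]
      exact muPrimeJd_mem_predictedSet c hp he h

omit hσ hk [NeZero f] in
theorem odd_of_generic : Odd p := by
  have := hb 0
  exact (Fact.out : p.Prime).odd_of_ne_two (by lia)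

theorem typeWeight_injective {a a' : ZMod f → ℤ} {J J' : Finset (ZMod f)} (ha : a ∈ setA f e)
    (ha' : a' ∈ setA f e) (hJ : ∀ i, 0 ≤ typeN p b a J i) (hJ' : ∀ i, 0 ≤ typeN p b a' J' i)
    (h : typeWeight σ p b c a J = typeWeight σ p b c a' J') : a = a' ∧ J = J' := by
  have h1 := typeN_le hb ha J
  have h2 := typeN_le hb ha' J'
  rw [typeWeight, typeWeight, Weight.mk_eq_mk_iff_expCong hσ hk
    (fun i => by have := h1 i; lia) fun i => by have := h2 i; lia] at h
  refine typeN_typeM_injective (Fact.out : p.Prime).one_lt (odd_of_generic hb he) (fun i => ?_) h.2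
  have h3 := congrFun h.1 i
  have h4 := hJ i
  have h5 := hJ' i
  lia

end PredictedWeights

section TypeConstituents

universe u

variable {p : ℕ} [Fact p.Prime] {k : Type} {F : Type u} [Field k] [Field F] {f : ℕ} [NeZero f]
  {σ : ZMod f → k →+* F} {e : ℕ} {b a : ZMod f → ℤ} (c : ZMod f → ℤ)

/-- The set of the constituents of the reduction of `θ_a`. -/
def thetaSet (σ : ZMod f → k →+* F) (p : ℕ) [Fact p.Prime] (b c a : ZMod f → ℤ) :
    Set (Weight σ) :=
  {w | ∃ m n, w = Weight.mk σ m n ∧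
    IsConstituentTheta (U := MuSpace F n) p σ b c a (mu σ m n)}

/-- The set of the constituents of the reduction of `θ'_a`. -/
def thetaSet' (σ : ZMod f → k →+* F) (p : ℕ) [Fact p.Prime] (b c a : ZMod f → ℤ) :
    Set (Weight σ) :=
  {w | ∃ m n, w = Weight.mk σ m n ∧
    IsConstituentTheta' (U := MuSpace F n) p σ b c a (mu σ m n)}

section Constituents

variable {r : ZMod f → ℕ} (hr : ∀ i, r i < p) (hra : ∀ i, b i + 2 * a i = r i)

include hra

omit [NeZero f] in
theorem constDet_eq_typeM (J : Finset (ZMod f)) :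
    constDet r (fun i => c i - a i) J = typeM b c a J := by
  funext i
  have := hra i
  unfold constDet typeM
  by_cases h3 : i ∈ J <;> by_cases h4 : i + 1 ∈ J <;> simp only [h3, h4, decide_true,
    decide_false, if_true, if_false, transferDet] <;> lia

include hr

omit [Fact p.Prime] [NeZero f] in
theorem constDim_eq_typeN_add_one (J : Finset (ZMod f)) (i : ZMod f) :
    (constDim p r J i : ℤ) = typeN p b a J i + 1 := by
  have h1 := hr i
  have h2 := hra i
  unfold constDim typeN
  by_cases h3 : i ∈ J <;> by_cases h4 : i + 1 ∈ J <;> simp only [h3, h4, decide_true,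
    decide_false, if_true, if_false, transferDim] <;> lia

omit [Fact p.Prime] [NeZero f] in
theorem constWeight_eq_typeWeight (J : Finset (ZMod f)) :
    constWeight σ p r (fun i => c i - a i) J = typeWeight σ p b c a J := by
  rw [constWeight, typeWeight, constDet_eq_typeM c hra]
  congr 1
  funext i
  have := constDim_eq_typeN_add_one hr hra J i
  lia

end Constituents

section

variable (hb : ∀ i, (e : ℤ) ≤ b i + e ∧ b i + e ≤ p - 1 - e) (ha : a ∈ setA f e)

include hb ha

omit [NeZero f] in
theorem exists_natCast_eq_add_two_mul :
    ∃ r : ZMod f → ℕ, (∀ i, r i < p) ∧ ∀ i, b i + 2 * a i = r i := by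
  have hp := (Fact.out : p.Prime).pos
  refine ⟨fun i => (b i + 2 * a i).toNat, fun i => ?_, fun i => ?_⟩ <;>
    have h1 := hb i <;> have h2 := ha i <;> lia

theorem typeChar_eq_iff_forall (hσ : ∀ i x, σ (i + 1) x ^ p = σ i x) (hk : Nat.card k = p ^ f) :
    typeChar₁ p σ b c a = typeChar₂ p σ c a ↔
      (∀ i, b i + 2 * a i = 0) ∨ ∀ i, b i + 2 * a i = p - 1 := by
  have hp := (Fact.out : p.Prime).one_lt
  obtain ⟨r, hr, hra⟩ := exists_natCast_eq_add_two_mul hb ha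
  rw [typeChar_eq_iff hσ hk]
  constructor
  · intro h
    rcases h.eq_or hp (fun i => by have := hr i; have := hra i; lia) (fun _ => by lia) with
      h | h | h
    · exact Or.inl (congrFun h)
    · exact Or.inl fun i => (h i).1
    · exact Or.inr fun i => (h i).1
  · rintro (h | h) <;> rw [funext h]
    · exact ExpCong.refl _
    · exact expCong_const

end

theorem compatible_iff_eq_univ (he : 0 < e) (ha : ∀ i, a i = 0) (J : Finset (ZMod f)) :
    Compatible e a J ↔ J = Finset.univ := by
  rw [compatible_iff_mem_Icc fun i => by rw [ha]; lia]
  simp [ha, eq_comm (a := (0 : ℤ)), he.ne']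

theorem compatible_iff_eq_empty (he : 0 < e) (ha : ∀ i, a i = e) (J : Finset (ZMod f)) :
    Compatible e a J ↔ J = ∅ := by
  rw [compatible_iff_mem_Icc fun i => by rw [ha]; lia]
  simp [ha, he.ne']

variable (hσ : ∀ i x, σ (i + 1) x ^ p = σ i x) (hk : Nat.card k = p ^ f)
  (hb : ∀ i, (e : ℤ) ≤ b i + e ∧ b i + e ≤ p - 1 - e) (he : 0 < e) (ha : a ∈ setA f e)

include hσ hk hb he ha

theorem exists_compatible_iff_of_typeChar_eq (h : typeChar₁ p σ b c a = typeChar₂ p σ c a) :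
    ∃ J, (∀ J', Compatible e a J' ↔ J' = J) ∧
      typeWeight σ p b c a J = Weight.mk σ (fun i => c i - a i) fun _ => 0 := by
  rcases (typeChar_eq_iff_forall c hb ha hσ hk).1 h with h0 | h0
  · refine ⟨Finset.univ, compatible_iff_eq_univ he fun i => ?_, ?_⟩
    · have := hb i; have := ha i; have := h0 i; lia
    · unfold typeWeight typeM typeN
      simp only [Finset.mem_univ, if_true, h0, Int.toNat_zero]
  · refine ⟨∅, compatible_iff_eq_empty he fun i => ?_, ?_⟩
    · have := hb i; have := ha i; have := h0 i; lia
    · have hN : (fun i => (typeN p b a ∅ i).toNat) = fun _ => 0 := funext fun i => by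
        have := h0 i
        simp only [typeN, Finset.notMem_empty, if_false]
        lia
      rw [typeWeight, hN]
      refine Weight.mk_congr hσ hk _ (ExpCong.of_sub_eq (fun _ => 1) fun i => ?_)
      have := h0 i
      simp only [typeM, Finset.notMem_empty, if_false]
      lia

theorem thetaSet'_eq : thetaSet' σ p b c a =
    {w | ∃ J, (∀ i, 0 ≤ typeN p b a J i) ∧ w = typeWeight σ p b c a J} := by
  have hp := (Fact.out : p.Prime).one_lt
  obtain ⟨r, hr, hra⟩ := exists_natCast_eq_add_two_mul hb ha
  have hdim := constDim_eq_typeN_add_one hr hra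
  have hnonneg (J) : (∀ i, constDim p r J i ≠ 0) ↔ ∀ i, 0 ≤ typeN p b a J i :=
    forall_congr' fun i => by have := hdim J i; lia
  have key := isConstituentTheta'_iff (c := c) hσ hk hr hra fun J J' _ _ hN hM => by
    rw [constDet_eq_typeM c hra, constDet_eq_typeM c hra] at hM
    refine (typeN_typeM_injective hp (odd_of_generic hb he) (b := b) (fun i => ?_) hM).2
    have := hdim J i; have := hdim J' i; have := hN i; lia
  simp only [hnonneg, constWeight_eq_typeWeight c hr hra] at key
  ext w
  constructor
  · rintro ⟨m, n, rfl, h⟩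
    exact (key m n).1 h
  · rintro ⟨J, hJ, rfl⟩
    exact ⟨_, _, rfl, (key _ _).2 ⟨J, hJ, rfl⟩⟩

theorem predictedSet_inter_thetaSet' : predictedSet σ p e b c ∩ thetaSet' σ p b c a =
    {w | ∃ J, IsPredicted p e b a J ∧ w = typeWeight σ p b c a J} := by
  rw [predictedSet_eq c hσ hk hb he, thetaSet'_eq c hσ hk hb he ha]
  ext w
  constructor
  · rintro ⟨⟨a', J', h, rfl⟩, J, hJ, h'⟩
    obtain ⟨rfl, rfl⟩ := typeWeight_injective c hσ hk hb he h.mem_setA ha (h.typeN_nonneg hb) hJ h'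
    exact ⟨J', h, rfl⟩
  · rintro ⟨J, h, rfl⟩
    exact ⟨⟨a, J, h, rfl⟩, J, h.typeN_nonneg hb, rfl⟩

theorem predictedSet_inter_thetaSet : predictedSet σ p e b c ∩ thetaSet σ p b c a =
    {w | ∃ J, Compatible e a J ∧ w = typeWeight σ p b c a J} := by
  by_cases h : typeChar₁ p σ b c a = typeChar₂ p σ c a
  · have key := isConstituentTheta_iff_of_eq hσ hk h
    obtain ⟨J, hJ, hw⟩ := exists_compatible_iff_of_typeChar_eq c hσ hk hb he ha h
    simp only [hJ, exists_eq_left]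
    ext w
    constructor
    · rintro ⟨-, m, n, rfl, hmn⟩
      exact ((key m n).1 hmn).trans hw.symm
    · rintro rfl
      rw [predictedSet_eq c hσ hk hb he]
      exact ⟨⟨a, J, Or.inl ((hJ J).2 rfl), rfl⟩, _, _, hw, (key _ _).2 rfl⟩
  · have htheta : thetaSet σ p b c a = thetaSet' σ p b c a := by
      simp only [thetaSet, thetaSet', IsConstituentTheta, IsConstituentTheta', h, false_and,
        or_false]
    have hexc (J) : ¬Exceptional p e b J a := fun hJ =>
      h <| (typeChar_eq_iff_forall c hb ha hσ hk).2 <|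
        hJ.imp (fun hJ i => by have := hJ.2 i; lia) fun hJ i => by have := hJ.2 i; lia
    rw [htheta, predictedSet_inter_thetaSet' c hσ hk hb he ha]
    simp only [IsPredicted, hexc, or_false]

theorem ncard_predictedSet_inter_thetaSet :
    (predictedSet σ p e b c ∩ thetaSet σ p b c a).ncard = 2 ^ (f - delta e a) := by
  have himage : predictedSet σ p e b c ∩ thetaSet σ p b c a =
      typeWeight σ p b c a '' {J | Compatible e a J} := by
    rw [predictedSet_inter_thetaSet c hσ hk hb he ha]
    simp only [Set.image, Set.mem_ofPred_eq, eq_comm]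
  rw [himage, Set.InjOn.ncard_image, card_compatible he ha]
  exact fun J (hJ : Compatible e a J) J' (hJ' : Compatible e a J') h =>
    (typeWeight_injective c hσ hk hb he ha ha (IsPredicted.typeN_nonneg hb (Or.inl hJ))
      (IsPredicted.typeN_nonneg hb (Or.inl hJ')) h).2

end TypeConstituents

section Decomposition

universe u

variable {p : ℕ} [Fact p.Prime] {k : Type} {F : Type u} [Field k] [Field F] {f : ℕ} [NeZero f]
  {σ : ZMod f → k →+* F} {e : ℕ} {b : ZMod f → ℤ} (c : ZMod f → ℤ)
  (hσ : ∀ i x, σ (i + 1) x ^ p = σ i x) (hk : Nat.card k = p ^ f)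
  (hb : ∀ i, (e : ℤ) ≤ b i + e ∧ b i + e ≤ p - 1 - e) (he : 0 < e)

include hσ hk hb he

theorem setW_eq_biUnion :
    setW σ p e b c = ⋃ a ∈ setA f e, predictedSet σ p e b c ∩ thetaSet σ p b c a := by
  rw [setW_eq hσ hk, Set.iUnion₂_congr fun a => predictedSet_inter_thetaSet c hσ hk hb he]
  ext w
  simp only [Set.mem_iUnion₂]
  exact exists_congr fun a => ⟨fun ⟨J, h, hw⟩ => ⟨h.mem_setA, J, h, hw⟩, fun ⟨_, h⟩ => h⟩

theorem predictedSet_eq_biUnion :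
    predictedSet σ p e b c = ⋃ a ∈ setA f e, predictedSet σ p e b c ∩ thetaSet' σ p b c a := by
  rw [Set.iUnion₂_congr fun a => predictedSet_inter_thetaSet' c hσ hk hb he,
    predictedSet_eq c hσ hk hb he]
  ext w
  simp only [Set.mem_iUnion₂]
  exact exists_congr fun a => ⟨fun ⟨J, h, hw⟩ => ⟨h.mem_setA, J, h, hw⟩, fun ⟨_, h⟩ => h⟩

theorem eq_of_typeWeight_mem {a a' : ZMod f → ℤ} {J : Finset (ZMod f)} (ha : a ∈ setA f e)
    (h : IsPredicted p e b a' J)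
    (hmem : typeWeight σ p b c a' J ∈ predictedSet σ p e b c ∩ thetaSet' σ p b c a) : a = a' := by
  rw [predictedSet_inter_thetaSet' c hσ hk hb he ha] at hmem
  obtain ⟨J', h', hw⟩ := hmem
  exact (typeWeight_injective c hσ hk hb he h.mem_setA ha (h.typeN_nonneg hb) (h'.typeN_nonneg hb)
    hw).1.symm

theorem pairwiseDisjoint_predictedSet_inter_thetaSet' :
    (setA f e).PairwiseDisjoint fun a => predictedSet σ p e b c ∩ thetaSet' σ p b c a := by
  intro a ha a' ha' hne
  refine Set.disjoint_left.2 fun w hw hw' => hne ?_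
  obtain ⟨J, h, rfl⟩ := (predictedSet_inter_thetaSet' c hσ hk hb he ha').subset hw'
  exact eq_of_typeWeight_mem c hσ hk hb he ha h hw

theorem pairwiseDisjoint_predictedSet_inter_thetaSet :
    (setA f e).PairwiseDisjoint fun a => predictedSet σ p e b c ∩ thetaSet σ p b c a := by
  refine (pairwiseDisjoint_predictedSet_inter_thetaSet' c hσ hk hb he).mono_on fun a ha => ?_
  rw [predictedSet_inter_thetaSet c hσ hk hb he ha, predictedSet_inter_thetaSet' c hσ hk hb he ha]
  exact fun w ⟨J, h, hw⟩ => ⟨J, Or.inl h, hw⟩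

theorem sum_eq_of_muJd_mem {a d : ZMod f → ℤ} {J : Finset (ZMod f)} (ha : a ∈ setA f e)
    (hd : Admissible e J d)
    (h : muJd σ p b c J d ∈ predictedSet σ p e b c ∩ thetaSet' σ p b c a) :
    ∑ i, a i = ∑ i, d i := by
  rw [muJd_eq_typeWeight hσ hk] at h
  rw [eq_of_typeWeight_mem c hσ hk hb he ha (Or.inl (compatible_typeOf_iff.2 hd)) h, sum_typeOf]

theorem eq_of_muPrimeJd_mem {a d : ZMod f → ℤ} {J : Finset (ZMod f)} (ha : a ∈ setA f e)
    (hd : Exceptional p e b J d)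
    (h : muPrimeJd σ p e c J ∈ predictedSet σ p e b c ∩ thetaSet' σ p b c a) : a = d := by
  rw [muPrimeJd_eq_typeWeight c (Fact.out : p.Prime).pos hd] at h
  exact eq_of_typeWeight_mem c hσ hk hb he ha (Or.inr (by rwa [compl_compl])) h

end Decomposition

/-! ### The tame character on inertia -/

section Residue

variable {p : ℕ} [Fact p.Prime]

/-- The ring of integers of the algebraic closure of `ℚ_p`. -/
abbrev integers (p : ℕ) [Fact p.Prime] : ValuationSubring (PadicAlgCl p) :=
  (Valued.v : Valuation (PadicAlgCl p) ℝ≥0).valuationSubring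

theorem mem_integers {x : PadicAlgCl p} : x ∈ integers p ↔ ‖x‖ ≤ 1 := Iff.rfl

theorem residue_integers_eq_iff {x y : integers p} :
    IsLocalRing.residue (integers p) x = IsLocalRing.residue (integers p) y ↔
      ‖(x : PadicAlgCl p) - y‖ < 1 :=
  Ideal.Quotient.eq.trans (Valuation.mem_maximalIdeal_iff _ _)

variable (E : IntermediateField ℚ_[p] (PadicAlgCl p))

/-- The Galois action on the ring of integers of the algebraic closure. -/
instance integersAction : MulSemiringAction (absGal E) (integers p) where
  smul g x := ⟨g x, mem_integers.2 ((norm_absGal g x).trans_le x.2)⟩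
  one_smul _ := rfl
  mul_smul _ _ _ := rfl
  smul_zero g := Subtype.ext (map_zero g)
  smul_add g _ _ := Subtype.ext (map_add g _ _)
  smul_one g := Subtype.ext (map_one g)
  smul_mul g _ _ := Subtype.ext (map_mul g _ _)

instance isGalois_padicAlgCl : IsGalois E (PadicAlgCl p) :=
  have : IsAlgClosure E (PadicAlgCl p) := ⟨inferInstance, inferInstance⟩
  inferInstance

/-- The ring of integers of the fixed field of `absGal E`, as a subring of `integers p`. -/
abbrev fixedIntegers : Subring (integers p) := FixedPoints.subring (integers p) (absGal E)

theorem mem_of_mem_fixedIntegers {x : integers p} (hx : x ∈ fixedIntegers E) :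
    (x : PadicAlgCl p) ∈ E := by
  obtain ⟨y, hy⟩ := (InfiniteGalois.mem_range_algebraMap_iff_fixed (k := E)
    (x : PadicAlgCl p)).2 fun g => congrArg Subtype.val (hx g)
  exact hy ▸ y.2

instance smulCommClass_fixedIntegers :
    SMulCommClass (absGal E) (fixedIntegers E) (integers p) where
  smul_comm g a b := (smul_mul' g a.1 b).trans (congrArg (· * g • b) (a.2 g))

instance isInvariant_fixedIntegers :
    Algebra.IsInvariant (fixedIntegers E) (integers p) (absGal E) where
  isInvariant b hb := ⟨⟨b, hb⟩, rfl⟩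

theorem continuousSMul_integers [TopologicalSpace (integers p)] [DiscreteTopology (integers p)] :
    ContinuousSMul (absGal E) (integers p) := by
  refine continuousSMul_iff_stabilizer_isOpen.2 fun x => ?_
  convert stabilizer_isOpen_of_isIntegral (K := E) (x : PadicAlgCl p) using 2
  ext g
  exact Subtype.ext_iff

variable {E}

theorem exists_smul_residue_eq
    (τ : IsLocalRing.ResidueField (integers p) ≃+* IsLocalRing.ResidueField (integers p))
    (hτ : ∀ x ∈ fixedIntegers E,
      τ (IsLocalRing.residue (integers p) x) = IsLocalRing.residue (integers p) x) :
    ∃ g : absGal E, ∀ x : integers p,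
      IsLocalRing.residue (integers p) (g • x) = τ (IsLocalRing.residue (integers p) x) := by
  let _ : TopologicalSpace (integers p) := ⊥
  have : DiscreteTopology (integers p) := ⟨rfl⟩
  have := continuousSMul_integers E
  let Q := IsLocalRing.maximalIdeal (integers p)
  let P := Q.under (fixedIntegers E)
  have hP : ∀ a : fixedIntegers E ⧸ P, τ (algebraMap (fixedIntegers E ⧸ P) (integers p ⧸ Q) a) =
      algebraMap (fixedIntegers E ⧸ P) (integers p ⧸ Q) a :=
    Ideal.Quotient.mk_surjective.forall.2 fun a => hτ a a.2
  obtain ⟨g, hg⟩ := Ideal.Quotient.stabilizerHom_surjective_of_profinite (G := absGal E) P Q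
    (AlgEquiv.ofRingEquiv (f := τ) hP)
  exact ⟨g, fun x => congrArg (fun φ => φ (Ideal.Quotient.mk Q x)) hg⟩

theorem exists_absGal_norm_sub_lt {L : IntermediateField ℚ_[p] (PadicAlgCl p)} (h : absGal L)
    (hE : ∀ x ∈ E, ‖x‖ ≤ 1 → ‖h x - x‖ < 1) :
    ∃ g : absGal E, ∀ x, ‖x‖ ≤ 1 → ‖g x - h x‖ < 1 := by
  let τ := MulSemiringAction.toRingEquiv (absGal L) (IsLocalRing.ResidueField (integers p)) h
  have hτ (x : integers p) : τ (IsLocalRing.residue (integers p) x) =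
      IsLocalRing.residue (integers p) (h • x) :=
    (IsLocalRing.ResidueField.residue_smul (absGal L) h x).symm
  obtain ⟨g, hg⟩ := exists_smul_residue_eq (E := E) τ fun x hx =>
    (hτ x).trans (residue_integers_eq_iff.2 (hE x (mem_of_mem_fixedIntegers E hx) x.2))
  refine ⟨g, fun x hx => ?_⟩
  have hgx := (hg ⟨x, mem_integers.2 hx⟩).trans (hτ _)
  rwa [residue_integers_eq_iff] at hgx

end Residue

section Tame

open Polynomial IntermediateField

variable {p : ℕ} [Fact p.Prime] {L : IntermediateField ℚ_[p] (PadicAlgCl p)} {f e : ℕ}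
  {π : PadicAlgCl p}

theorem residue_eq_zero_iff_norm_lt_one (u : ringOfIntegers L) :
    IsLocalRing.residue (ringOfIntegers L) u = 0 ↔ ‖((u : L) : PadicAlgCl p)‖ < 1 :=
  (IsLocalRing.residue_eq_zero_iff u).trans (Valuation.mem_maximalIdeal_iff _ _)

theorem exists_pow_eq_one_norm_sub_lt {N : ℕ} (hN : 0 < N) {u : PadicAlgCl p}
    (hu : ‖u ^ N - 1‖ < 1) : ∃ ζ : PadicAlgCl p, ζ ^ N = 1 ∧ ‖ζ - u‖ < 1 := by
  have hmon : (X ^ N - C (1 : PadicAlgCl p)).Monic := monic_X_pow_sub_C _ hN.ne'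
  have hprod := congrArg (eval u)
    ((IsAlgClosed.splits (X ^ N - C (1 : PadicAlgCl p))).eq_prod_roots_of_monic hmon)
  simp only [eval_multiset_prod, eval_sub, eval_pow, eval_X, eval_C, Multiset.map_map,
    Function.comp_def] at hprod
  by_contra! hfar
  refine absurd hu (not_lt.2 ?_)
  rw [hprod]
  refine Multiset.prod_induction (fun y => 1 ≤ ‖y‖) _ (fun a b ha hb => ?_) (by simp)
    fun y hy => ?_
  · rw [norm_mul]
    exact one_le_mul_of_one_le_of_one_le ha hb
  · obtain ⟨ζ, hζ, rfl⟩ := Multiset.mem_map.1 hy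
    rw [norm_sub_rev]
    exact hfar ζ (by simpa [IsRoot, sub_eq_zero] using (mem_roots hmon.ne_zero).1 hζ)

namespace IsLocalSetting

variable (hL : IsLocalSetting L f e π)

include hL

theorem finite_residueField : Finite (residueField L) :=
  Nat.finite_of_card_ne_zero <| by
    rw [hL.card_residueField]
    exact pow_ne_zero _ (Fact.out : p.Prime).ne_zero

theorem one_lt_pow : 1 < p ^ f := by
  have := hL.finite_residueField
  rw [← hL.card_residueField]
  exact Finite.one_lt_card

theorem norm_lt_one : ‖π‖ < 1 := by
  by_contra! h
  have hlt := hL.norm_pow_lt_one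
  rw [norm_pow] at hlt
  exact absurd (one_le_pow₀ h) hlt.not_ge

theorem norm_pos : 0 < ‖π‖ :=
  norm_pos_iff.2 hL.ne_zero

theorem ramification_pos : 0 < e := by
  refine Nat.pos_of_ne_zero fun he => ?_
  have hnorm := hL.ramification
  rw [he, pow_zero, ← PadicAlgCl.valuation_coe, PadicAlgCl.valuation_p] at hnorm
  have : (p : ℝ) = 1 := by simpa [eq_comm] using hnorm
  exact (Fact.out : p.Prime).ne_one (by exact_mod_cast this)

theorem exists_norm_eq {x : PadicAlgCl p} (hx : x ∈ L) (hx0 : x ≠ 0) :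
    ∃ z : ℤ, ‖x‖ = ‖π‖ ^ (((p ^ f - 1 : ℕ) : ℤ) * z) := by
  have hlt := hL.norm_pow_lt_one
  have hpos : 0 < ‖π ^ (p ^ f - 1)‖ := norm_pos_iff.2 (pow_ne_zero _ hL.ne_zero)
  obtain ⟨n, hn, hn'⟩ := exists_mem_Ioc_zpow (norm_pos_iff.2 hx0) ((one_lt_inv₀ hpos).2 hlt)
  rw [inv_zpow] at hn hn'
  refine ⟨-(n + 1), ?_⟩
  rw [zpow_mul, zpow_natCast, ← norm_pow, zpow_neg]
  refine le_antisymm hn' (not_lt.1 fun hx1 => hn.not_ge ?_)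
  -- otherwise `x * (π ^ (p ^ f - 1)) ^ (n + 1)` has norm strictly between the two largest
  -- norms `‖π ^ (p ^ f - 1)‖` and `1` of integers of `L`
  have hle := hL.norm_le _ (mul_mem hx (zpow_mem hL.pow_mem (n + 1))) (by
    rwa [norm_mul, norm_zpow, ← lt_div_iff₀ (zpow_pos hpos _), one_div])
  rw [norm_mul, norm_zpow, zpow_add_one₀ hpos.ne', ← mul_assoc,
    mul_le_iff_le_one_left hpos] at hle
  rwa [← one_div, le_div_iff₀ (zpow_pos hpos _)]

theorem norm_mul_pow_ne {x y : PadicAlgCl p} (hx : x ∈ L) (hy : y ∈ L) (hx0 : x ≠ 0)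
    (hy0 : y ≠ 0) {i j : ℕ} (hi : i < p ^ f - 1) (hj : j < p ^ f - 1) (hij : i ≠ j) :
    ‖x * π ^ i‖ ≠ ‖y * π ^ j‖ := by
  obtain ⟨z, hz⟩ := hL.exists_norm_eq hx hx0
  obtain ⟨w, hw⟩ := hL.exists_norm_eq hy hy0
  intro h
  rw [norm_mul, norm_mul, norm_pow, norm_pow, hz, hw, ← zpow_natCast, ← zpow_natCast,
    ← zpow_add₀ hL.norm_pos.ne', ← zpow_add₀ hL.norm_pos.ne'] at h
  have hexp := zpow_right_injective₀ hL.norm_pos hL.norm_lt_one.ne h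
  have hdvd : ((p ^ f - 1 : ℕ) : ℤ) ∣ i - j := ⟨w - z, by linear_combination hexp⟩
  have := Int.eq_zero_of_abs_lt_dvd hdvd (by rw [abs_lt]; lia)
  lia

theorem norm_coeff_le {P : L[X]} (hP : P.natDegree < p ^ f - 1) (i : ℕ) :
    ‖((P.coeff i : L) : PadicAlgCl p) * π ^ i‖ ≤ ‖aeval π P‖ := by
  set T : ℕ → PadicAlgCl p := fun i => ((P.coeff i : L) : PadicAlgCl p) * π ^ i with hT
  have hsum : aeval π P = ∑ i ∈ Finset.range (p ^ f - 1), T i := aeval_eq_sum_range' hP π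
  obtain ⟨k, hk, hmax⟩ := Finset.exists_max_image (Finset.range (p ^ f - 1)) (fun i => ‖T i‖)
    ⟨0, Finset.mem_range.2 (by lia)⟩
  have hi : ‖T i‖ ≤ ‖T k‖ := by
    by_cases hi : i < p ^ f - 1
    · exact hmax i (Finset.mem_range.2 hi)
    · rw [show T i = 0 by simp [hT, coeff_eq_zero_of_natDegree_lt (by lia : P.natDegree < i)],
        norm_zero]
      exact norm_nonneg _
  refine hi.trans ?_
  by_cases hk0 : T k = 0
  · simp [hk0]
  rw [hsum]
  refine (IsNonarchimedean.apply_sum_eq_of_lt (f := fun x : PadicAlgCl p => ‖x‖)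
    (PadicAlgCl.isNonarchimedean p) (fun a => (norm_neg a).symm) hk fun j hj hjk => ?_).ge
  refine lt_of_le_of_ne (hmax j hj) fun h => ?_
  have hj0 : T j ≠ 0 := fun hj0 => hk0 (norm_eq_zero.1 (h.symm.trans (by rw [hj0, norm_zero])))
  exact hL.norm_mul_pow_ne (P.coeff j).2 (P.coeff k).2
    (left_ne_zero_of_mul hj0) (left_ne_zero_of_mul hk0)
    (Finset.mem_range.1 hj) (Finset.mem_range.1 hk) hjk h

theorem minpoly_eq :
    minpoly L π = X ^ (p ^ f - 1) - C (⟨π ^ (p ^ f - 1), hL.pow_mem⟩ : L) := by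
  have hq := hL.one_lt_pow
  refine (minpoly.unique _ _ (monic_X_pow_sub_C _ (by lia)) ?_ fun Q hQ hQ0 => ?_).symm
  · rw [map_sub, map_pow, aeval_X, aeval_C]
    exact sub_self _
  rw [degree_X_pow_sub_C (by lia), degree_eq_natDegree hQ.ne_zero, Nat.cast_le]
  by_contra! hdeg
  have hle := hL.norm_coeff_le hdeg Q.natDegree
  rw [hQ.coeff_natDegree, hQ0, norm_zero, norm_le_zero_iff, OneMemClass.coe_one, one_mul] at hle
  exact pow_ne_zero _ hL.ne_zero hle

theorem exists_aeval_eq {x : PadicAlgCl p} (hx : x ∈ L⟮π⟯) :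
    ∃ P : L[X], P.natDegree < p ^ f - 1 ∧ aeval π P = x := by
  obtain ⟨P, hP, hPx⟩ :=
    (adjoin.powerBasis (Algebra.IsIntegral.isIntegral (R := L) π)).exists_eq_aeval ⟨x, hx⟩
  refine ⟨P, ?_, ?_⟩
  · rwa [adjoin.powerBasis_dim, hL.minpoly_eq, natDegree_X_pow_sub_C] at hP
  · rw [adjoin.powerBasis_gen] at hPx
    simpa [aeval_coe] using (congrArg Subtype.val hPx).symm

theorem exists_norm_sub_lt {x : PadicAlgCl p} (hx : x ∈ L⟮π⟯) (hx1 : ‖x‖ ≤ 1) :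
    ∃ y ∈ L, ‖x - y‖ < 1 := by
  obtain ⟨P, hP, rfl⟩ := hL.exists_aeval_eq hx
  refine ⟨P.coeff 0, (P.coeff 0).2, ?_⟩
  have hsum : aeval π P - (P.coeff 0 : L) = ∑ i ∈ Finset.range (p ^ f - 1 - 1),
      ((P.coeff (i + 1) : L) : PadicAlgCl p) * π ^ (i + 1) := by
    rw [aeval_eq_sum_range' hP, ← Nat.sub_add_cancel (show 1 ≤ p ^ f - 1 by lia),
      Finset.sum_range_succ', pow_zero, Algebra.smul_def, mul_one, Nat.add_sub_cancel]
    exact add_sub_cancel_right _ _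
  rw [hsum]
  refine Finset.sum_induction _ (‖·‖ < 1)
    (fun a b ha hb => (IsUltrametricDist.norm_add_le_max a b).trans_lt (max_lt ha hb))
    (by simp) fun i hi => ?_
  by_cases hi0 : P.coeff (i + 1) = 0
  · simp [hi0]
  have hi := Finset.mem_range.1 hi
  refine lt_of_le_of_ne ((hL.norm_coeff_le hP (i + 1)).trans hx1) ?_
  simpa using hL.norm_mul_pow_ne (j := 0) (P.coeff (i + 1)).2 (one_mem L) (by simpa using hi0)
    one_ne_zero (by lia) (by lia) i.succ_ne_zero

theorem tameCharacter_eq {g : absGal L} {u : ringOfIntegers L}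
    (hu : ‖g π / π - ((u : L) : PadicAlgCl p)‖ < 1) :
    tameCharacter L π g = IsLocalRing.residue (ringOfIntegers L) u := by
  have hex := hL.exists_residue g
  rw [tameCharacter, dif_pos hex, ← sub_eq_zero, ← map_sub, residue_eq_zero_iff_norm_lt_one]
  have hchoose := hex.choose_spec
  rw [norm_sub_rev] at hchoose
  have hlt := (IsUltrametricDist.norm_add_le_max _ _).trans_lt (max_lt hchoose hu)
  rwa [sub_add_sub_cancel] at hlt

theorem tameCharacter_ne_zero (g : absGal L) : tameCharacter L π g ≠ 0 := by
  obtain ⟨u, hu⟩ := hL.exists_residue g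
  rw [hL.tameCharacter_eq hu, Ne, residue_eq_zero_iff_norm_lt_one]
  intro hu1
  have hlt := (IsUltrametricDist.norm_add_le_max _ _).trans_lt (max_lt hu hu1)
  rw [sub_add_cancel, norm_div, norm_absGal, div_self hL.norm_pos.ne'] at hlt
  exact lt_irrefl _ hlt

theorem norm_pow_sub_one_lt {u : ringOfIntegers L}
    (hu : IsLocalRing.residue (ringOfIntegers L) u ≠ 0) :
    ‖((u : L) : PadicAlgCl p) ^ (p ^ f - 1) - 1‖ < 1 := by
  have := hL.finite_residueField
  have := Fintype.ofFinite (residueField L)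
  have hpow := FiniteField.pow_card_sub_one_eq_one _ hu
  rwa [← Nat.card_eq_fintype_card, hL.card_residueField, ← map_pow, ← sub_eq_zero,
    ← map_one (IsLocalRing.residue (ringOfIntegers L)), ← map_sub,
    residue_eq_zero_iff_norm_lt_one] at hpow

theorem exists_absGal_apply_eq_mul {ζ : PadicAlgCl p} (hζ : ζ ^ (p ^ f - 1) = 1) :
    ∃ h : absGal L, h π = ζ * π := by
  have hconj : IsConjRoot L π (ζ * π) := by
    refine isConjRoot_of_aeval_eq_zero (Algebra.IsIntegral.isIntegral π) ?_
    rw [hL.minpoly_eq, map_sub, map_pow, aeval_X, aeval_C, mul_pow, hζ, one_mul]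
    exact sub_self _
  exact hconj.symm.exists_algEquiv

theorem exists_mem_inertia_apply_eq (h : absGal L) : ∃ g ∈ inertia L, g π = h π := by
  -- `h` is trivial on the residue field of `L(π)`, so it agrees on the residue field of the
  -- algebraic closure with an automorphism fixing `π`
  have hres : ∀ y ∈ L⟮π⟯.restrictScalars ℚ_[p], ‖y‖ ≤ 1 → ‖h y - y‖ < 1 := fun y hy hy1 => by
    obtain ⟨z, hz, hyz⟩ := hL.exists_norm_sub_lt hy hy1
    have hsplit : h y - y = h (y - z) + (z - y) := by
      rw [map_sub, show h z = z from h.commutes ⟨z, hz⟩]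
      ring
    rw [hsplit]
    refine (IsUltrametricDist.norm_add_le_max _ _).trans_lt (max_lt ?_ ?_)
    · rwa [norm_absGal]
    · rwa [norm_sub_rev]
  obtain ⟨g, hg⟩ := exists_absGal_norm_sub_lt h hres
  let g' : absGal L := AlgEquiv.ofRingEquiv (f := g.toRingEquiv)
    fun y => g.commutes ⟨y, (L⟮π⟯).algebraMap_mem y⟩
  have hg'π : g'⁻¹ π = π := g'.symm_apply_eq.2
    (g.commutes ⟨π, mem_adjoin_simple_self L π⟩ : g π = π).symm
  refine ⟨h * g'⁻¹, fun y hy => ?_, by rw [AlgEquiv.mul_apply, hg'π]⟩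
  have hlt : ‖g' (g'⁻¹ y) - h (g'⁻¹ y)‖ < 1 := hg (g'⁻¹ y) (by rwa [norm_absGal])
  rwa [show g' (g'⁻¹ y) = y from g'.apply_symm_apply y, norm_sub_rev] at hlt

theorem exists_tameCharacter_eq {x : residueField L} (hx : x ≠ 0) :
    ∃ g ∈ inertia L, tameCharacter L π g = x := by
  have hq := hL.one_lt_pow
  obtain ⟨u, rfl⟩ := IsLocalRing.residue_surjective x
  obtain ⟨ζ, hζ, hζu⟩ := exists_pow_eq_one_norm_sub_lt (by lia) (hL.norm_pow_sub_one_lt hx)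
  obtain ⟨h, hh⟩ := hL.exists_absGal_apply_eq_mul hζ
  obtain ⟨g, hg, hgh⟩ := hL.exists_mem_inertia_apply_eq h
  refine ⟨g, hg, hL.tameCharacter_eq ?_⟩
  rwa [hgh, hh, mul_div_cancel_right₀ _ hL.ne_zero]

end IsLocalSetting

end Tame

section Inertia

variable {p : ℕ} [Fact p.Prime] {L : IntermediateField ℚ_[p] (PadicAlgCl p)} {f e : ℕ} [NeZero f]
  {π : PadicAlgCl p} (hL : IsLocalSetting L f e π) {F : Type*} [Field F]
  {σ : ZMod f → residueField L →+* F} (hσ : ∀ i x, σ (i + 1) x ^ p = σ i x)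

include hL hσ

theorem EqOnInertia.iff_expCong {χ : absGal L →* Fˣ} {s t : ZMod f → ℤ}
    (h : EqOnInertia σ π χ t) : EqOnInertia σ π χ s ↔ ExpCong p s t := by
  refine Iff.trans ?_ (prod_embedding_eq_iff hσ hL.card_residueField s t)
  constructor
  · intro hs x hx
    obtain ⟨g, hg, rfl⟩ := hL.exists_tameCharacter_eq hx
    rw [← hs g hg, h g hg]
  · intro hst g hg
    rw [h g hg, hst _ (hL.tameCharacter_ne_zero g)]

theorem setW'_eq_predictedSet {χ₁ χ₂ : absGal L →* Fˣ} {b c : ZMod f → ℤ}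
    (hgen : EqOnInertia σ π (χ₁⁻¹ * χ₂) (fun i => b i + e)) (hc : EqOnInertia σ π χ₁ c) :
    setW' σ e π χ₁ χ₂ = predictedSet σ p e b c := by
  have hχ₂ : EqOnInertia σ π χ₂ (fun i => c i + (b i + e)) := fun g hg => by
    rw [show χ₂ g = χ₁ g * (χ₁⁻¹ * χ₂) g by simp, Units.val_mul, hc g hg, hgen g hg,
      ← Finset.prod_mul_distrib]
    exact Finset.prod_congr rfl fun i _ =>
      (zpow_add₀ ((map_ne_zero _).2 (hL.tameCharacter_ne_zero g)) _ _).symm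
  unfold setW' predictedSet
  simp only [hχ₂.iff_expCong hL hσ, hc.iff_expCong hL hσ]

end Inertia

end SerreWeights

end

open SerreWeights in
theorem proposition3p3_general
    (p : ℕ) [Fact p.Prime] (L : IntermediateField ℚ_[p] (PadicAlgCl p))
    (f e : ℕ) [NeZero f] (π : PadicAlgCl p) (hL : IsLocalSetting L f e π)
    (F : Type*) [Field F] (σ : ZMod f → residueField L →+* F)
    (hσ : ∀ i x, σ (i + 1) x ^ p = σ i x) (χ₁ χ₂ : absGal L →* Fˣ) (b c : ZMod f → ℤ)
    (hb : ∀ i, (e : ℤ) ≤ b i + e ∧ b i + e ≤ p - 1 - e)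
    (hgen : EqOnInertia σ π (χ₁⁻¹ * χ₂) (fun i => b i + e))
    (hc : EqOnInertia σ π χ₁ c) :
    (setW σ p e b c = ⋃ a ∈ setA f e, setWa σ e π χ₁ χ₂ b c a) ∧
    (setA f e).PairwiseDisjoint (fun a => setWa σ e π χ₁ χ₂ b c a) ∧
    (setW' σ e π χ₁ χ₂ = ⋃ a ∈ setA f e, setWa' σ e π χ₁ χ₂ b c a) ∧
    (setA f e).PairwiseDisjoint (fun a => setWa' σ e π χ₁ χ₂ b c a) ∧
    (∀ a ∈ setA f e, (setWa σ e π χ₁ χ₂ b c a).ncard = 2 ^ (f - delta e a)) ∧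
    (∀ a ∈ setA f e, ∀ J d, Admissible e J d →
      muJd σ p b c J d ∈ setWa' σ e π χ₁ χ₂ b c a → ∑ i, a i = ∑ i, d i) ∧
    (∀ a ∈ setA f e, ∀ J d, Exceptional p e b J d →
      muPrimeJd σ p e c J ∈ setWa' σ e π χ₁ χ₂ b c a → ∑ i, a i = ∑ i, d i) := by
  have hk := hL.card_residueField
  have he := hL.ramification_pos
  have hW' := setW'_eq_predictedSet hL hσ hgen hc
  have hWa a : setWa σ e π χ₁ χ₂ b c a = predictedSet σ p e b c ∩ thetaSet σ p b c a := hW' ▸ rfl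
  have hWa' a : setWa' σ e π χ₁ χ₂ b c a = predictedSet σ p e b c ∩ thetaSet' σ p b c a :=
    hW' ▸ rfl
  simp only [hW', hWa, hWa']
  exact ⟨setW_eq_biUnion c hσ hk hb he,
    pairwiseDisjoint_predictedSet_inter_thetaSet c hσ hk hb he,
    predictedSet_eq_biUnion c hσ hk hb he,
    pairwiseDisjoint_predictedSet_inter_thetaSet' c hσ hk hb he,
    fun a ha => ncard_predictedSet_inter_thetaSet c hσ hk hb he ha,
    fun a ha J d hd h => sum_eq_of_muJd_mem c hσ hk hb he ha hd h,
    fun a ha J d hd h => by rw [eq_of_muPrimeJd_mem c hσ hk hb he ha hd h]⟩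

open SerreWeights in
theorem proposition3p3
    (p : ℕ) [Fact p.Prime] (hp : p ≠ 2)
    (L : IntermediateField ℚ_[p] (PadicAlgCl p)) [FiniteDimensional ℚ_[p] L]
    (f e : ℕ) [NeZero f] (π : PadicAlgCl p) (hL : IsLocalSetting L f e π)
    (F : Type*) [Field F] [Finite F] [TopologicalSpace F] [DiscreteTopology F]
    (σ : ZMod f → residueField L →+* F) (hσ : ∀ i x, σ (i + 1) x ^ p = σ i x)
    (ρ : absGal L →* GL (Fin 2) F) (hρ : Continuous ρ)
    (χ₁ χ₂ : absGal L →* Fˣ)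
    (hχ : ∃ P : GL (Fin 2) F, ∀ g, ∃ u : F,
      (P * ρ g * P⁻¹).1 = !![(χ₂ g : F), u; 0, (χ₁ g : F)])
    (b c : ZMod f → ℤ)
    (hb : ∀ i, (e : ℤ) ≤ b i + e ∧ b i + e ≤ p - 1 - e)
    (hgen : EqOnInertia σ π (χ₁⁻¹ * χ₂) (fun i => b i + e))
    (hc : EqOnInertia σ π χ₁ c) :
    (setW σ p e b c = ⋃ a ∈ setA f e, setWa σ e π χ₁ χ₂ b c a) ∧
    (setA f e).PairwiseDisjoint (fun a => setWa σ e π χ₁ χ₂ b c a) ∧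
    (setW' σ e π χ₁ χ₂ = ⋃ a ∈ setA f e, setWa' σ e π χ₁ χ₂ b c a) ∧
    (setA f e).PairwiseDisjoint (fun a => setWa' σ e π χ₁ χ₂ b c a) ∧
    (∀ a ∈ setA f e, (setWa σ e π χ₁ χ₂ b c a).ncard = 2 ^ (f - delta e a)) ∧
    (∀ a ∈ setA f e, ∀ J d, Admissible e J d →
      muJd σ p b c J d ∈ setWa' σ e π χ₁ χ₂ b c a → ∑ i, a i = ∑ i, d i) ∧
    (∀ a ∈ setA f e, ∀ J d, Exceptional p e b J d →
      muPrimeJd σ p e c J ∈ setWa' σ e π χ₁ χ₂ b c a → ∑ i, a i = ∑ i, d i) :=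
  proposition3p3_general p L f e π hL F σ hσ χ₁ χ₂ b c hb hgen hc
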